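/- Two players bargain over a unit surplus in continuous time. A bargaining game is a tuple $B=(a_1,a_2,z_1,z_2,r_1,r_2,\gamma_1,c_1,k_2,w_1)$ with $a_1,a_2\in(0,1)$, $D:=a_1+a_2-1>0$, $z_1,z_2\in(0,1)$, $r_1,r_2>0$, $\gamma_1\ge 0$, $0\le w_1<c_1<1$ and $0<k_2<1-w_1$. Player $i$ is justified with probability $z_i$, and unjustified (strategic) otherwise. A justified player never concedes; a justified player 1 challenges at Poisson rate $\gamma_1$, and a justified player 2 always sees a challenge. A strategy of an unjustified player 1 consists of right-continuous nondecreasing functions $F_1,G_1:[0,\infty)\to[0,1]$ with $F_1+G_1\le 1$ (probabilities of having conceded, resp. challenged, by time $t$). A strategy of an unjustified player 2 consists of a right-continuous nondecreasing $F_2:[0,\infty)\to[0,1]$ (concession) and a measurable $q_2:[0,\infty)\to[0,1]$ (probability of yielding to a challenge at time $t$). Integrals with respect to $dF_i$ and $dG_1$ include the atom at time $0$. With $F(t^-)$ the left limit ($F(0^-)=0$), the unjustified players' expected utilities are as follows. Player 1, conceding at $t$: $$U_1(t)=(1-z_2)\int_{[0,t)}a_1e^{-r_1s}dF_2(s)+[1-(1-z_2)F_2(t)]e^{-r_1t}(1-a_2)+(1-z_2)[F_2(t)-F_2(t^-)]e^{-r_1t}\tfrac{a_1+1-a_2}{2}.$$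 Player 1, challenging at $t$: $$V_1(t)=(1-z_2)\int_{[0,t]}a_1e^{-r_1s}dF_2(s)+[1-(1-z_2)F_2(t)]e^{-r_1t}(1-a_2-c_1D)+(1-z_2)[1-F_2(t)]e^{-r_1t}[(1-q_2(t))w_1+q_2(t)]D.$$ Player 2, conceding at $t$: $$\begin{aligned}U_2(t)=\;&(1-z_1)\int_{[0,t)}a_2e^{-r_2s}dF_1(s)+z_1\int_0^t[1-a_1-(1-q_2(s))k_2D]e^{-r_2s}\gamma_1e^{-\gamma_1s}ds\\&+(1-z_1)\int_{[0,t)}\{1-a_1+[1-q_2(s)][1-w_1-k_2]D\}e^{-r_2s}dG_1(s)\\&+e^{-r_2t}(1-a_1)[1-(1-z_1)F_1(t)-(1-z_1)G_1(t^-)-z_1(1-e^{-\gamma_1t})]\\&+(1-z_1)[F_1(t)-F_1(t^-)]e^{-r_2t}\tfrac{a_2+1-a_1}{2}.\end{aligned}$$ The payoffs are $u_1=\int U_1dF_1+\int V_1dG_1$ and $u_2=\int U_2dF_2$. An equilibrium is a profile in which each strategy maximizes the player's own payoff given the opponent's strategy. Let $\lambda_1=r_2(1-a_1)/D$, $\lambda_2=r_1(1-a_2)/D$,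 $\nu_1^*=1-\frac{k_2}{1-w_1}$, $\mu_2^*=1-c_1$. The reputation coevolution curve is, for $\mu_2\in(0,1]$ and $\gamma_1\ne\lambda_1$, $$\widetilde\mu_1(\mu_2)=\begin{cases}\dfrac{\lambda_1-\gamma_1}{\lambda_1\mu_2^{(\gamma_1-\lambda_1)/\lambda_2}-\gamma_1}&\mu_2>\mu_2^*,\\[2ex]\dfrac{\lambda_1-\gamma_1}{\lambda_1\mu_2^{(\gamma_1-\lambda_1)/\lambda_2}+\left(\frac{\gamma_1}{\nu_1^*}-\gamma_1\right)\left(\frac{\mu_2}{\mu_2^*}\right)^{(\gamma_1-\lambda_1)/\lambda_2}-\frac{\gamma_1}{\nu_1^*}}&\mu_2\le\mu_2^*,\end{cases}$$ and, for $\gamma_1=\lambda_1$, the limit of this expression: $\widetilde\mu_1(\mu_2)=\left[1-\frac{\gamma_1}{\lambda_2}\log\mu_2\right]^{-1}$ if $\mu_2>\mu_2^*$ and $\widetilde\mu_1(\mu_2)=\left[1-\frac{\gamma_1}{\lambda_2}\log\mu_2^*-\frac{\gamma_1}{\nu_1^*\lambda_2}\log\frac{\mu_2}{\mu_2^*}\right]^{-1}$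 if $\mu_2\le\mu_2^*$. Let $\mu_1^N=\widetilde\mu_1(\mu_2^*)$, and let $\widetilde\mu_2$ be the inverse of $\widetilde\mu_1$, set to $0$ at reputations below the range of $\widetilde\mu_1$. **Proposition.** Every game $B$ has exactly one pair of equilibrium payoffs $(u_1,u_2)$. Primes denote the payoffs and the curve of the new game $B'$ obtained by changing one parameter; both games satisfy the restrictions above. 1. Let $\{i,j\}=\{1,2\}$, and let $z_i$ increase or $r_i$ decrease. Then $u_i'\ge u_i$ and $u_j'\le u_j$. If $z_i\ge\widetilde\mu_i(z_j)$, then $u_i'>u_i$ and $u_j'=u_j$. If $z_i<\widetilde\mu_i(z_j)$, then $u_j'<u_j$. If $z_i'\le\widetilde\mu_i'(z_j)$, then $u_i'=u_i$. 2. Let $c_1$ increase, or $k_2$ decrease, or $w_1$ decrease. Then $u_1'\le u_1$ and $u_2'\ge u_2$. If $\gamma_1>0$ and $\widetilde\mu_1(z_2)<z_1<\mu_1^N$, then $u_1'<u_1$; otherwise $u_1'=u_1$. If $\gamma_1>0$ and $\widetilde\mu_2(z_1)\le z_2<\mu_2^*$, then $u_2'>u_2$. If $\gamma_1=0$, or $z_2\ge\mu_2^*$,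 or $z_2\le\widetilde\mu_2'(z_1)$, then $u_2'=u_2$. 3. If $z_1<\widetilde\mu_1(z_2)$, then $u_1$ does not change under sufficiently small changes of $z_1$ or of $r_1$. If $z_2<\widetilde\mu_2(z_1)$, then $u_2$ does not change under sufficiently small changes of any one of $z_2,r_2,c_1,k_2,w_1$. -/

import Mathlib

open MeasureTheory Filter Topology

noncomputable section

/-- The parameters of a bargaining game with one-sided ultimatum and single demand types. -/
structure BargainingGame where
  /-- justified demands -/
  a₁ : ℝ
  a₂ : ℝ
  /-- prior probabilities of being justified -/
  z₁ : ℝ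
  z₂ : ℝ
  /-- discount rates -/
  r₁ : ℝ
  r₂ : ℝ
  /-- arrival rate of challenge opportunities for a justified player 1 -/
  γ₁ : ℝ
  /-- cost of challenging, as a proportion of the conflicting difference -/
  c₁ : ℝ
  /-- cost of seeing a challenge, as a proportion of the conflicting difference -/
  k₂ : ℝ
  /-- winning probability in court of an unjustified player 1 against an unjustified player 2 -/
  w₁ : ℝ

namespace BargainingGame

/-- The standing assumptions on the parameters. -/
structure Valid (B : BargainingGame) : Prop where
  a₁_pos : 0 < B.a₁
  a₁_lt_one : B.a₁ < 1
  a₂_lt_one : B.a₂ < 1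
  conflict : 1 - B.a₁ < B.a₂
  z₁_pos : 0 < B.z₁
  z₁_lt_one : B.z₁ < 1
  z₂_pos : 0 < B.z₂
  z₂_lt_one : B.z₂ < 1
  r₁_pos : 0 < B.r₁
  r₂_pos : 0 < B.r₂
  γ₁_nonneg : 0 ≤ B.γ₁
  w₁_nonneg : 0 ≤ B.w₁
  w₁_lt_c₁ : B.w₁ < B.c₁
  c₁_lt_one : B.c₁ < 1
  k₂_pos : 0 < B.k₂
  k₂_lt : B.k₂ < 1 - B.w₁

variable (B : BargainingGame)

/-- The amount of disagreement. -/
def D : ℝ := B.a₁ + B.a₂ - 1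

/-! ### The game -/

/-- A strategy of an unjustified player 1: `F t` and `G t` are the probabilities of having conceded,
respectively challenged, by time `t` (inclusive). A `StieltjesFunction` is nondecreasing and
right-continuous; vanishing at negative times makes the associated measure carry an atom of mass
`F 0` at time zero. -/
structure Strategy₁ where
  F : StieltjesFunction ℝ
  G : StieltjesFunction ℝ
  F_neg : ∀ t < 0, F t = 0
  G_neg : ∀ t < 0, G t = 0
  add_le_one : ∀ t, F t + G t ≤ 1

/-- A strategy of an unjustified player 2: `F t` is the probability of having conceded by time `t`
and `q t` the probability of yielding to a challenge made at time `t`. -/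
structure Strategy₂ where
  F : StieltjesFunction ℝ
  F_neg : ∀ t < 0, F t = 0
  F_le_one : ∀ t, F t ≤ 1
  q : ℝ → ℝ
  q_meas : Measurable q
  q_nonneg : ∀ t, 0 ≤ q t
  q_le_one : ∀ t, q t ≤ 1

/-- Expected utility of an unjustified player 1 from conceding at time `t`. Simultaneous concessions
lead to an equal split, so the first integral runs over the concessions of player 2 strictly
before `t`. -/
def concedeUtility₁ (S₂ : Strategy₂) (t : ℝ) : ℝ :=
  (1 - B.z₂) * (∫ s in Set.Ico 0 t, B.a₁ * Real.exp (-B.r₁ * s) ∂S₂.F.measure)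
  + (1 - (1 - B.z₂) * S₂.F t) * Real.exp (-B.r₁ * t) * (1 - B.a₂)
  + (1 - B.z₂) * (S₂.F t - Function.leftLim S₂.F t) * Real.exp (-B.r₁ * t)
      * ((B.a₁ + 1 - B.a₂) / 2)

/-- Expected utility of an unjustified player 1 from challenging at time `t`. If player 2 concedes
at the time of the challenge, the concession determines the outcome. -/
def challengeUtility₁ (S₂ : Strategy₂) (t : ℝ) : ℝ :=
  (1 - B.z₂) * (∫ s in Set.Icc 0 t, B.a₁ * Real.exp (-B.r₁ * s) ∂S₂.F.measure)
  + (1 - (1 - B.z₂) * S₂.F t) * Real.exp (-B.r₁ * t) * (1 - B.a₂ - B.c₁ * B.D)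
  + (1 - B.z₂) * (1 - S₂.F t) * Real.exp (-B.r₁ * t)
      * (((1 - S₂.q t) * B.w₁ + S₂.q t) * B.D)

/-- Expected utility of an unjustified player 1 from a strategy profile. -/
def utility₁ (S₁ : Strategy₁) (S₂ : Strategy₂) : ℝ :=
  (∫ t, B.concedeUtility₁ S₂ t ∂S₁.F.measure) + ∫ t, B.challengeUtility₁ S₂ t ∂S₁.G.measure

/-- Expected utility of an unjustified player 2 from conceding at time `t` and yielding to
challenges according to `q`. The four lines up to the last are: player 1 conceded before `t`; a
justified player 1 challenged before `t`; an unjustified player 1 challenged before `t`; neither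
happened and player 2 concedes alone. The last line is a simultaneous concession. -/
def concedeUtility₂ (S₁ : Strategy₁) (q : ℝ → ℝ) (t : ℝ) : ℝ :=
  (1 - B.z₁) * (∫ s in Set.Ico 0 t, B.a₂ * Real.exp (-B.r₂ * s) ∂S₁.F.measure)
  + B.z₁ * (∫ s in Set.Ico 0 t, (1 - B.a₁ - (1 - q s) * B.k₂ * B.D) * Real.exp (-B.r₂ * s)
      * (B.γ₁ * Real.exp (-B.γ₁ * s)))
  + (1 - B.z₁) * (∫ s in Set.Ico 0 t,
      (1 - B.a₁ + (1 - q s) * (1 - B.w₁ - B.k₂) * B.D) * Real.exp (-B.r₂ * s) ∂S₁.G.measure)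
  + Real.exp (-B.r₂ * t) * (1 - B.a₁)
      * (1 - (1 - B.z₁) * S₁.F t - (1 - B.z₁) * Function.leftLim S₁.G t
          - B.z₁ * (1 - Real.exp (-B.γ₁ * t)))
  + (1 - B.z₁) * (S₁.F t - Function.leftLim S₁.F t) * Real.exp (-B.r₂ * t)
      * ((B.a₂ + 1 - B.a₁) / 2)

/-- Expected utility of an unjustified player 2 from a strategy profile. -/
def utility₂ (S₁ : Strategy₁) (S₂ : Strategy₂) : ℝ :=
  ∫ t, B.concedeUtility₂ S₁ S₂.q t ∂S₂.F.measure

/-- Bayesian Nash equilibrium. -/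
def IsEquilibrium (S₁ : Strategy₁) (S₂ : Strategy₂) : Prop :=
  (∀ S₁' : Strategy₁, B.utility₁ S₁' S₂ ≤ B.utility₁ S₁ S₂) ∧
  (∀ S₂' : Strategy₂, B.utility₂ S₁ S₂' ≤ B.utility₂ S₁ S₂)

/-- The pair `p` is the pair of (unjustified) players' payoffs in some equilibrium. -/
def IsEquilibriumPayoff (p : ℝ × ℝ) : Prop :=
  ∃ S₁ S₂, B.IsEquilibrium S₁ S₂ ∧ p = (B.utility₁ S₁ S₂, B.utility₂ S₁ S₂)

/-! ### The reputation coevolution curve -/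

/-- Overall concession rate of player 1. -/
def lam₁ : ℝ := B.r₂ * (1 - B.a₁) / B.D

/-- Overall concession rate of player 2. -/
def lam₂ : ℝ := B.r₁ * (1 - B.a₂) / B.D

/-- Reputation of a challenging player 1 that makes player 2 indifferent between yielding to and
seeing the challenge. -/
def nuStar₁ : ℝ := 1 - B.k₂ / (1 - B.w₁)

/-- Reputation of player 2 above which an unjustified player 1 does not challenge. -/
def muStar₂ : ℝ := 1 - B.c₁

/-- The reputation coevolution curve, as reputation of player 1 in terms of the reputation
`x ∈ (0, 1]` of player 2. -/
def muTilde₁ (x : ℝ) : ℝ :=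
  if B.γ₁ = B.lam₁ then
    if B.muStar₂ < x then
      1 / (1 - B.γ₁ / B.lam₂ * Real.log x)
    else
      1 / (1 - B.γ₁ / B.lam₂ * Real.log B.muStar₂
        - B.γ₁ / B.nuStar₁ / B.lam₂ * Real.log (x / B.muStar₂))
  else
    if B.muStar₂ < x then
      (B.lam₁ - B.γ₁) / (B.lam₁ * x ^ ((B.γ₁ - B.lam₁) / B.lam₂) - B.γ₁)
    else
      (B.lam₁ - B.γ₁) / (B.lam₁ * x ^ ((B.γ₁ - B.lam₁) / B.lam₂)
        + (B.γ₁ / B.nuStar₁ - B.γ₁) * (x / B.muStar₂) ^ ((B.γ₁ - B.lam₁) / B.lam₂)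
        - B.γ₁ / B.nuStar₁)

/-- The inverse of the (continuous, strictly increasing) function `muTilde₁` on `(0, 1]`: reputation
of player 2 in terms of the reputation `m` of player 1. It is extended by `0` (the supremum of the
empty set) to those `m` that lie below all values of `muTilde₁` on `(0, 1]`. -/
def muTilde₂ (m : ℝ) : ℝ := sSup {x | 0 < x ∧ x ≤ 1 ∧ B.muTilde₁ x ≤ m}

/-- Reputation of player 1 when the reputation of player 2 is `muStar₂`. -/
def muN₁ : ℝ := B.muTilde₁ B.muStar₂

/-! ### Parameter changes -/

/-- `B'` arises from `B` by an increase of `z₁` or a decrease of `r₁`. -/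
def Favors₁ (B B' : BargainingGame) : Prop :=
  (∃ z, B.z₁ < z ∧ B' = { B with z₁ := z }) ∨ (∃ r, r < B.r₁ ∧ B' = { B with r₁ := r })

/-- `B'` arises from `B` by an increase of `z₂` or a decrease of `r₂`. -/
def Favors₂ (B B' : BargainingGame) : Prop :=
  (∃ z, B.z₂ < z ∧ B' = { B with z₂ := z }) ∨ (∃ r, r < B.r₂ ∧ B' = { B with r₂ := r })

/-- `B'` arises from `B` by an increase of `c₁`, a decrease of `k₂`, or a decrease of `w₁`. -/
def CourtAgainst₁ (B B' : BargainingGame) : Prop :=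
  (∃ c, B.c₁ < c ∧ B' = { B with c₁ := c }) ∨ (∃ k, k < B.k₂ ∧ B' = { B with k₂ := k }) ∨
  (∃ w, w < B.w₁ ∧ B' = { B with w₁ := w })

end BargainingGame

end

/-!
The equilibrium payoffs have a closed form (`payoff₁`, `payoff₂`), from which the comparative statics
are read off.

*Uniqueness.* After an integration by parts, the utility from conceding at time `t` is affine in
`netGain`, a function of the overall concession distribution of the opponent and the probability
that the interaction lasts, corrected by half of the opponent's jump at `t` (`concedeUtility₁_eq`,
`concedeUtility₂_eq`). Comparison with the deviations to a single time shows that in equilibrium every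
time in the support is optimal. An interval without concessions of the opponent makes waiting
strictly worse, so the support of the concessions has no gaps (`waiting_value_eq_of_lt`), and both
`netGain`s are constant until a common time `T`. Hence player 2 concedes at the overall rate
`lam₂`. Player 2 may answer challenges in any way, so court costs him nothing on balance, and player 1
challenges only while player 2's reputation is below `muStar₂`, at the rate that makes player 2
indifferent. The survival probability of player 1 then solves a linear differential equation, whose
solution is given by `rho`, the reciprocal of the coevolution curve in the time left
(`muTilde₁_eq`). Since the reputations reach one at the same time and at most one player concedes at
time zero, the time-zero concessions, and with them the payoffs, are determined
(`IsEquilibrium.utility_eq_payoff`).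

*Existence.* The strategies found in this way form an equilibrium (`isEquilibrium_path`).

*Comparative statics.* The function `rho` is built from integrals `expInt` that are monotone in the
rates, so the coevolution curve moves monotonically with `r₁`, `r₂` and the court parameters, and
does not depend on `z₁` and `z₂`. Each payoff is monotone in the ratio of the opponent's reputation
required by the curve to the one he has, as long as this ratio exceeds one, and constant otherwise
(`payoff_of_favors₁`, `payoff_of_favors₂`, `payoff_of_courtAgainst₁`); the statements on small changes
follow from the continuity of the curve (`tendsto_muTilde₁`).
-/

section

open Set

/-! ### Stieltjes functions carried by the nonnegative half-line -/

namespace StieltjesFunction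

variable {F : StieltjesFunction ℝ}

lemma leftLim_le (F : StieltjesFunction ℝ) (t : ℝ) : Function.leftLim F t ≤ F t :=
  F.mono.leftLim_le le_rfl

/-- Almost every point lies in `(-∞, T]`, if the function is constant from `T` on. -/
lemma ae_le {T : ℝ} (h : ∀ s, T ≤ s → F s = F T) :
    ∀ᵐ t ∂F.measure, t ≤ T := by
  rw [ae_iff]
  have : {t : ℝ | ¬ t ≤ T} = Ioi T := by ext; simp
  rw [this]
  have h1 : Tendsto F atTop (𝓝 (F T)) := by
    refine tendsto_const_nhds.congr' ?_
    filter_upwards [eventually_ge_atTop T] with s hs using (h s hs).symm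
  rw [F.measure_Ioi h1]; simp

/-- A property that holds almost everywhere holds somewhere on every interval on which the function
increases. -/
lemma exists_of_lt {p : ℝ → Prop} (hp : ∀ᵐ t ∂F.measure, p t) {s t : ℝ} (h : F s < F t) :
    ∃ u ∈ Ioc s t, p u := by
  by_contra! hcon
  have h0 : F.measure (Ioc s t) = 0 := measure_mono_null (fun u hu => hcon u hu) (ae_iff.1 hp)
  rw [F.measure_Ioc, ENNReal.ofReal_eq_zero] at h0
  linarith

/-- Splitting off the atom at the right end point. -/
lemma setIntegral_Icc {f : ℝ → ℝ} (hf : Integrable f F.measure) {t : ℝ}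
    (ht : 0 ≤ t) : ∫ s in Icc 0 t, f s ∂F.measure
      = (∫ s in Ico 0 t, f s ∂F.measure) + (F t - Function.leftLim F t) * f t := by
  rw [← Ico_union_right ht, setIntegral_union (by simp) (measurableSet_singleton t)
    hf.integrableOn hf.integrableOn]
  congr 1
  rw [integral_singleton, Measure.real, F.measure_singleton,
    ENNReal.toReal_ofReal (by linarith [leftLim_le F t]), smul_eq_mul]

/-- A distribution function of a possibly defective probability measure on `[0, ∞)`. -/
structure IsSubDist (F : StieltjesFunction ℝ) : Prop where
  eq_zero : ∀ t < 0, F t = 0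
  le_one : ∀ t, F t ≤ 1

namespace IsSubDist

lemma nonneg (hF : F.IsSubDist) (t : ℝ) : 0 ≤ F t := by
  have h := F.mono (min_le_left t (-1))
  rwa [hF.eq_zero _ (lt_of_le_of_lt (min_le_right _ _) (by norm_num))] at h

lemma tendsto_atBot (hF : F.IsSubDist) : Tendsto F atBot (𝓝 0) := by
  refine tendsto_const_nhds.congr' ?_
  filter_upwards [eventually_lt_atBot 0] with t ht using (hF.eq_zero t ht).symm

lemma measure_Iic (hF : F.IsSubDist) (t : ℝ) : F.measure (Iic t) = ENNReal.ofReal (F t) := by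
  rw [F.measure_Iic hF.tendsto_atBot, sub_zero]

lemma isFiniteMeasure (hF : F.IsSubDist) : IsFiniteMeasure F.measure :=
  F.isFiniteMeasure_of_forall_abs_le (C := 1) fun x => by
    rw [abs_of_nonneg (hF.nonneg x)]; exact hF.le_one x

lemma leftLim_zero (hF : F.IsSubDist) : Function.leftLim F 0 = 0 := by
  refine leftLim_eq_of_tendsto (tendsto_const_nhds.congr' ?_)
  filter_upwards [self_mem_nhdsWithin] with t ht using (hF.eq_zero t ht).symm

lemma ae_nonneg (hF : F.IsSubDist) : ∀ᵐ t ∂F.measure, 0 ≤ t := by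
  rw [ae_iff]
  have : {t : ℝ | ¬ 0 ≤ t} = Iio 0 := by ext; simp
  rw [this, F.measure_Iio hF.tendsto_atBot, hF.leftLim_zero]; simp

lemma measureReal_Icc (hF : F.IsSubDist) (t : ℝ) :
    F.measure.real (Icc 0 t) = F t := by
  rw [Measure.real, F.measure_Icc, hF.leftLim_zero, sub_zero, ENNReal.toReal_ofReal (hF.nonneg t)]

lemma measureReal_univ_le (hF : F.IsSubDist) {c : ℝ} (h : ∀ t, F t ≤ c) :
    F.measure.real univ ≤ c := by
  have h0 : 0 ≤ c := (hF.nonneg 0).trans (h 0)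
  refine ENNReal.toReal_le_of_le_ofReal h0 ?_
  have hmono : Monotone fun n : ℕ => (Iic (n : ℝ)) := fun a b h => Iic_subset_Iic.2 (by exact_mod_cast h)
  have hU : (⋃ n : ℕ, Iic (n : ℝ)) = univ := by
    ext x; simpa using exists_nat_ge x
  rw [← hU, hmono.measure_iUnion]
  exact iSup_le fun n => by rw [hF.measure_Iic]; exact ENNReal.ofReal_le_ofReal (h n)

lemma le_measureReal_univ (hF : F.IsSubDist) (t : ℝ) : F t ≤ F.measure.real univ := by
  have := hF.isFiniteMeasure
  have h : F.measure.real (Iic t) ≤ F.measure.real univ := measureReal_mono (subset_univ _)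
  rwa [Measure.real, hF.measure_Iic, ENNReal.toReal_ofReal (hF.nonneg t)] at h

/-- If the measure of `F` gives no mass to `(t, ∞)`, then all of it is reached at `t`. -/
lemma eq_measureReal_univ (hF : F.IsSubDist) {t : ℝ} (h : ∀ s, t ≤ s → F s = F t) :
    F.measure.real univ = F t := by
  refine le_antisymm (hF.measureReal_univ_le fun s => ?_) (hF.le_measureReal_univ t)
  rcases le_total s t with hs | hs
  · exact F.mono hs
  · exact (h s hs).le

lemma ae_ne (hF : F.IsSubDist) (h : F 0 = 0) : ∀ᵐ t ∂F.measure, t ≠ 0 := by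
  rw [ae_iff]
  have : {t : ℝ | ¬ t ≠ 0} = {0} := by ext; simp
  rw [this, F.measure_singleton, hF.leftLim_zero, h]; simp

lemma integrable_of_le (hF : F.IsSubDist) {f : ℝ → ℝ} (hf : Measurable f) {C : ℝ}
    (hC : ∀ t, 0 ≤ t → |f t| ≤ C) : Integrable f F.measure := by
  have := hF.isFiniteMeasure
  refine Integrable.of_bound hf.aestronglyMeasurable C ?_
  filter_upwards [hF.ae_nonneg] with t ht using hC t ht

lemma integrable_exp (hF : F.IsSubDist) {r : ℝ} (hr : 0 ≤ r) :
    Integrable (fun s => Real.exp (-r * s)) F.measure :=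
  hF.integrable_of_le (by fun_prop) (C := 1) fun t ht => by
    rw [abs_of_pos (Real.exp_pos _), Real.exp_le_one_iff]; nlinarith [mul_nonneg hr ht]

/-- Integration by parts against an exponential. -/
lemma setIntegral_exp (hF : F.IsSubDist) (r : ℝ) {t : ℝ} (ht : 0 ≤ t) :
    ∫ s in Icc 0 t, Real.exp (-r * s) ∂F.measure
      = Real.exp (-r * t) * F t + ∫ s in 0..t, r * (Real.exp (-r * s) * F s) := by
  have := hF.isFiniteMeasure
  set μ := F.measure.restrict (Icc 0 t) with hμ
  set ν := (volume : Measure ℝ).restrict (Ioc 0 t) with hν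
  let k : ℝ × ℝ → ℝ := fun p => if p.1 ≤ p.2 then r * Real.exp (-r * p.2) else 0
  have hkm : Measurable k :=
    Measurable.ite (measurableSet_le measurable_fst measurable_snd) (by fun_prop) (by fun_prop)
  obtain ⟨C, hC⟩ : ∃ C, ∀ u ∈ Icc 0 t, |r * Real.exp (-r * u)| ≤ C :=
    isCompact_Icc.exists_bound_of_continuousOn (f := fun u => r * Real.exp (-r * u)) (by fun_prop)
  have hC0 : 0 ≤ C := (abs_nonneg _).trans (hC 0 ⟨le_rfl, ht⟩)
  have hki : Integrable (fun p : ℝ × ℝ => k p) (μ.prod ν) := by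
    refine Integrable.of_bound hkm.aestronglyMeasurable C ?_
    have h2 : ∀ᵐ p ∂(μ.prod ν), p.2 ∈ Ioc 0 t :=
      Measure.quasiMeasurePreserving_snd.ae (ae_restrict_mem measurableSet_Ioc)
    filter_upwards [h2] with p hp
    simp only [k]
    split_ifs
    · exact hC _ ⟨hp.1.le, hp.2⟩
    · simpa using hC0
  have hswap := integral_integral_swap (f := fun s u => k (s, u)) hki
  have hinner : ∀ s ∈ Icc 0 t, ∫ u, k (s, u) ∂ν = Real.exp (-r * s) - Real.exp (-r * t) := by
    intro s hs
    have h1 : ∫ u, k (s, u) ∂ν = ∫ u in s..t, r * Real.exp (-r * u) := by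
      rw [intervalIntegral.integral_of_le hs.2, hν, ← integral_indicator measurableSet_Ioc,
        ← integral_indicator measurableSet_Ioc]
      refine integral_congr_ae ?_
      filter_upwards [compl_mem_ae_iff.2 (MeasureTheory.measure_singleton s)] with u hu
      have hu : u ≠ s := hu
      simp only [indicator, mem_Ioc, k]
      by_cases h : s ≤ u
      · have h' := lt_of_le_of_ne h hu.symm
        have h'' := lt_of_le_of_lt hs.1 h'
        simp [h, h', h'']
      · have h' : ¬ s < u := fun h' => h h'.le
        simp [h, h']
    rw [h1, intervalIntegral.integral_eq_sub_of_hasDerivAt (f := fun u => -Real.exp (-r * u))]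
    · ring
    · intro u _
      have h2 : HasDerivAt (fun u => -r * u) (-r) u := by
        simpa using (hasDerivAt_id u).const_mul (-r)
      exact (show HasDerivAt (fun u => -Real.exp (-r * u)) _ u from h2.exp.neg).congr_deriv (by ring)
    · exact Continuous.intervalIntegrable (by fun_prop) _ _
  have houter : ∀ u ∈ Ioc 0 t, ∫ s, k (s, u) ∂μ = r * Real.exp (-r * u) * F u := by
    intro u hu
    have h1 : (fun s => k (s, u)) = (Iic u).indicator fun _ => r * Real.exp (-r * u) := by
      ext s; simp [k, indicator]
    rw [h1, integral_indicator measurableSet_Iic, setIntegral_const, hμ, measureReal_restrict_apply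
      measurableSet_Iic]
    have : Iic u ∩ Icc 0 t = Icc 0 u := by
      ext s; simp only [mem_inter_iff, mem_Iic, mem_Icc]; constructor
      · rintro ⟨a, b, _⟩; exact ⟨b, a⟩
      · rintro ⟨a, b⟩; exact ⟨b, a, b.trans hu.2⟩
    rw [this, hF.measureReal_Icc u, smul_eq_mul]; ring
  have hL : ∫ s, ∫ u, k (s, u) ∂ν ∂μ
      = (∫ s in Icc 0 t, Real.exp (-r * s) ∂F.measure) - Real.exp (-r * t) * F t := by
    have hint : Integrable (fun s => Real.exp (-r * s)) μ :=
      (Continuous.continuousOn (by fun_prop)).integrableOn_compact isCompact_Icc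
    rw [hμ, setIntegral_congr_fun measurableSet_Icc hinner, integral_sub hint (integrable_const _),
      setIntegral_const, hF.measureReal_Icc t, smul_eq_mul]; ring
  have hR : ∫ u, ∫ s, k (s, u) ∂μ ∂ν = ∫ s in 0..t, r * (Real.exp (-r * s) * F s) := by
    rw [hν, setIntegral_congr_fun measurableSet_Ioc houter, intervalIntegral.integral_of_le ht]
    refine integral_congr_ae (Eventually.of_forall fun u => ?_)
    simp only; ring
  rw [hL, hR] at hswap
  linarith

end IsSubDist

/-- The unit mass at `t`. -/
noncomputable def unitMass (t : ℝ) : StieltjesFunction ℝ := ProbabilityTheory.cdf (Measure.dirac t)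

lemma measure_unitMass (t : ℝ) : (unitMass t).measure = Measure.dirac t :=
  ProbabilityTheory.measure_cdf _

lemma unitMass_le_one (t s : ℝ) : unitMass t s ≤ 1 := ProbabilityTheory.cdf_le_one _ _

lemma unitMass_neg {t : ℝ} (ht : 0 ≤ t) (s : ℝ) (hs : s < 0) : unitMass t s = 0 := by
  rw [unitMass, ProbabilityTheory.cdf_eq_real, Measure.real, Measure.dirac_apply' _ measurableSet_Iic]
  have : ¬ t ≤ s := by linarith
  simp [this]

/-- The restriction of a continuous nondecreasing function on `[0, ∞)`, extended by zero, so that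
the measure has an atom of mass `f 0` at zero. -/
noncomputable def ofContinuousOn (f : ℝ → ℝ) (hm : MonotoneOn f (Ici 0)) (hc : ContinuousOn f (Ici 0))
    (h0 : 0 ≤ f 0) : StieltjesFunction ℝ where
  toFun t := if t < 0 then 0 else f t
  mono' := by
    intro s t hst
    dsimp only
    split_ifs with h1 h2 h2
    · exact le_rfl
    · exact h0.trans (hm (by simp) (not_lt.1 h2) (not_lt.1 h2))
    · exact absurd (hst.trans_lt h2) h1
    · exact hm (not_lt.1 h1) (not_lt.1 h2) hst
  right_continuous' := by
    intro t
    rcases lt_or_ge t 0 with ht | ht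
    · refine ContinuousAt.continuousWithinAt ?_
      refine (continuousAt_const (y := (0 : ℝ))).congr ?_
      filter_upwards [Iio_mem_nhds ht] with s hs
      simp [show s < 0 from hs]
    · refine ((hc t ht).mono (Ici_subset_Ici.2 ht)).congr (fun s hs => ?_) ?_
      · simp [not_lt.2 (ht.trans hs)]
      · simp [not_lt.2 ht]

section ofContinuousOn

variable {f : ℝ → ℝ} {hm : MonotoneOn f (Ici 0)} {hc : ContinuousOn f (Ici 0)} {h0 : 0 ≤ f 0}

lemma ofContinuousOn_of_nonneg {t : ℝ} (ht : 0 ≤ t) : ofContinuousOn f hm hc h0 t = f t :=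
  if_neg (not_lt.2 ht)

lemma ofContinuousOn_of_neg {t : ℝ} (ht : t < 0) : ofContinuousOn f hm hc h0 t = 0 :=
  if_pos ht

lemma ofContinuousOn_isSubDist (h1 : ∀ t, 0 ≤ t → f t ≤ 1) :
    (ofContinuousOn f hm hc h0).IsSubDist where
  eq_zero _ ht := ofContinuousOn_of_neg ht
  le_one t := by
    rcases lt_or_ge t 0 with ht | ht
    · rw [ofContinuousOn_of_neg ht]; norm_num
    · rw [ofContinuousOn_of_nonneg ht]; exact h1 t ht

lemma leftLim_ofContinuousOn {t : ℝ} (ht : 0 < t) :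
    Function.leftLim (ofContinuousOn f hm hc h0) t = f t := by
  refine leftLim_eq_of_tendsto ?_
  have h : Tendsto f (𝓝[<] t) (𝓝 (f t)) :=
    ((hc t ht.le).continuousAt (Ici_mem_nhds ht)).tendsto.mono_left nhdsWithin_le_nhds
  refine h.congr' ?_
  filter_upwards [nhdsWithin_le_nhds (Ioi_mem_nhds ht)] with s hs
  rw [ofContinuousOn_of_nonneg (le_of_lt hs)]

end ofContinuousOn

end StieltjesFunction

/-- A function bounded by `c` almost everywhere, whose integral is as large as the bound allows,
equals `c` almost everywhere. Measurability is not needed: a non-integrable function has integral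
zero, which is less than the bound unless the measure vanishes. -/
lemma ae_eq_of_integral_eq {μ : Measure ℝ} [IsFiniteMeasure μ] {f : ℝ → ℝ} {c : ℝ} (hc : 0 < c)
    (hf : ∀ᵐ t ∂μ, f t ≤ c) (h : c * μ.real Set.univ ≤ ∫ t, f t ∂μ) : ∀ᵐ t ∂μ, f t = c := by
  by_cases hμ : μ = 0
  · simp [hμ]
  have hpos : 0 < μ.real Set.univ := by
    rw [Measure.real, ENNReal.toReal_pos_iff]
    exact ⟨(Measure.measure_univ_pos.2 hμ), measure_lt_top _ _⟩
  have hi : Integrable f μ := by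
    by_contra hi
    rw [integral_undef hi] at h
    nlinarith [mul_pos hc hpos]
  have h2 : ∫ t, (c - f t) ∂μ = 0 := by
    refine le_antisymm ?_ (integral_nonneg_of_ae (hf.mono fun t ht => sub_nonneg.2 ht))
    rw [integral_sub (integrable_const c) hi]; simp; linarith [mul_comm c (μ.real Set.univ)]
  rw [integral_eq_zero_iff_of_nonneg_ae (hf.mono fun t ht => sub_nonneg.2 ht)
    ((integrable_const c).sub hi)] at h2
  filter_upwards [h2] with t ht
  have : c - f t = 0 := ht
  linarith

lemma integral_le_of_ae_le {μ : Measure ℝ} [IsFiniteMeasure μ] {f : ℝ → ℝ} {c : ℝ} (hc : 0 ≤ c)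
    (hf : ∀ᵐ t ∂μ, f t ≤ c) : ∫ t, f t ∂μ ≤ c * μ.real Set.univ := by
  by_cases hi : Integrable f μ
  · refine (integral_mono_ae hi (integrable_const c) hf).trans ?_
    simp [mul_comm]
  · rw [integral_undef hi]; positivity

/-! ### The gain from waiting -/

/-- The normalized gain from waiting until just after time `t` and then conceding, against an
opponent who has conceded with probability `P t` by time `t`, while the interaction goes on with
probability `S t`. Integrated by parts, it is the sum of the discounted concessions of the opponent
minus `lam` times the discounted survival probability: it is stationary as long as the opponent
concedes at the overall rate `lam`. -/
noncomputable def netGain (r lam : ℝ) (P S : ℝ → ℝ) (t : ℝ) : ℝ :=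
  Real.exp (-r * t) * P t + ∫ s in 0..t, Real.exp (-r * s) * (r * P s - lam * S s)

section netGain

variable {r lam : ℝ} {P S : ℝ → ℝ}

lemma netGain_zero : netGain r lam P S 0 = P 0 := by simp [netGain]

lemma netGain_intervalIntegrable (hP : Monotone P) (hS : Antitone S) (a b : ℝ) :
    IntervalIntegrable (fun s => Real.exp (-r * s) * (r * P s - lam * S s)) volume a b :=
  ((hP.intervalIntegrable.const_mul r).sub (hS.intervalIntegrable.const_mul lam)).continuousOn_mul
    (Continuous.continuousOn (by fun_prop))

lemma continuous_netGain_integral (hP : Monotone P) (hS : Antitone S) :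
    Continuous fun t => ∫ s in 0..t, Real.exp (-r * s) * (r * P s - lam * S s) :=
  intervalIntegral.continuous_primitive (fun a b => netGain_intervalIntegrable hP hS a b) 0

lemma continuousWithinAt_netGain (hP : Monotone P) (hS : Antitone S) {t : ℝ} {s : Set ℝ}
    (h : ContinuousWithinAt P s t) : ContinuousWithinAt (netGain r lam P S) s t :=
  (ContinuousWithinAt.mul (Continuous.continuousWithinAt (by fun_prop)) h).add
    (continuous_netGain_integral hP hS).continuousWithinAt

/-- Waiting is costly while the opponent does not concede. -/
lemma netGain_lt (hP : Monotone P) (hS : Antitone S) (hl : 0 < lam) (hpos : ∀ t, 0 < S t)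
    {s t : ℝ} (hst : s < t) (h : P s = P t) : netGain r lam P S t < netGain r lam P S s := by
  have h1 : netGain r lam P S t - netGain r lam P S s
      = (Real.exp (-r * t) - Real.exp (-r * s)) * P s
        + ∫ u in s..t, Real.exp (-r * u) * (r * P u - lam * S u) := by
    rw [← intervalIntegral.integral_interval_sub_left (netGain_intervalIntegrable hP hS 0 t)
      (netGain_intervalIntegrable hP hS 0 s), netGain, netGain, h]
    ring
  have hi : IntervalIntegrable (fun u => Real.exp (-r * u) * S u) volume s t :=
    hS.intervalIntegrable.continuousOn_mul (Continuous.continuousOn (by fun_prop))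
  have h2 : ∫ u in s..t, Real.exp (-r * u) * (r * P u - lam * S u)
      = (∫ u in s..t, r * Real.exp (-r * u)) * P s - lam * ∫ u in s..t, Real.exp (-r * u) * S u := by
    rw [← intervalIntegral.integral_const_mul, ← intervalIntegral.integral_mul_const,
      ← intervalIntegral.integral_sub (Continuous.intervalIntegrable (by fun_prop) _ _)
        (hi.const_mul lam)]
    refine intervalIntegral.integral_congr fun u hu => ?_
    rw [uIcc_of_le hst.le] at hu
    have : P u = P s := le_antisymm ((hP hu.2).trans h.ge) (hP hu.1)
    simp only [this]; ring
  have h3 : ∫ u in s..t, r * Real.exp (-r * u) = Real.exp (-r * s) - Real.exp (-r * t) := by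
    rw [intervalIntegral.integral_eq_sub_of_hasDerivAt (f := fun u => -Real.exp (-r * u))]
    · ring
    · intro u _
      have h2 : HasDerivAt (fun u => -r * u) (-r) u := by
        simpa using (hasDerivAt_id u).const_mul (-r)
      exact (show HasDerivAt (fun u => -Real.exp (-r * u)) _ u from h2.exp.neg).congr_deriv (by ring)
    · exact Continuous.intervalIntegrable (by fun_prop) _ _
  have h4 : 0 < ∫ u in s..t, Real.exp (-r * u) * S u :=
    intervalIntegral.intervalIntegral_pos_of_pos_on hi
      (fun u _ => mul_pos (Real.exp_pos _) (hpos u)) hst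
  have h5 := mul_pos hl h4
  rw [h2, h3] at h1
  linarith

lemma hasDerivWithinAt_netGain_integral (hP : Monotone P) (hS : Antitone S) {t : ℝ}
    (hPc : ContinuousWithinAt P (Ici t) t) (hSc : ContinuousWithinAt S (Ici t) t) :
    HasDerivWithinAt (fun t => ∫ s in 0..t, Real.exp (-r * s) * (r * P s - lam * S s))
      (Real.exp (-r * t) * (r * P t - lam * S t)) (Ici t) t := by
  refine intervalIntegral.integral_hasDerivWithinAt_right (netGain_intervalIntegrable hP hS 0 t)
    (s := Ici t) (t := Ioi t) ?_ ?_
  · have h1 := hP.measurable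
    have h2 := hS.measurable
    have h3 : Measurable fun s => Real.exp (-r * s) * (r * P s - lam * S s) := by fun_prop
    exact h3.stronglyMeasurable.stronglyMeasurableAtFilter
  · refine ContinuousWithinAt.mono ?_ Ioi_subset_Ici_self
    exact ContinuousWithinAt.mul (Continuous.continuousWithinAt (by fun_prop))
      ((continuousWithinAt_const.mul hPc).sub (continuousWithinAt_const.mul hSc))

lemma hasDerivAt_exp_mul (r t : ℝ) :
    HasDerivAt (fun t => Real.exp (r * t)) (r * Real.exp (r * t)) t := by
  have h2 : HasDerivAt (fun u => r * u) r t := by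
    simpa using (hasDerivAt_id t).const_mul r
  exact h2.exp.congr_deriv (by ring)

/-- If waiting neither pays nor costs before `T`, and there is no jump upwards at `T`, then the
opponent's concessions are continuous up to `T`. -/
lemma eqOn_of_netGain_const (hP : Monotone P) (hS : Antitone S) {T : ℝ}
    (hc : ∀ t ∈ Ico 0 T, netGain r lam P S t = P 0) (hT : netGain r lam P S T ≤ P 0) :
    EqOn P (fun t => Real.exp (r * t)
      * (P 0 - ∫ s in 0..t, Real.exp (-r * s) * (r * P s - lam * S s))) (Icc 0 T) := by
  set Q : ℝ → ℝ := fun t => Real.exp (r * t)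
      * (P 0 - ∫ s in 0..t, Real.exp (-r * s) * (r * P s - lam * S s)) with hQ
  have hQc : Continuous Q := by
    have := continuous_netGain_integral (r := r) (lam := lam) hP hS
    fun_prop
  have hexp : ∀ t, Real.exp (r * t) * Real.exp (-r * t) = 1 := fun t => by
    rw [← Real.exp_add]; simp
  have key : ∀ t, P t = Q t + Real.exp (r * t) * (netGain r lam P S t - P 0) := fun t => by
    simp only [hQ, netGain]
    linear_combination (-P t) * hexp t
  have h1 : EqOn P Q (Ico 0 T) := fun t ht => by rw [key t, hc t ht]; ring
  intro t ht
  rcases ht.2.lt_or_eq with h | rfl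
  · exact h1 ⟨ht.1, h⟩
  · rcases ht.1.eq_or_lt with h0 | h0
    · rw [← h0]; simp [hQ]
    refine le_antisymm ?_ ?_
    · rw [key t]
      nlinarith [mul_nonneg (Real.exp_pos (r * t)).le (sub_nonneg.2 hT)]
    · have hlim : Tendsto Q (𝓝[<] t) (𝓝 (Q t)) := hQc.continuousAt.tendsto.mono_left nhdsWithin_le_nhds
      refine le_of_tendsto hlim ?_
      filter_upwards [Ico_mem_nhdsLT h0] with s hs
      rw [← h1 hs]; exact hP hs.2.le

lemma continuousOn_of_netGain_const (hP : Monotone P) (hS : Antitone S) {T : ℝ}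
    (hc : ∀ t ∈ Ico 0 T, netGain r lam P S t = P 0) (hT : netGain r lam P S T ≤ P 0) :
    ContinuousOn P (Icc 0 T) := by
  refine ContinuousOn.congr (Continuous.continuousOn ?_) (eqOn_of_netGain_const hP hS hc hT)
  have := continuous_netGain_integral (r := r) (lam := lam) hP hS
  fun_prop

lemma hasDerivWithinAt_of_netGain_const (hP : Monotone P) (hS : Antitone S) {T : ℝ}
    (hc : ∀ t ∈ Ico 0 T, netGain r lam P S t = P 0) (hT : netGain r lam P S T ≤ P 0) {t : ℝ}
    (ht : t ∈ Ico 0 T) (hPc : ContinuousWithinAt P (Ici t) t)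
    (hSc : ContinuousWithinAt S (Ici t) t) : HasDerivWithinAt P (lam * S t) (Ici t) t := by
  have heq := eqOn_of_netGain_const hP hS hc hT
  have h1 := (hasDerivAt_exp_mul r t).hasDerivWithinAt (s := Ici t) |>.mul
    ((hasDerivWithinAt_netGain_integral (r := r) (lam := lam) hP hS hPc hSc).const_sub (P 0))
  have hexp : Real.exp (r * t) * Real.exp (-r * t) = 1 := by
    rw [← Real.exp_add]; simp
  have h2 := h1.congr_deriv (show _ = lam * S t by
    have := heq ⟨ht.1, ht.2.le⟩
    simp only at this
    linear_combination (-r) * this + (lam * S t - r * P t) * hexp)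
  refine h2.congr_of_eventuallyEq ?_ (heq ⟨ht.1, ht.2.le⟩)
  filter_upwards [Icc_mem_nhdsGE ht.2] with s hs using heq ⟨ht.1.trans hs.1, hs.2⟩

lemma netGain_const_of_hasDerivWithinAt (hP : Monotone P) (hS : Antitone S) {T : ℝ}
    (hPc : ContinuousOn P (Icc 0 T)) (hd : ∀ t ∈ Ico 0 T, HasDerivWithinAt P (lam * S t) (Ici t) t)
    (hSc : ∀ t ∈ Ico 0 T, ContinuousWithinAt S (Ici t) t) {t : ℝ} (ht : t ∈ Icc 0 T) :
    netGain r lam P S t = P 0 := by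
  rw [← netGain_zero (r := r) (lam := lam) (P := P) (S := S)]
  refine constant_of_has_deriv_right_zero (a := 0) (b := T) (fun t ht => ?_) (fun t ht => ?_) t ht
  · exact continuousWithinAt_netGain hP hS (hPc t ht)
  · have h1 := ((hasDerivAt_exp_mul (-r) t).hasDerivWithinAt (s := Ici t) |>.mul (hd t ht)).add
      (hasDerivWithinAt_netGain_integral (r := r) (lam := lam) hP hS (hd t ht).continuousWithinAt
        (hSc t ht))
    exact h1.congr_deriv (by ring)

end netGain

/-! ### Absence of gaps in the concessions -/

lemma exists_Icc_lt_of_continuousWithinAt {W : ℝ → ℝ} {s w : ℝ}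
    (h : ContinuousWithinAt W (Ici s) s) (hlt : W s < w) : ∃ t > s, ∀ u ∈ Icc s t, W u < w := by
  have h1 : ∀ᶠ u in 𝓝[≥] s, W u < w := h.eventually_lt_const hlt
  obtain ⟨t, ht, hsub⟩ := (mem_nhdsGE_iff_exists_Icc_subset).1 h1
  exact ⟨t, ht, fun u hu => hsub hu⟩

/-- Two concession processes, each of which lives where waiting is worth the maximum for the
respective player and never jumps together with the other one, have no gaps. A player whose
opponent pauses loses from waiting, hence pauses as well; a pause can end only by jumps of
both processes. So waiting is worth the maximum for both players until the concessions end. -/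
lemma waiting_value_eq_of_lt {P₁ P₂ W₁ W₂ : ℝ → ℝ} {w₁ w₂ : ℝ} (m₁ : Monotone P₁) (m₂ : Monotone P₂)
    (c₁ : ∀ t, 0 ≤ t → ContinuousWithinAt W₁ (Ici t) t)
    (c₂ : ∀ t, 0 ≤ t → ContinuousWithinAt W₂ (Ici t) t)
    (le₁ : ∀ t, 0 ≤ t → W₁ t ≤ w₁) (le₂ : ∀ t, 0 ≤ t → W₂ t ≤ w₂)
    (dec₁ : ∀ s t, 0 ≤ s → s < t → P₂ s = P₂ t → W₁ t < W₁ s)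
    (dec₂ : ∀ s t, 0 ≤ s → s < t → P₁ s = P₁ t → W₂ t < W₂ s)
    (act₁ : ∀ s t, 0 ≤ s → P₁ s < P₁ t → ∃ u ∈ Ioc s t, W₁ u = w₁ ∧ Function.leftLim P₂ u = P₂ u)
    (act₂ : ∀ s t, 0 ≤ s → P₂ s < P₂ t → ∃ u ∈ Ioc s t, W₂ u = w₂ ∧ Function.leftLim P₁ u = P₁ u)
    {s t' : ℝ} (hs : 0 ≤ s) (h : P₂ s < P₂ t') : W₁ s = w₁ ∧ W₂ s = w₂ := by
  -- While the opponent's process is constant, so is a player's own process.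
  have follow₂ : ∀ t, s ≤ t → P₁ s = P₁ t → P₂ s = P₂ t := by
    intro t hst h1
    by_contra hne
    obtain ⟨u, hu, hw, -⟩ := act₂ s t hs (lt_of_le_of_ne (m₂ hst) hne)
    have := dec₂ s u hs hu.1 (le_antisymm (m₁ hu.1.le) ((m₁ hu.2).trans h1.ge))
    linarith [le₂ s hs]
  have follow₁ : ∀ t, s ≤ t → P₂ s = P₂ t → P₁ s = P₁ t := by
    intro t hst h1
    by_contra hne
    obtain ⟨u, hu, hw, -⟩ := act₁ s t hs (lt_of_le_of_ne (m₁ hst) hne)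
    have := dec₁ s u hs hu.1 (le_antisymm (m₂ hu.1.le) ((m₂ hu.2).trans h1.ge))
    linarith [le₁ s hs]
  have main : ∀ t₀, s < t₀ → P₂ s < P₂ t₀ := by
    intro t₀ hst₀
    by_contra hnot
    have e2 : P₂ s = P₂ t₀ := le_antisymm (m₂ hst₀.le) (not_lt.1 hnot)
    let A : Set ℝ := {t | s ≤ t ∧ P₂ t = P₂ s}
    have hA0 : t₀ ∈ A := ⟨hst₀.le, e2.symm⟩
    have hAb : BddAbove A := ⟨t', fun t ht => by
      by_contra hlt
      have := m₂ (not_le.1 hlt).le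
      linarith [ht.2]⟩
    set τ := sSup A with hτ
    have hsτ : s < τ := hst₀.trans_le (le_csSup hAb hA0)
    have con₂ : ∀ u, s ≤ u → u < τ → P₂ u = P₂ s := by
      intro u hsu hu
      obtain ⟨a, ha, hua⟩ := exists_lt_of_lt_csSup ⟨t₀, hA0⟩ hu
      exact le_antisymm ((m₂ hua.le).trans ha.2.le) (m₂ hsu)
    have con₁ : ∀ u, s ≤ u → u < τ → P₁ u = P₁ s := fun u hsu hu =>
      (follow₁ u hsu (con₂ u hsu hu).symm).symm
    have ll : ∀ {P : ℝ → ℝ}, (∀ u, s ≤ u → u < τ → P u = P s) → Function.leftLim P τ = P s := by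
      intro P hP
      refine leftLim_eq_of_tendsto (tendsto_const_nhds.congr' ?_)
      filter_upwards [Ico_mem_nhdsLT hsτ] with u hu using (hP u hu.1 hu.2).symm
    -- If `P₁` jumped at the end of the pause, `P₂` would not, and waiting would not yet be worth
    -- the maximum for player 1.
    have e1τ : P₁ τ = P₁ s := by
      by_contra hne
      obtain ⟨u, hu, hw, hl⟩ := act₁ s τ hs (lt_of_le_of_ne (m₁ hsτ.le) (Ne.symm hne))
      have hPu : P₂ s = P₂ u := by
        rcases hu.2.lt_or_eq with h' | rfl
        · exact (con₂ u hu.1.le h').symm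
        · rw [← hl, ll con₂]
      linarith [dec₁ s u hs hu.1 hPu, le₁ s hs]
    have e2τ : P₂ τ = P₂ s := (follow₂ τ hsτ.le e1τ.symm).symm
    have hτ0 : 0 ≤ τ := hs.trans hsτ.le
    obtain ⟨a, hτa, hW⟩ := exists_Icc_lt_of_continuousWithinAt (c₂ τ hτ0)
      ((dec₂ s τ hs hsτ e1τ.symm).trans_le (le₂ s hs))
    have hPa : P₂ a = P₂ s := by
      rw [← e2τ]
      by_contra hne
      obtain ⟨u, hu, hw, -⟩ := act₂ τ a hτ0 (lt_of_le_of_ne (m₂ hτa.le) (Ne.symm hne))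
      linarith [hW u ⟨hu.1.le, hu.2⟩]
    have := le_csSup hAb (show a ∈ A from ⟨hsτ.le.trans hτa.le, hPa⟩)
    linarith
  constructor
  · by_contra hne
    obtain ⟨t, hst, hW⟩ := exists_Icc_lt_of_continuousWithinAt (c₁ s hs)
      (lt_of_le_of_ne (le₁ s hs) hne)
    have hP : P₁ s < P₁ t := lt_of_le_of_ne (m₁ hst.le) fun he =>
      (main t hst).ne (follow₂ t hst.le he)
    obtain ⟨u, hu, hw, -⟩ := act₁ s t hs hP
    linarith [hW u ⟨hu.1.le, hu.2⟩]
  · by_contra hne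
    obtain ⟨t, hst, hW⟩ := exists_Icc_lt_of_continuousWithinAt (c₂ s hs)
      (lt_of_le_of_ne (le₂ s hs) hne)
    obtain ⟨u, hu, hw, -⟩ := act₂ s t hs (main t hst)
    linarith [hW u ⟨hu.1.le, hu.2⟩]

lemma integral_mul_exp (r t : ℝ) :
    ∫ s in 0..t, r * Real.exp (-r * s) = 1 - Real.exp (-r * t) := by
  rw [intervalIntegral.integral_eq_sub_of_hasDerivAt (f := fun u => -Real.exp (-r * u))]
  · simp; ring
  · exact fun u _ => (hasDerivAt_exp_mul (-r) u).neg.congr_deriv (by ring)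
  · exact Continuous.intervalIntegrable (by fun_prop) _ _

/-! ### Justified challenges -/

/-- The distribution function of the arrival time of an event with Poisson rate `γ`. -/
noncomputable def arrival (γ : ℝ) (hγ : 0 ≤ γ) : StieltjesFunction ℝ :=
  .ofContinuousOn (fun t => 1 - Real.exp (-γ * t))
    (fun s _ t _ hst => by
      have : Real.exp (-γ * t) ≤ Real.exp (-γ * s) :=
        Real.exp_le_exp.2 (by nlinarith [mul_le_mul_of_nonneg_left hst hγ])
      dsimp only; linarith)
    (Continuous.continuousOn (by fun_prop)) (by simp)

section arrival

variable {γ : ℝ} {hγ : 0 ≤ γ}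

lemma arrival_of_nonneg {t : ℝ} (ht : 0 ≤ t) : arrival γ hγ t = 1 - Real.exp (-γ * t) :=
  StieltjesFunction.ofContinuousOn_of_nonneg ht

lemma arrival_of_neg {t : ℝ} (ht : t < 0) : arrival γ hγ t = 0 :=
  StieltjesFunction.ofContinuousOn_of_neg ht

lemma arrival_isSubDist : (arrival γ hγ).IsSubDist :=
  StieltjesFunction.ofContinuousOn_isSubDist fun t _ => by linarith [Real.exp_pos (-γ * t)]

lemma arrival_lt_one (t : ℝ) : arrival γ hγ t < 1 := by
  rcases lt_or_ge t 0 with ht | ht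
  · rw [arrival_of_neg ht]; norm_num
  · rw [arrival_of_nonneg ht]; linarith [Real.exp_pos (-γ * t)]

lemma leftLim_arrival {t : ℝ} (ht : 0 ≤ t) :
    Function.leftLim (arrival γ hγ) t = arrival γ hγ t := by
  rcases ht.eq_or_lt with rfl | h
  · rw [arrival_isSubDist.leftLim_zero, arrival_of_nonneg le_rfl]; simp
  · rw [arrival_of_nonneg ht]; exact StieltjesFunction.leftLim_ofContinuousOn h

lemma measure_arrival : (arrival γ hγ).measure
    = (volume.restrict (Ici 0)).withDensity fun s => ENNReal.ofReal (γ * Real.exp (-γ * s)) := by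
  have := (arrival_isSubDist (γ := γ) (hγ := hγ)).isFiniteMeasure
  refine Measure.ext_of_Iic _ _ fun a => ?_
  rw [arrival_isSubDist.measure_Iic, withDensity_apply _ measurableSet_Iic,
    Measure.restrict_restrict measurableSet_Iic, inter_comm, Ici_inter_Iic]
  rcases lt_or_ge a 0 with ha | ha
  · rw [arrival_of_neg ha, Icc_eq_empty (not_le.2 ha)]; simp
  · rw [arrival_of_nonneg ha, ← integral_mul_exp, intervalIntegral.integral_of_le ha,
      ← integral_Icc_eq_integral_Ioc, ofReal_integral_eq_lintegral_ofReal]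
    · exact (Continuous.continuousOn (by fun_prop)).integrableOn_compact isCompact_Icc
    · exact Eventually.of_forall fun s => mul_nonneg hγ (Real.exp_pos _).le

lemma setIntegral_arrival (f : ℝ → ℝ) (t : ℝ) :
    ∫ s in Ico 0 t, f s ∂(arrival γ hγ).measure
      = ∫ s in Ico 0 t, f s * (γ * Real.exp (-γ * s)) := by
  rw [measure_arrival, setIntegral_withDensity_eq_setIntegral_toReal_smul₀ (by fun_prop)
    (Eventually.of_forall fun s => ENNReal.ofReal_lt_top) _ measurableSet_Ico,
    Measure.restrict_restrict measurableSet_Ico, inter_eq_left.2 Ico_subset_Ici_self]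
  refine integral_congr_ae (Eventually.of_forall fun s => ?_)
  simp only [smul_eq_mul]
  rw [ENNReal.toReal_ofReal (mul_nonneg hγ (Real.exp_pos _).le), mul_comm]

end arrival

/-! ### Utilities in terms of the gain from waiting -/

/-- The gain from waiting, scaled and with its integrals separated, when the interaction may also
be ended by challenges, with probability `N t` by time `t`. -/
lemma add_mul_netGain {α β δ r lam : ℝ} {P N : ℝ → ℝ} (hP : Monotone P) (hN : Monotone N)
    (h : δ * lam = r * β) (hα : α = δ + β) (t : ℝ) :
    β + δ * netGain r lam P (fun s => 1 - P s - N s) t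
      = δ * (Real.exp (-r * t) * P t) + α * (∫ s in 0..t, r * (Real.exp (-r * s) * P s))
        + β * (∫ s in 0..t, r * (Real.exp (-r * s) * N s)) + β * Real.exp (-r * t) := by
  have hi : ∀ {P : ℝ → ℝ}, Monotone P →
      IntervalIntegrable (fun s => r * (Real.exp (-r * s) * P s)) volume 0 t := fun hP =>
    (hP.intervalIntegrable.continuousOn_mul (Continuous.continuousOn (by fun_prop))).const_mul r
  have h1 : δ * (∫ s in 0..t, Real.exp (-r * s) * (r * P s - lam * (1 - P s - N s)))
      = α * (∫ s in 0..t, r * (Real.exp (-r * s) * P s))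
        + β * (∫ s in 0..t, r * (Real.exp (-r * s) * N s))
        - β * ∫ s in 0..t, r * Real.exp (-r * s) := by
    simp only [← intervalIntegral.integral_const_mul]
    rw [← intervalIntegral.integral_add ((hi hP).const_mul α) ((hi hN).const_mul β),
      ← intervalIntegral.integral_sub (((hi hP).const_mul α).add ((hi hN).const_mul β))
        (Continuous.intervalIntegrable (by fun_prop) _ _)]
    refine intervalIntegral.integral_congr fun s _ => ?_
    simp only [hα]
    linear_combination (-Real.exp (-r * s) * (1 - P s - N s)) * h
  rw [integral_mul_exp] at h1
  rw [netGain, mul_add, h1]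
  ring

namespace BargainingGame

variable {B : BargainingGame}

namespace Valid

lemma D_pos (hB : B.Valid) : 0 < B.D := by have := hB.conflict; unfold D; linarith

lemma lam₁_pos (hB : B.Valid) : 0 < B.lam₁ :=
  div_pos (mul_pos hB.r₂_pos (by linarith [hB.a₁_lt_one])) hB.D_pos

lemma lam₂_pos (hB : B.Valid) : 0 < B.lam₂ :=
  div_pos (mul_pos hB.r₁_pos (by linarith [hB.a₂_lt_one])) hB.D_pos

lemma D_mul_lam₁ (hB : B.Valid) : B.D * B.lam₁ = B.r₂ * (1 - B.a₁) :=
  mul_div_cancel₀ _ hB.D_pos.ne'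

lemma D_mul_lam₂ (hB : B.Valid) : B.D * B.lam₂ = B.r₁ * (1 - B.a₂) :=
  mul_div_cancel₀ _ hB.D_pos.ne'

lemma w₁_lt_one (hB : B.Valid) : B.w₁ < 1 := by linarith [hB.k₂_lt, hB.k₂_pos]

lemma court_pos (hB : B.Valid) : 0 < 1 - B.w₁ - B.k₂ := by linarith [hB.k₂_lt]

end Valid

section Strategies

variable (S₁ : Strategy₁) (S₂ : Strategy₂)

lemma Strategy₂.isSubDist : S₂.F.IsSubDist := ⟨S₂.F_neg, S₂.F_le_one⟩

lemma Strategy₁.isSubDist_F : S₁.F.IsSubDist where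
  eq_zero := S₁.F_neg
  le_one t := by
    have h1 := S₁.G.mono (min_le_left t (-1))
    rw [S₁.G_neg _ (lt_of_le_of_lt (min_le_right _ _) (by norm_num))] at h1
    linarith [S₁.add_le_one t]

lemma Strategy₁.isSubDist_G : S₁.G.IsSubDist where
  eq_zero := S₁.G_neg
  le_one t := by linarith [S₁.add_le_one t, S₁.isSubDist_F.nonneg t]

/-- The overall probability that player 2 has conceded by time `t`. -/
def conceded₂ (B : BargainingGame) (t : ℝ) : ℝ := (1 - B.z₂) * S₂.F t

/-- The overall probability that player 1 has conceded by time `t`. -/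
def conceded₁ (B : BargainingGame) (t : ℝ) : ℝ := (1 - B.z₁) * S₁.F t

/-- The overall probability that player 1 has challenged by time `t`. -/
noncomputable def challenged₁ (hB : B.Valid) (t : ℝ) : ℝ :=
  (1 - B.z₁) * S₁.G t + B.z₁ * arrival B.γ₁ hB.γ₁_nonneg t

/-- The overall probability that player 1 has neither conceded nor challenged by time `t`. -/
noncomputable def survival₁ (hB : B.Valid) (t : ℝ) : ℝ :=
  1 - conceded₁ S₁ B t - challenged₁ S₁ hB t

/-- The overall probability that player 2 has not conceded by time `t`. -/
def survival₂ (B : BargainingGame) (t : ℝ) : ℝ := 1 - conceded₂ S₂ B t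

/-- Player 1's normalized gain from waiting. -/
noncomputable def gain₁ (B : BargainingGame) : ℝ → ℝ :=
  netGain B.r₁ B.lam₂ (conceded₂ S₂ B) (survival₂ S₂ B)

/-- Player 2's normalized gain from waiting and yielding to challenges. -/
noncomputable def gain₂ (hB : B.Valid) : ℝ → ℝ :=
  netGain B.r₂ B.lam₁ (conceded₁ S₁ B) (survival₁ S₁ hB)

/-- Player 2's normalized gain until time `t` from seeing challenges with probability `1 - q`
instead of yielding to them. -/
noncomputable def courtGain (hB : B.Valid) (q : ℝ → ℝ) (t : ℝ) : ℝ :=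
  (1 - B.z₁) * (1 - B.w₁ - B.k₂)
      * (∫ s in Ico 0 t, (1 - q s) * Real.exp (-B.r₂ * s) ∂S₁.G.measure)
    - B.z₁ * B.k₂ * (∫ s in Ico 0 t, (1 - q s) * Real.exp (-B.r₂ * s)
      ∂(arrival B.γ₁ hB.γ₁_nonneg).measure)

variable {S₁ S₂}

lemma conceded₁_mono (hB : B.Valid) : Monotone (conceded₁ S₁ B) := fun _ _ h =>
  mul_le_mul_of_nonneg_left (S₁.F.mono h) (by linarith [hB.z₁_lt_one])

lemma conceded₂_mono (hB : B.Valid) : Monotone (conceded₂ S₂ B) := fun _ _ h =>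
  mul_le_mul_of_nonneg_left (S₂.F.mono h) (by linarith [hB.z₂_lt_one])

lemma challenged₁_mono (hB : B.Valid) : Monotone (challenged₁ S₁ hB) := fun _ _ h =>
  add_le_add (mul_le_mul_of_nonneg_left (S₁.G.mono h) (by linarith [hB.z₁_lt_one]))
    (mul_le_mul_of_nonneg_left ((arrival _ _).mono h) hB.z₁_pos.le)

lemma survival₁_anti (hB : B.Valid) : Antitone (survival₁ S₁ hB) := fun _ _ h => by
  have h1 := conceded₁_mono (S₁ := S₁) hB h
  have h2 := challenged₁_mono (S₁ := S₁) hB h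
  unfold survival₁; linarith

lemma survival₂_anti (hB : B.Valid) : Antitone (survival₂ S₂ B) := fun _ _ h => by
  have h1 := conceded₂_mono (S₂ := S₂) hB h
  unfold survival₂; linarith

lemma survival₁_pos (hB : B.Valid) (t : ℝ) : 0 < survival₁ S₁ hB t := by
  have h1 := mul_le_mul_of_nonneg_left (S₁.add_le_one t) (by linarith [hB.z₁_lt_one] : 0 ≤ 1 - B.z₁)
  have h2 := mul_lt_mul_of_pos_left (arrival_lt_one (γ := B.γ₁) (hγ := hB.γ₁_nonneg) t) hB.z₁_pos
  unfold survival₁ conceded₁ challenged₁; linarith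

lemma le_survival₂ (hB : B.Valid) (t : ℝ) : B.z₂ ≤ survival₂ S₂ B t := by
  have h1 := mul_le_mul_of_nonneg_left (S₂.F_le_one t) (by linarith [hB.z₂_lt_one] : 0 ≤ 1 - B.z₂)
  unfold survival₂ conceded₂; linarith

lemma survival₂_pos (hB : B.Valid) (t : ℝ) : 0 < survival₂ S₂ B t :=
  hB.z₂_pos.trans_le (le_survival₂ hB t)

lemma conceded₁_rightCont (t : ℝ) : ContinuousWithinAt (conceded₁ S₁ B) (Ici t) t :=
  continuousWithinAt_const.mul (S₁.F.right_continuous t)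

lemma conceded₂_rightCont (t : ℝ) : ContinuousWithinAt (conceded₂ S₂ B) (Ici t) t :=
  continuousWithinAt_const.mul (S₂.F.right_continuous t)

lemma survival₁_rightCont (hB : B.Valid) (t : ℝ) :
    ContinuousWithinAt (survival₁ S₁ hB) (Ici t) t :=
  (continuousWithinAt_const.sub (conceded₁_rightCont t)).sub
    ((continuousWithinAt_const.mul (S₁.G.right_continuous t)).add
      (continuousWithinAt_const.mul ((arrival _ _).right_continuous t)))

lemma survival₂_rightCont (t : ℝ) : ContinuousWithinAt (survival₂ S₂ B) (Ici t) t :=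
  continuousWithinAt_const.sub (conceded₂_rightCont t)

lemma gain₁_rightCont (hB : B.Valid) (t : ℝ) : ContinuousWithinAt (gain₁ S₂ B) (Ici t) t :=
  continuousWithinAt_netGain (conceded₂_mono hB) (survival₂_anti hB) (conceded₂_rightCont t)

lemma gain₂_rightCont (hB : B.Valid) (t : ℝ) : ContinuousWithinAt (gain₂ S₁ hB) (Ici t) t :=
  continuousWithinAt_netGain (conceded₁_mono hB) (survival₁_anti hB) (conceded₁_rightCont t)

lemma gain₁_lt (hB : B.Valid) {s t : ℝ} (hst : s < t) (h : conceded₂ S₂ B s = conceded₂ S₂ B t) :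
    gain₁ S₂ B t < gain₁ S₂ B s :=
  netGain_lt (conceded₂_mono hB) (survival₂_anti hB) hB.lam₂_pos (survival₂_pos hB) hst h

lemma gain₂_lt (hB : B.Valid) {s t : ℝ} (hst : s < t) (h : conceded₁ S₁ B s = conceded₁ S₁ B t) :
    gain₂ S₁ hB t < gain₂ S₁ hB s :=
  netGain_lt (conceded₁_mono hB) (survival₁_anti hB) hB.lam₁_pos (survival₁_pos hB) hst h

/-- The utility from waiting until after `t`. -/
lemma utility_wait₁ (hB : B.Valid) {t : ℝ} (ht : 0 ≤ t) :
    (1 - B.z₂) * (∫ s in Icc 0 t, B.a₁ * Real.exp (-B.r₁ * s) ∂S₂.F.measure)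
      + (1 - (1 - B.z₂) * S₂.F t) * Real.exp (-B.r₁ * t) * (1 - B.a₂)
      = (1 - B.a₂) + B.D * gain₁ S₂ B t := by
  have h := add_mul_netGain (α := B.a₁) (conceded₂_mono (S₂ := S₂) hB)
    (monotone_const (c := (0 : ℝ))) hB.D_mul_lam₂ (by unfold D; ring) t
  have hi : ∫ s in 0..t, B.r₁ * (Real.exp (-B.r₁ * s) * conceded₂ S₂ B s)
      = (1 - B.z₂) * ∫ s in 0..t, B.r₁ * (Real.exp (-B.r₁ * s) * S₂.F s) := by
    rw [← intervalIntegral.integral_const_mul]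
    exact intervalIntegral.integral_congr fun s _ => by simp only [conceded₂]; ring
  simp only [sub_zero, mul_zero, intervalIntegral.integral_zero] at h
  rw [hi] at h
  rw [integral_const_mul, S₂.isSubDist.setIntegral_exp _ ht]
  change _ = (1 - B.a₂) + B.D * netGain _ _ _ (fun s => 1 - conceded₂ S₂ B s) t
  rw [h, conceded₂, D]
  ring

lemma concedeUtility₁_eq (hB : B.Valid) {t : ℝ} (ht : 0 ≤ t) :
    B.concedeUtility₁ S₂ t = (1 - B.a₂) + B.D * (gain₁ S₂ B t
      - Real.exp (-B.r₁ * t) * ((1 - B.z₂) * (S₂.F t - Function.leftLim S₂.F t)) / 2) := by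
  have h := utility_wait₁ (S₂ := S₂) hB ht
  rw [integral_const_mul, StieltjesFunction.setIntegral_Icc (S₂.isSubDist.integrable_exp hB.r₁_pos.le) ht]
    at h
  rw [concedeUtility₁, integral_const_mul]
  rw [D] at h ⊢
  linear_combination h

lemma challengeUtility₁_eq (hB : B.Valid) {t : ℝ} (ht : 0 ≤ t) :
    B.challengeUtility₁ S₂ t = (1 - B.a₂) + B.D * (gain₁ S₂ B t + Real.exp (-B.r₁ * t)
      * ((survival₂ S₂ B t - B.z₂) * ((1 - S₂.q t) * B.w₁ + S₂.q t)
        - B.c₁ * survival₂ S₂ B t)) := by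
  have h := utility_wait₁ (S₂ := S₂) hB ht
  rw [challengeUtility₁, survival₂, conceded₂]
  linear_combination h

lemma integrable_see {F : StieltjesFunction ℝ} (hF : F.IsSubDist) {r : ℝ} (hr : 0 ≤ r) {q : ℝ → ℝ}
    (hq : Measurable q) (hq0 : ∀ t, 0 ≤ q t) (hq1 : ∀ t, q t ≤ 1) :
    Integrable (fun s => (1 - q s) * Real.exp (-r * s)) F.measure :=
  hF.integrable_of_le (by fun_prop) (C := 1) fun t ht => by
    have h1 : Real.exp (-r * t) ≤ 1 := by
      rw [Real.exp_le_one_iff]; nlinarith [mul_nonneg hr ht]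
    rw [abs_of_nonneg (mul_nonneg (by linarith [hq1 t]) (Real.exp_pos _).le)]
    exact mul_le_one₀ (by linarith [hq0 t]) (Real.exp_pos _).le h1

/-- The integrals of player 2's challenge payoffs, split into the payoff from yielding and the gain
from seeing challenges. -/
lemma setIntegral_challenge {F : StieltjesFunction ℝ} (hF : F.IsSubDist) {r : ℝ} (hr : 0 ≤ r)
    {q : ℝ → ℝ} (hq : Measurable q) (hq0 : ∀ t, 0 ≤ q t) (hq1 : ∀ t, q t ≤ 1) (b x t : ℝ) :
    ∫ s in Ico 0 t, (b + (1 - q s) * x) * Real.exp (-r * s) ∂F.measure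
      = b * (∫ s in Ico 0 t, Real.exp (-r * s) ∂F.measure)
        + x * ∫ s in Ico 0 t, (1 - q s) * Real.exp (-r * s) ∂F.measure := by
  rw [← integral_const_mul, ← integral_const_mul,
    ← integral_add ((hF.integrable_exp hr).const_mul b).integrableOn
      ((integrable_see hF hr hq hq0 hq1).const_mul x).integrableOn]
  refine integral_congr_ae (Eventually.of_forall fun s => ?_)
  simp only; ring

lemma concedeUtility₂_eq (hB : B.Valid) {q : ℝ → ℝ} (hq : Measurable q) (hq0 : ∀ t, 0 ≤ q t)
    (hq1 : ∀ t, q t ≤ 1) {t : ℝ} (ht : 0 ≤ t) :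
    B.concedeUtility₂ S₁ q t = (1 - B.a₁) + B.D * (gain₂ S₁ hB t
      - Real.exp (-B.r₂ * t) * ((1 - B.z₁) * (S₁.F t - Function.leftLim S₁.F t)) / 2
      + courtGain S₁ hB q t) := by
  set A := arrival B.γ₁ hB.γ₁_nonneg with hA
  have hr := hB.r₂_pos.le
  have h := add_mul_netGain (α := B.a₂) (conceded₁_mono (S₁ := S₁) hB)
    (challenged₁_mono (S₁ := S₁) hB) hB.D_mul_lam₁ (by unfold D; ring) t
  have hi : ∫ s in 0..t, B.r₂ * (Real.exp (-B.r₂ * s) * conceded₁ S₁ B s)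
      = (1 - B.z₁) * ∫ s in 0..t, B.r₂ * (Real.exp (-B.r₂ * s) * S₁.F s) := by
    rw [← intervalIntegral.integral_const_mul]
    exact intervalIntegral.integral_congr fun s _ => by simp only [conceded₁]; ring
  have hii : ∀ F : StieltjesFunction ℝ,
      IntervalIntegrable (fun s => B.r₂ * (Real.exp (-B.r₂ * s) * F s)) volume 0 t := fun F =>
    (F.mono.intervalIntegrable.continuousOn_mul (Continuous.continuousOn (by fun_prop))).const_mul _
  have hi' : ∫ s in 0..t, B.r₂ * (Real.exp (-B.r₂ * s) * challenged₁ S₁ hB s)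
      = (1 - B.z₁) * (∫ s in 0..t, B.r₂ * (Real.exp (-B.r₂ * s) * S₁.G s))
        + B.z₁ * (∫ s in 0..t, B.r₂ * (Real.exp (-B.r₂ * s) * A s)) := by
    rw [← intervalIntegral.integral_const_mul, ← intervalIntegral.integral_const_mul,
      ← intervalIntegral.integral_add ((hii _).const_mul _) ((hii _).const_mul _)]
    exact intervalIntegral.integral_congr fun s _ => by simp only [challenged₁]; ring
  rw [hi, hi'] at h
  have e1 := S₁.isSubDist_F.setIntegral_exp B.r₂ ht
  have e2 := S₁.isSubDist_G.setIntegral_exp B.r₂ ht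
  have e3 := (arrival_isSubDist (γ := B.γ₁) (hγ := hB.γ₁_nonneg)).setIntegral_exp B.r₂ ht
  rw [StieltjesFunction.setIntegral_Icc (S₁.isSubDist_F.integrable_exp hr) ht] at e1
  rw [StieltjesFunction.setIntegral_Icc (S₁.isSubDist_G.integrable_exp hr) ht] at e2
  rw [StieltjesFunction.setIntegral_Icc (arrival_isSubDist.integrable_exp hr) ht,
    leftLim_arrival ht, sub_self, zero_mul, add_zero] at e3
  have j1 : ∫ s in Ico 0 t, (1 - B.a₁ + (1 - q s) * (1 - B.w₁ - B.k₂) * B.D)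
      * Real.exp (-B.r₂ * s) ∂S₁.G.measure = _ :=
    (integral_congr_ae (Eventually.of_forall fun s => by ring)).trans
      (setIntegral_challenge S₁.isSubDist_G hr hq hq0 hq1 (1 - B.a₁) ((1 - B.w₁ - B.k₂) * B.D) t)
  have j2 : ∫ s in Ico 0 t, (1 - B.a₁ - (1 - q s) * B.k₂ * B.D) * Real.exp (-B.r₂ * s)
      * (B.γ₁ * Real.exp (-B.γ₁ * s)) = _ :=
    ((setIntegral_arrival (hγ := hB.γ₁_nonneg) _ t).symm.trans
      (integral_congr_ae (Eventually.of_forall fun s => by ring))).trans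
      (setIntegral_challenge arrival_isSubDist hr hq hq0 hq1 (1 - B.a₁) (-(B.k₂ * B.D)) t)
  have hAt : A t = 1 - Real.exp (-B.γ₁ * t) := arrival_of_nonneg ht
  rw [concedeUtility₂, integral_const_mul, j1, j2, courtGain]
  change _ = 1 - B.a₁ + B.D * (netGain _ _ _ (fun s => 1 - conceded₁ S₁ B s - challenged₁ S₁ hB s) t
    - _ + _)
  have hct : conceded₁ S₁ B t = (1 - B.z₁) * S₁.F t := rfl
  rw [hct] at h
  rw [← hAt]
  rw [D] at h ⊢
  linear_combination -h + B.a₂ * (1 - B.z₁) * e1 + (1 - B.a₁) * (1 - B.z₁) * e2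
    + (1 - B.a₁) * B.z₁ * e3

end Strategies

end BargainingGame

/-! ### The reputation coevolution curve -/

/-- The integral of `exp (b s)` over `[0, τ]`. It equals `(exp (b τ) - 1) / b` if `b ≠ 0`, and
`τ` if `b = 0`. -/
noncomputable def expInt (b τ : ℝ) : ℝ := ∫ s in 0..τ, Real.exp (b * s)

lemma expInt_zero (b : ℝ) : expInt b 0 = 0 := by simp [expInt]

lemma hasDerivAt_expInt (b τ : ℝ) : HasDerivAt (expInt b) (Real.exp (b * τ)) τ :=
  (show Continuous fun s => Real.exp (b * s) by fun_prop).deriv_integral _ 0 τ ▸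
    (intervalIntegral.differentiable_integral_of_continuous
      (show Continuous fun s => Real.exp (b * s) by fun_prop) τ).hasDerivAt

lemma mul_expInt (b τ : ℝ) : b * expInt b τ = Real.exp (b * τ) - 1 := by
  rw [expInt, ← intervalIntegral.integral_const_mul,
    intervalIntegral.integral_eq_sub_of_hasDerivAt (fun s _ => hasDerivAt_exp_mul b s)]
  · simp
  · exact Continuous.intervalIntegrable (by fun_prop) _ _

lemma expInt_zero_left (τ : ℝ) : expInt 0 τ = τ := by simp [expInt]

lemma expInt_strictMono (b : ℝ) : StrictMono (expInt b) :=
  strictMono_of_hasDerivAt_pos (hasDerivAt_expInt b) fun _ => Real.exp_pos _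

lemma continuous_expInt : Continuous fun p : ℝ × ℝ => expInt p.1 p.2 :=
  intervalIntegral.continuous_parametric_intervalIntegral_of_continuous
    (f := fun (p : ℝ × ℝ) s => Real.exp (p.1 * s)) (by fun_prop) continuous_snd

lemma expInt_mono_left {b b' τ : ℝ} (hb : b ≤ b') (hτ : 0 ≤ τ) : expInt b τ ≤ expInt b' τ :=
  intervalIntegral.integral_mono_on hτ (Continuous.intervalIntegrable (by fun_prop) _ _)
    (Continuous.intervalIntegrable (by fun_prop) _ _) fun s hs =>
      Real.exp_le_exp.2 (mul_le_mul_of_nonneg_right hb hs.1)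

lemma expInt_nonneg (b : ℝ) {τ : ℝ} (hτ : 0 ≤ τ) : 0 ≤ expInt b τ := by
  rw [← expInt_zero b]; exact (expInt_strictMono b).monotone hτ

lemma expInt_pos (b : ℝ) {τ : ℝ} (hτ : 0 < τ) : 0 < expInt b τ := by
  rw [← expInt_zero b]; exact expInt_strictMono b hτ

namespace BargainingGame

/-- The time which the reputation of player 2 needs to grow from `muStar₂` to one. -/
noncomputable def tauStar (B : BargainingGame) : ℝ := -Real.log B.muStar₂ / B.lam₂

/-- The reciprocal of the reputation of player 1 on the coevolution curve, as a function of the time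
`τ` left until both reputations reach one. Backwards in time it solves the linear equation
`ρ' = (λ₁ - γ₁) ρ + γ₁ n`, where `n = 1` for `τ < tauStar` and `n = 1 / nuStar₁` for `τ > tauStar`. -/
noncomputable def rho (B : BargainingGame) (τ : ℝ) : ℝ :=
  1 + B.lam₁ * expInt (B.lam₁ - B.γ₁) τ
    + (B.γ₁ / B.nuStar₁ - B.γ₁) * expInt (B.lam₁ - B.γ₁) (max (τ - B.tauStar) 0)

variable {B : BargainingGame}

namespace Valid

lemma muStar₂_pos (hB : B.Valid) : 0 < B.muStar₂ := by unfold muStar₂; linarith [hB.c₁_lt_one]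

lemma c₁_pos (hB : B.Valid) : 0 < B.c₁ := hB.w₁_nonneg.trans_lt hB.w₁_lt_c₁

lemma muStar₂_lt_one (hB : B.Valid) : B.muStar₂ < 1 := by unfold muStar₂; linarith [hB.c₁_pos]

lemma tauStar_pos (hB : B.Valid) : 0 < B.tauStar :=
  div_pos (neg_pos.2 (Real.log_neg hB.muStar₂_pos hB.muStar₂_lt_one)) hB.lam₂_pos

lemma nuStar₁_pos (hB : B.Valid) : 0 < B.nuStar₁ := by
  have h := hB.w₁_lt_one
  rw [nuStar₁, sub_pos, div_lt_one (by linarith)]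
  exact hB.k₂_lt

lemma nuStar₁_lt_one (hB : B.Valid) : B.nuStar₁ < 1 := by
  have h := div_pos hB.k₂_pos (by linarith [hB.w₁_lt_one] : 0 < 1 - B.w₁)
  rw [nuStar₁]; linarith

lemma excess_nonneg (hB : B.Valid) : 0 ≤ B.γ₁ / B.nuStar₁ - B.γ₁ := by
  rw [sub_nonneg, le_div_iff₀ hB.nuStar₁_pos]
  nlinarith [mul_nonneg hB.γ₁_nonneg (sub_nonneg.2 hB.nuStar₁_lt_one.le)]

/-- The rate of unjustified challenges, relative to that of justified ones, that leaves player 2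
indifferent between yielding to and seeing a challenge. -/
lemma excess_eq (hB : B.Valid) :
    B.γ₁ / B.nuStar₁ - B.γ₁ = B.γ₁ * (B.k₂ / (1 - B.w₁ - B.k₂)) := by
  have h1 : 1 - B.w₁ ≠ 0 := by linarith [hB.w₁_lt_one]
  have h2 := hB.court_pos.ne'
  have h3 : B.nuStar₁ = (1 - B.w₁ - B.k₂) / (1 - B.w₁) := by rw [nuStar₁]; field_simp
  rw [h3]; field_simp; ring

end Valid

lemma rho_zero (hB : B.Valid) : B.rho 0 = 1 := by
  simp [rho, expInt_zero, hB.tauStar_pos.le]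

lemma rho_strictMono (hB : B.Valid) : StrictMono B.rho := fun s t hst => by
  have h1 := mul_lt_mul_of_pos_left (expInt_strictMono (B.lam₁ - B.γ₁) hst) hB.lam₁_pos
  have h2 := mul_le_mul_of_nonneg_left ((expInt_strictMono (B.lam₁ - B.γ₁)).monotone
    (max_le_max_right 0 (sub_le_sub_right hst.le B.tauStar))) hB.excess_nonneg
  unfold rho; linarith

lemma one_le_rho (hB : B.Valid) {τ : ℝ} (hτ : 0 ≤ τ) : 1 ≤ B.rho τ :=
  (rho_zero hB).ge.trans ((rho_strictMono hB).monotone hτ)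

lemma continuous_rho : Continuous B.rho := by
  have h1 : Continuous fun τ => expInt (B.lam₁ - B.γ₁) τ :=
    continuous_expInt.comp (by fun_prop : Continuous fun τ : ℝ => (B.lam₁ - B.γ₁, τ))
  have h2 : Continuous fun τ => expInt (B.lam₁ - B.γ₁) (max (τ - B.tauStar) 0) :=
    h1.comp (by fun_prop)
  unfold rho; fun_prop

/-- The evolution of the reciprocal reputation in time, towards the time `T` at which the reputations
reach one. -/
lemma hasDerivWithinAt_rho (T t : ℝ) :
    HasDerivWithinAt (fun t => B.rho (T - t))
      (-((B.lam₁ - B.γ₁) * B.rho (T - t) + B.γ₁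
        + if t < T - B.tauStar then B.γ₁ / B.nuStar₁ - B.γ₁ else 0)) (Ici t) t := by
  set b := B.lam₁ - B.γ₁ with hb
  have h0 : HasDerivAt (fun t : ℝ => T - t) (-1) t := by simpa using (hasDerivAt_id t).const_sub T
  have h1 : HasDerivWithinAt (fun t => expInt b (T - t)) (-(1 + b * expInt b (T - t))) (Ici t) t := by
    refine (((hasDerivAt_expInt b (T - t)).comp t h0).hasDerivWithinAt).congr_deriv ?_
    rw [mul_expInt]; ring
  have h2 : HasDerivWithinAt (fun t => expInt b (max (T - t - B.tauStar) 0))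
      (-(b * expInt b (max (T - t - B.tauStar) 0) + if t < T - B.tauStar then 1 else 0))
      (Ici t) t := by
    split_ifs with ht
    · have h3 : HasDerivAt (fun t : ℝ => T - t - B.tauStar) (-1) t := h0.sub_const _
      have h4 : HasDerivWithinAt (fun t => expInt b (T - t - B.tauStar))
          (-(b * expInt b (T - t - B.tauStar) + 1)) (Ici t) t := by
        refine (((hasDerivAt_expInt b (T - t - B.tauStar)).comp t h3).hasDerivWithinAt).congr_deriv ?_
        rw [mul_expInt]; ring
      rw [max_eq_left (by linarith)]
      refine h4.congr_of_eventuallyEq ?_ (by rw [max_eq_left (by linarith)])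
      filter_upwards [nhdsWithin_le_nhds (Iio_mem_nhds ht)] with s hs
      have : s < T - B.tauStar := hs
      rw [max_eq_left (by linarith)]
    · have h5 : ∀ s, t ≤ s → max (T - s - B.tauStar) 0 = 0 := fun s hs =>
        max_eq_right (by linarith [not_lt.1 ht])
      rw [h5 t le_rfl, expInt_zero]
      refine ((hasDerivWithinAt_const t (Ici t) (0 : ℝ)).congr_deriv (by simp)).congr
        (fun s hs => ?_) ?_
      · rw [h5 s hs, expInt_zero]
      · rw [h5 t le_rfl, expInt_zero]
  have h6 := ((h1.const_mul B.lam₁).const_add 1).add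
    (h2.const_mul (B.γ₁ / B.nuStar₁ - B.γ₁))
  refine h6.congr_deriv ?_
  rw [rho]
  split_ifs <;> ring

lemma muTilde₁_eq (hB : B.Valid) {x : ℝ} (hx : 0 < x) :
    B.muTilde₁ x = 1 / B.rho (-Real.log x / B.lam₂) := by
  have hl := hB.lam₂_pos
  have hs := hB.muStar₂_pos
  have hcmp : B.muStar₂ < x ↔ -Real.log x / B.lam₂ < B.tauStar := by
    rw [tauStar, div_lt_div_iff_of_pos_right hl, neg_lt_neg_iff, Real.log_lt_log_iff hs hx]
  have hdiff : -Real.log x / B.lam₂ - B.tauStar = -Real.log (x / B.muStar₂) / B.lam₂ := by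
    rw [tauStar, Real.log_div hx.ne' hs.ne']; ring
  by_cases hg : B.γ₁ = B.lam₁
  · rw [muTilde₁, if_pos hg, rho, ← hg, sub_self, expInt_zero_left, expInt_zero_left]
    split_ifs with h
    · rw [max_eq_right (by linarith [hcmp.1 h])]
      congr 1; ring
    · rw [max_eq_left (by linarith [not_lt.1 (mt hcmp.2 h)]), hdiff, Real.log_div hx.ne' hs.ne']
      congr 1; ring
  · have hb : B.lam₁ - B.γ₁ ≠ 0 := sub_ne_zero.2 (Ne.symm hg)
    have hpow : ∀ y, 0 < y → y ^ ((B.γ₁ - B.lam₁) / B.lam₂)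
        = 1 + (B.lam₁ - B.γ₁) * expInt (B.lam₁ - B.γ₁) (-Real.log y / B.lam₂) := fun y hy => by
      rw [mul_expInt, Real.rpow_def_of_pos hy]
      have : Real.log y * ((B.γ₁ - B.lam₁) / B.lam₂)
        = (B.lam₁ - B.γ₁) * (-Real.log y / B.lam₂) := by ring
      rw [this]; ring
    have hfrac : ∀ {u v : ℝ}, u = (B.lam₁ - B.γ₁) * v → (B.lam₁ - B.γ₁) / u = 1 / v := by
      rintro u v rfl
      rw [← div_div, div_self hb]
    rw [muTilde₁, if_neg hg, rho]
    split_ifs with h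
    · rw [max_eq_right (by linarith [hcmp.1 h]), expInt_zero]
      exact hfrac (by rw [hpow x hx]; ring)
    · rw [max_eq_left (by linarith [not_lt.1 (mt hcmp.2 h)]), hdiff]
      exact hfrac (by rw [hpow x hx, hpow _ (div_pos hx hs)]; ring)

lemma muTilde₁_one (hB : B.Valid) : B.muTilde₁ 1 = 1 := by
  rw [muTilde₁_eq hB one_pos]; simp [rho_zero hB]

lemma timeLeft_nonneg (hB : B.Valid) {x : ℝ} (hx : 0 < x) (hx1 : x ≤ 1) :
    0 ≤ -Real.log x / B.lam₂ :=
  div_nonneg (neg_nonneg.2 (Real.log_nonpos hx.le hx1)) hB.lam₂_pos.le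

lemma muTilde₁_strictMonoOn (hB : B.Valid) : StrictMonoOn B.muTilde₁ (Ioc 0 1) :=
  fun x hx y hy hxy => by
    rw [muTilde₁_eq hB hx.1, muTilde₁_eq hB hy.1]
    refine one_div_lt_one_div_of_lt
      (one_pos.trans_le (one_le_rho hB (timeLeft_nonneg hB hy.1 hy.2))) (rho_strictMono hB ?_)
    exact div_lt_div_of_pos_right (neg_lt_neg (Real.log_lt_log hx.1 hxy)) hB.lam₂_pos

lemma muTilde₁_continuousOn (hB : B.Valid) : ContinuousOn B.muTilde₁ (Ioc 0 1) := by
  refine ContinuousOn.congr (f := fun x => 1 / B.rho (-Real.log x / B.lam₂)) ?_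
    fun x hx => muTilde₁_eq hB hx.1
  refine continuousOn_const.div (continuous_rho.comp_continuousOn ?_) fun x hx =>
    (one_pos.trans_le (one_le_rho hB (timeLeft_nonneg hB hx.1 hx.2))).ne'
  exact ((Real.continuousOn_log.mono fun x hx => hx.1.ne').neg).div_const _

lemma bddAbove_muTilde₂ (m : ℝ) : BddAbove {x | 0 < x ∧ x ≤ 1 ∧ B.muTilde₁ x ≤ m} :=
  ⟨1, fun _ hx => hx.2.1⟩

lemma muTilde₂_nonneg (m : ℝ) : 0 ≤ B.muTilde₂ m := Real.sSup_nonneg fun _ hx => hx.1.le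

/-- Where it does not vanish, `muTilde₂` is inverse to `muTilde₁`. -/
lemma muTilde₁_muTilde₂ (hB : B.Valid) {m : ℝ} (hm : m < 1) (h : 0 < B.muTilde₂ m) :
    B.muTilde₁ (B.muTilde₂ m) = m ∧ B.muTilde₂ m < 1 := by
  obtain ⟨x, hx0, hx1, hx⟩ : {x | 0 < x ∧ x ≤ 1 ∧ B.muTilde₁ x ≤ m}.Nonempty := by
    by_contra hne
    rw [not_nonempty_iff_eq_empty] at hne
    rw [muTilde₂, hne, Real.sSup_empty] at h
    exact lt_irrefl _ h
  obtain ⟨c, hc, hcm⟩ := intermediate_value_Icc hx1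
    ((muTilde₁_continuousOn hB).mono (fun y hy => ⟨hx0.trans_le hy.1, hy.2⟩))
    ⟨hx, by rw [muTilde₁_one hB]; exact hm.le⟩
  have hc0 : 0 < c := hx0.trans_le hc.1
  have hg : IsGreatest {x | 0 < x ∧ x ≤ 1 ∧ B.muTilde₁ x ≤ m} c :=
    ⟨⟨hc0, hc.2, hcm.le⟩, fun y hy => by
      by_contra hlt
      have := muTilde₁_strictMonoOn hB ⟨hc0, hc.2⟩ ⟨hy.1, hy.2.1⟩ (not_le.1 hlt)
      linarith [hy.2.2]⟩
  rw [muTilde₂, hg.csSup_eq]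
  refine ⟨hcm, lt_of_le_of_ne hc.2 ?_⟩
  rintro rfl
  rw [muTilde₁_one hB] at hcm; linarith

lemma le_muTilde₂_iff (hB : B.Valid) {m x : ℝ} (hm : m < 1) (hx : 0 < x) (hx1 : x ≤ 1) :
    x ≤ B.muTilde₂ m ↔ B.muTilde₁ x ≤ m := by
  refine ⟨fun h => ?_, fun h => le_csSup (bddAbove_muTilde₂ m) ⟨hx, hx1, h⟩⟩
  obtain ⟨h1, h2⟩ := muTilde₁_muTilde₂ hB hm (hx.trans_le h)
  rw [← h1]
  exact (muTilde₁_strictMonoOn hB).monotoneOn ⟨hx, hx1⟩ ⟨hx.trans_le h, h2.le⟩ h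

lemma lt_muTilde₂_iff (hB : B.Valid) {m x : ℝ} (hm : m < 1) (hx : 0 < x) (hx1 : x ≤ 1) :
    x < B.muTilde₂ m ↔ B.muTilde₁ x < m := by
  constructor
  · intro h
    obtain ⟨h1, h2⟩ := muTilde₁_muTilde₂ hB hm (hx.trans h)
    rw [← h1]
    exact muTilde₁_strictMonoOn hB ⟨hx, hx1⟩ ⟨hx.trans h, h2.le⟩ h
  · intro h
    refine lt_of_le_of_ne ((le_muTilde₂_iff hB hm hx hx1).2 h.le) fun he => ?_
    have := (muTilde₁_muTilde₂ hB hm (he ▸ hx)).1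
    rw [← he] at this
    exact h.ne this

/-! ### The equilibrium payoffs -/

/-- Player 1's equilibrium payoff: player 2 concedes at time zero with the probability that raises
his reputation to the coevolution curve, if it is below. -/
noncomputable def payoff₁ (B : BargainingGame) : ℝ :=
  1 - B.a₂ + B.D * (1 - B.z₂ / max B.z₂ (B.muTilde₂ B.z₁))

/-- Player 2's equilibrium payoff: player 1 concedes at time zero with the probability that raises
his reputation to the coevolution curve, if it is below. -/
noncomputable def payoff₂ (B : BargainingGame) : ℝ :=
  1 - B.a₁ + B.D * (1 - B.z₁ / max B.z₁ (B.muTilde₁ B.z₂))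

/-- The length of the interaction and the payoffs: with `T` the time at which both reputations
reach one, `z₂ exp (λ₂ T)` and `z₁ ρ(T)` are the probabilities that the players do not concede at
time zero, and one of them is one. -/
lemma payoff_eq_of_time (hB : B.Valid) {T : ℝ} (hT : 0 ≤ T) (h₂ : B.z₂ * Real.exp (B.lam₂ * T) ≤ 1)
    (h₁ : B.z₁ * B.rho T ≤ 1)
    (h : B.z₂ * Real.exp (B.lam₂ * T) = 1 ∨ B.z₁ * B.rho T = 1) :
    B.payoff₁ = 1 - B.a₂ + B.D * (1 - B.z₂ * Real.exp (B.lam₂ * T)) ∧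
    B.payoff₂ = 1 - B.a₁ + B.D * (1 - B.z₁ * B.rho T) := by
  set x := Real.exp (-(B.lam₂ * T)) with hx
  have hx0 : 0 < x := Real.exp_pos _
  have hx1 : x ≤ 1 := Real.exp_le_one_iff.2 (by nlinarith [mul_nonneg hB.lam₂_pos.le hT])
  have hex : Real.exp (B.lam₂ * T) = 1 / x := by rw [hx, Real.exp_neg]; simp
  have hmx : B.muTilde₁ x = 1 / B.rho T := by
    rw [muTilde₁_eq hB hx0, hx, Real.log_exp]
    congr 2; field_simp [hB.lam₂_pos.ne']
  have hρ : 0 < B.rho T := one_pos.trans_le (one_le_rho hB hT)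
  rw [hex, mul_one_div, div_le_one hx0] at h₂
  have h₁' : B.z₁ ≤ B.muTilde₁ x := by rw [hmx, le_div_iff₀ hρ]; exact h₁
  have hm₂ : B.muTilde₁ B.z₂ ≤ B.muTilde₁ x :=
    (muTilde₁_strictMonoOn hB).monotoneOn ⟨hB.z₂_pos, hB.z₂_lt_one.le⟩ ⟨hx0, hx1⟩ h₂
  have hy : B.muTilde₂ B.z₁ ≤ x := by
    by_contra hlt
    exact absurd ((lt_muTilde₂_iff hB hB.z₁_lt_one hx0 hx1).1 (not_le.1 hlt)) (not_lt.2 h₁')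
  rw [hex, mul_one_div, payoff₁, payoff₂]
  have hzr : B.z₁ * B.rho T = B.z₁ / B.muTilde₁ x := by rw [hmx]; field_simp
  rw [hzr]
  rcases h with h | h
  · have hz : B.z₂ = x := by
      rw [hex, mul_one_div, div_eq_one_iff_eq hx0.ne'] at h; exact h
    rw [max_eq_left (hz ▸ hy), div_self hB.z₂_pos.ne', ← hz, div_self hB.z₂_pos.ne',
      max_eq_right (hz ▸ h₁')]
    exact ⟨rfl, rfl⟩
  · have hz : B.z₁ = B.muTilde₁ x := by
      rw [hmx, eq_div_iff hρ.ne']; exact h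
    have hyx : B.muTilde₂ B.z₁ = x :=
      le_antisymm hy ((le_muTilde₂_iff hB hB.z₁_lt_one hx0 hx1).2 hz.ge)
    rw [hyx, max_eq_right h₂, ← hz, max_eq_left (hm₂.trans hz.ge)]
    exact ⟨rfl, rfl⟩

/-- The interaction has a finite length compatible with the prior reputations. -/
lemma exists_time (hB : B.Valid) : ∃ T, 0 < T ∧ B.z₂ * Real.exp (B.lam₂ * T) ≤ 1 ∧
    B.z₁ * B.rho T ≤ 1 ∧ (B.z₂ * Real.exp (B.lam₂ * T) = 1 ∨ B.z₁ * B.rho T = 1) := by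
  let f : ℝ → ℝ := fun T => max (B.z₂ * Real.exp (B.lam₂ * T)) (B.z₁ * B.rho T)
  have hf : Continuous f := by
    have := continuous_rho (B := B)
    fun_prop
  have hT₂ := timeLeft_nonneg hB hB.z₂_pos hB.z₂_lt_one.le
  have h0 : f 0 < 1 := by simp [f, rho_zero hB, hB.z₁_lt_one, hB.z₂_lt_one]
  have h1 : 1 ≤ f (-Real.log B.z₂ / B.lam₂) := by
    refine le_max_of_le_left ?_
    rw [mul_div_cancel₀ _ hB.lam₂_pos.ne', Real.exp_neg, Real.exp_log hB.z₂_pos,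
      mul_inv_cancel₀ hB.z₂_pos.ne']
  obtain ⟨T, hT, hfT⟩ := intermediate_value_Icc hT₂ hf.continuousOn ⟨h0.le, h1⟩
  refine ⟨T, lt_of_le_of_ne hT.1 ?_, hfT ▸ le_max_left _ _, hfT ▸ le_max_right _ _, ?_⟩
  · rintro rfl; exact h0.ne hfT
  · rcases max_choice (B.z₂ * Real.exp (B.lam₂ * T)) (B.z₁ * B.rho T) with h | h
    · left; rw [← h]; exact hfT
    · right; rw [← h]; exact hfT

end BargainingGame

/-! ### Necessary conditions for an equilibrium -/

/-- If payoffs of stopping, which lose half of the opponent's jump, are bounded by `w`, so is the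
value of waiting until after the jump: stop right after it. -/
lemma le_of_sub_jump_le {g P J : ℝ → ℝ} {w r t : ℝ} (hg : ContinuousWithinAt g (Ici t) t)
    (hP : ContinuousWithinAt P (Ici t) t) (hJ : ∀ s, t < s → J s ≤ P s - P t)
    (h : ∀ s, t < s → g s - Real.exp (-r * s) * J s / 2 ≤ w) : g t ≤ w := by
  have h1 : ContinuousWithinAt (fun s => g s - Real.exp (-r * s) * (P s - P t) / 2) (Ici t) t :=
    hg.sub (((Continuous.continuousWithinAt (by fun_prop)).mul
      (hP.sub continuousWithinAt_const)).div_const 2)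
  have h2 := (h1.mono Ioi_subset_Ici_self).tendsto
  simp only [sub_self, mul_zero, zero_div, sub_zero] at h2
  refine le_of_tendsto h2 ?_
  filter_upwards [self_mem_nhdsWithin] with s hs
  have := mul_le_mul_of_nonneg_left (hJ s hs) (Real.exp_pos (-r * s)).le
  linarith [h s hs]

namespace BargainingGame

variable {B : BargainingGame} {S₁ : Strategy₁} {S₂ : Strategy₂}

lemma gain₁_zero : gain₁ S₂ B 0 = conceded₂ S₂ B 0 := netGain_zero

lemma gain₂_zero (hB : B.Valid) : gain₂ S₁ hB 0 = conceded₁ S₁ B 0 := netGain_zero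

lemma leftLim_conceded₁ {t : ℝ} (h : Function.leftLim S₁.F t = S₁.F t) :
    Function.leftLim (conceded₁ S₁ B) t = conceded₁ S₁ B t := by
  have h1 := (S₁.F.mono.tendsto_leftLim t).const_mul (1 - B.z₁)
  rw [h] at h1
  exact leftLim_eq_of_tendsto h1

lemma leftLim_conceded₂ {t : ℝ} (h : Function.leftLim S₂.F t = S₂.F t) :
    Function.leftLim (conceded₂ S₂ B) t = conceded₂ S₂ B t := by
  have h1 := (S₂.F.mono.tendsto_leftLim t).const_mul (1 - B.z₂)
  rw [h] at h1
  exact leftLim_eq_of_tendsto h1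

lemma courtGain_one (hB : B.Valid) (t : ℝ) : courtGain S₁ hB (fun _ => 1) t = 0 := by
  simp [courtGain]

namespace IsEquilibrium

lemma concedeUtility₁_le (hE : B.IsEquilibrium S₁ S₂) {t : ℝ} (ht : 0 ≤ t) :
    B.concedeUtility₁ S₂ t ≤ B.utility₁ S₁ S₂ := by
  have h := hE.1 ⟨.unitMass t, 0, StieltjesFunction.unitMass_neg ht, fun _ _ => rfl,
    fun s => by simpa using StieltjesFunction.unitMass_le_one t s⟩
  rwa [utility₁, StieltjesFunction.measure_unitMass, StieltjesFunction.measure_zero,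
    integral_dirac, integral_zero_measure, add_zero] at h

lemma challengeUtility₁_le (hE : B.IsEquilibrium S₁ S₂) {t : ℝ} (ht : 0 ≤ t) :
    B.challengeUtility₁ S₂ t ≤ B.utility₁ S₁ S₂ := by
  have h := hE.1 ⟨0, .unitMass t, fun _ _ => rfl, StieltjesFunction.unitMass_neg ht,
    fun s => by simpa using StieltjesFunction.unitMass_le_one t s⟩
  rwa [utility₁, StieltjesFunction.measure_unitMass, StieltjesFunction.measure_zero,
    integral_dirac, integral_zero_measure, zero_add] at h

lemma concedeUtility₂_le (hE : B.IsEquilibrium S₁ S₂) {q : ℝ → ℝ} (hq : Measurable q)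
    (hq0 : ∀ t, 0 ≤ q t) (hq1 : ∀ t, q t ≤ 1) {t : ℝ} (ht : 0 ≤ t) :
    B.concedeUtility₂ S₁ q t ≤ B.utility₂ S₁ S₂ := by
  have h := hE.2 ⟨.unitMass t, StieltjesFunction.unitMass_neg ht,
    StieltjesFunction.unitMass_le_one t, q, hq, hq0, hq1⟩
  rwa [utility₂, StieltjesFunction.measure_unitMass, integral_dirac] at h

lemma utility₁_pos (hB : B.Valid) (hE : B.IsEquilibrium S₁ S₂) : 0 < B.utility₁ S₁ S₂ := by
  refine lt_of_lt_of_le ?_ (hE.concedeUtility₁_le le_rfl)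
  rw [concedeUtility₁_eq hB le_rfl, gain₁_zero, S₂.isSubDist.leftLim_zero, conceded₂]
  have := mul_nonneg hB.D_pos.le
    (mul_nonneg (by linarith [hB.z₂_lt_one] : 0 ≤ 1 - B.z₂) (S₂.isSubDist.nonneg 0))
  simp only [mul_zero, Real.exp_zero]
  linarith [hB.a₂_lt_one]

lemma utility₂_pos (hB : B.Valid) (hE : B.IsEquilibrium S₁ S₂) : 0 < B.utility₂ S₁ S₂ := by
  refine lt_of_lt_of_le ?_ (hE.concedeUtility₂_le (q := fun _ => 1) measurable_const
    (fun _ => zero_le_one) (fun _ => le_rfl) le_rfl)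
  rw [concedeUtility₂_eq hB measurable_const (fun _ => zero_le_one) (fun _ => le_rfl) le_rfl,
    gain₂_zero, S₁.isSubDist_F.leftLim_zero, courtGain_one, conceded₁]
  have := mul_nonneg hB.D_pos.le
    (mul_nonneg (by linarith [hB.z₁_lt_one] : 0 ≤ 1 - B.z₁) (S₁.isSubDist_F.nonneg 0))
  simp only [mul_zero, Real.exp_zero]
  linarith [hB.a₁_lt_one]

lemma _root_.BargainingGame.Strategy₁.mass_le (S₁ : Strategy₁) :
    S₁.F.measure.real univ + S₁.G.measure.real univ ≤ 1 := by
  have h1 := S₁.isSubDist_F.isFiniteMeasure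
  have h2 := S₁.isSubDist_G.isFiniteMeasure
  have h : (S₁.F + S₁.G).IsSubDist :=
    ⟨fun t ht => by rw [StieltjesFunction.add_apply, S₁.F_neg t ht, S₁.G_neg t ht, add_zero],
      S₁.add_le_one⟩
  have h3 := h.measureReal_univ_le h.le_one
  rwa [StieltjesFunction.measure_add, measureReal_add_apply] at h3

/-- An unjustified player 1 acts with probability one, and at optimal times only. -/
lemma optimal₁ (hB : B.Valid) (hE : B.IsEquilibrium S₁ S₂) :
    S₁.F.measure.real univ + S₁.G.measure.real univ = 1 ∧
    (∀ᵐ t ∂S₁.F.measure, B.concedeUtility₁ S₂ t = B.utility₁ S₁ S₂) ∧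
    (∀ᵐ t ∂S₁.G.measure, B.challengeUtility₁ S₂ t = B.utility₁ S₁ S₂) := by
  have h1 := S₁.isSubDist_F.isFiniteMeasure
  have h2 := S₁.isSubDist_G.isFiniteMeasure
  have hu := hE.utility₁_pos hB
  have hF : ∀ᵐ t ∂S₁.F.measure, B.concedeUtility₁ S₂ t ≤ B.utility₁ S₁ S₂ :=
    S₁.isSubDist_F.ae_nonneg.mono fun t => hE.concedeUtility₁_le
  have hG : ∀ᵐ t ∂S₁.G.measure, B.challengeUtility₁ S₂ t ≤ B.utility₁ S₁ S₂ :=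
    S₁.isSubDist_G.ae_nonneg.mono fun t => hE.challengeUtility₁_le
  have iF := integral_le_of_ae_le hu.le hF
  have iG := integral_le_of_ae_le hu.le hG
  have hdef : B.utility₁ S₁ S₂ = (∫ t, B.concedeUtility₁ S₂ t ∂S₁.F.measure)
    + ∫ t, B.challengeUtility₁ S₂ t ∂S₁.G.measure := rfl
  have hm : S₁.F.measure.real univ + S₁.G.measure.real univ = 1 := by
    refine le_antisymm S₁.mass_le ?_
    nlinarith
  refine ⟨hm, ae_eq_of_integral_eq hu hF ?_, ae_eq_of_integral_eq hu hG ?_⟩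
  · have : B.utility₁ S₁ S₂ = B.utility₁ S₁ S₂ * S₁.F.measure.real univ
      + B.utility₁ S₁ S₂ * S₁.G.measure.real univ := by rw [← mul_add, hm, mul_one]
    linarith
  · have : B.utility₁ S₁ S₂ = B.utility₁ S₁ S₂ * S₁.F.measure.real univ
      + B.utility₁ S₁ S₂ * S₁.G.measure.real univ := by rw [← mul_add, hm, mul_one]
    linarith

/-- An unjustified player 2 concedes with probability one, and at optimal times only. -/
lemma optimal₂ (hB : B.Valid) (hE : B.IsEquilibrium S₁ S₂) :
    S₂.F.measure.real univ = 1 ∧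
    (∀ᵐ t ∂S₂.F.measure, B.concedeUtility₂ S₁ S₂.q t = B.utility₂ S₁ S₂) := by
  have h1 := S₂.isSubDist.isFiniteMeasure
  have hu := hE.utility₂_pos hB
  have hF : ∀ᵐ t ∂S₂.F.measure, B.concedeUtility₂ S₁ S₂.q t ≤ B.utility₂ S₁ S₂ :=
    S₂.isSubDist.ae_nonneg.mono fun t => hE.concedeUtility₂_le S₂.q_meas S₂.q_nonneg S₂.q_le_one
  have iF := integral_le_of_ae_le hu.le hF
  have hdef : B.utility₂ S₁ S₂ = ∫ t, B.concedeUtility₂ S₁ S₂.q t ∂S₂.F.measure := rfl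
  rw [← hdef] at iF
  have hm : S₂.F.measure.real univ = 1 := by
    refine le_antisymm (S₂.isSubDist.measureReal_univ_le S₂.F_le_one) ?_
    nlinarith
  exact ⟨hm, ae_eq_of_integral_eq hu hF (by rw [hm, mul_one]; exact hdef.le)⟩

end IsEquilibrium

/-- Player 1's normalized equilibrium gain over conceding immediately. -/
noncomputable def value₁ (B : BargainingGame) (S₁ : Strategy₁) (S₂ : Strategy₂) : ℝ :=
  (B.utility₁ S₁ S₂ - (1 - B.a₂)) / B.D

/-- Player 2's normalized equilibrium gain over conceding immediately. -/
noncomputable def value₂ (B : BargainingGame) (S₁ : Strategy₁) (S₂ : Strategy₂) : ℝ :=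
  (B.utility₂ S₁ S₂ - (1 - B.a₁)) / B.D

lemma utility₁_eq_value (hB : B.Valid) :
    B.utility₁ S₁ S₂ = 1 - B.a₂ + B.D * B.value₁ S₁ S₂ := by
  rw [value₁, mul_div_cancel₀ _ hB.D_pos.ne']; ring

lemma utility₂_eq_value (hB : B.Valid) :
    B.utility₂ S₁ S₂ = 1 - B.a₁ + B.D * B.value₂ S₁ S₂ := by
  rw [value₂, mul_div_cancel₀ _ hB.D_pos.ne']; ring

namespace IsEquilibrium

lemma gain₁_le (hB : B.Valid) (hE : B.IsEquilibrium S₁ S₂) {t : ℝ} (ht : 0 ≤ t) :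
    gain₁ S₂ B t ≤ B.value₁ S₁ S₂ := by
  refine le_of_sub_jump_le (r := B.r₁) (J := fun s => (1 - B.z₂) * (S₂.F s - Function.leftLim S₂.F s))
    (gain₁_rightCont hB t) (conceded₂_rightCont (S₂ := S₂) (B := B) t) (fun s hs => ?_) (fun s hs => ?_)
  · rw [conceded₂, conceded₂, ← mul_sub]
    exact mul_le_mul_of_nonneg_left (by linarith [S₂.F.mono.le_leftLim hs])
      (by linarith [hB.z₂_lt_one])
  · have h := hE.concedeUtility₁_le (ht.trans hs.le)
    rw [concedeUtility₁_eq hB (ht.trans hs.le), utility₁_eq_value hB, add_le_add_iff_left] at h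
    exact le_of_mul_le_mul_left h hB.D_pos

lemma gain₂_le (hB : B.Valid) (hE : B.IsEquilibrium S₁ S₂) {t : ℝ} (ht : 0 ≤ t) :
    gain₂ S₁ hB t ≤ B.value₂ S₁ S₂ := by
  refine le_of_sub_jump_le (r := B.r₂) (J := fun s => (1 - B.z₁) * (S₁.F s - Function.leftLim S₁.F s))
    (gain₂_rightCont hB t) (conceded₁_rightCont (S₁ := S₁) (B := B) t) (fun s hs => ?_) (fun s hs => ?_)
  · rw [conceded₁, conceded₁, ← mul_sub]
    exact mul_le_mul_of_nonneg_left (by linarith [S₁.F.mono.le_leftLim hs])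
      (by linarith [hB.z₁_lt_one])
  · have h := hE.concedeUtility₂_le (q := fun _ => 1) measurable_const
      (fun _ => zero_le_one) (fun _ => le_rfl) (ht.trans hs.le)
    rw [concedeUtility₂_eq hB measurable_const (fun _ => zero_le_one) (fun _ => le_rfl)
      (ht.trans hs.le), utility₂_eq_value hB, add_le_add_iff_left, courtGain_one, add_zero] at h
    exact le_of_mul_le_mul_left h hB.D_pos

/-- Player 1 concedes only when waiting has its maximal value, and not when player 2 concedes with
positive probability. -/
lemma ae_concede₁ (hB : B.Valid) (hE : B.IsEquilibrium S₁ S₂) : ∀ᵐ t ∂S₁.F.measure,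
    0 ≤ t ∧ gain₁ S₂ B t = B.value₁ S₁ S₂ ∧ Function.leftLim S₂.F t = S₂.F t := by
  filter_upwards [S₁.isSubDist_F.ae_nonneg, (hE.optimal₁ hB).2.1] with t ht h
  rw [concedeUtility₁_eq hB ht, utility₁_eq_value hB, add_right_inj,
    mul_right_inj' hB.D_pos.ne'] at h
  have h1 := hE.gain₁_le hB ht
  have h2 := StieltjesFunction.leftLim_le S₂.F t
  have h3 : 0 < Real.exp (-B.r₁ * t) * (1 - B.z₂) :=
    mul_pos (Real.exp_pos _) (by linarith [hB.z₂_lt_one])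
  have h4 : S₂.F t - Function.leftLim S₂.F t ≤ 0 := by
    by_contra hlt
    have := mul_pos h3 (not_le.1 hlt)
    linarith
  have h5 : Function.leftLim S₂.F t = S₂.F t := by linarith
  refine ⟨ht, ?_, h5⟩
  rw [h5] at h; linarith

/-- Player 1 challenges only where player 2 has not finished conceding, his reputation is at most
`muStar₂`, and he yields with a probability bounded away from zero. -/
lemma ae_challenge₁ (hB : B.Valid) (hE : B.IsEquilibrium S₁ S₂) : ∀ᵐ t ∂S₁.G.measure,
    0 ≤ t ∧ B.c₁ * survival₂ S₂ B t ≤ survival₂ S₂ B t - B.z₂ ∧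
    (B.c₁ - B.w₁) / (1 - B.w₁) ≤ S₂.q t := by
  filter_upwards [S₁.isSubDist_G.ae_nonneg, (hE.optimal₁ hB).2.2] with t ht h
  rw [challengeUtility₁_eq hB ht, utility₁_eq_value hB, add_right_inj,
    mul_right_inj' hB.D_pos.ne'] at h
  have h1 := hE.gain₁_le hB ht
  have hS := survival₂_pos (S₂ := S₂) hB t
  have hSz := le_survival₂ (S₂ := S₂) hB t
  have hw := hB.w₁_lt_one
  have h2 : 0 ≤ (survival₂ S₂ B t - B.z₂) * ((1 - S₂.q t) * B.w₁ + S₂.q t)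
      - B.c₁ * survival₂ S₂ B t := by
    by_contra hlt
    have := mul_neg_of_pos_of_neg (Real.exp_pos (-B.r₁ * t)) (not_le.1 hlt)
    linarith
  have hq0 := S₂.q_nonneg t
  have hq1 := S₂.q_le_one t
  have h3 : (1 - S₂.q t) * B.w₁ + S₂.q t ≤ 1 := by nlinarith
  have h4 : 0 ≤ (1 - S₂.q t) * B.w₁ + S₂.q t := by nlinarith [hB.w₁_nonneg]
  refine ⟨ht, by nlinarith, ?_⟩
  rw [div_le_iff₀ (by linarith)]
  have h5 : B.c₁ * survival₂ S₂ B t ≤ survival₂ S₂ B t * ((1 - S₂.q t) * B.w₁ + S₂.q t) := by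
    nlinarith [mul_nonneg hB.z₂_pos.le h4]
  have h6 : B.c₁ ≤ (1 - S₂.q t) * B.w₁ + S₂.q t := by
    rw [mul_comm] at h5
    exact le_of_mul_le_mul_left h5 hS
  linarith

end IsEquilibrium

/-! ### Player 2's response to challenges -/

/-- Changing the response to challenges on a set. -/
lemma courtGain_eq_add (hB : B.Valid) {q q' : ℝ → ℝ} (hq : Measurable q)
    (hq0 : ∀ t, 0 ≤ q t) (hq1 : ∀ t, q t ≤ 1) {A : Set ℝ} (hA : MeasurableSet A) {t κ : ℝ}
    (hAt : A ⊆ Ico 0 t)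
    (h : ∀ s, (1 - q' s) * Real.exp (-B.r₂ * s)
      = (1 - q s) * Real.exp (-B.r₂ * s) + A.indicator (fun _ => κ) s) :
    courtGain S₁ hB q' t = courtGain S₁ hB q t
      + κ * ((1 - B.z₁) * (1 - B.w₁ - B.k₂) * S₁.G.measure.real A
        - B.z₁ * B.k₂ * (arrival B.γ₁ hB.γ₁_nonneg).measure.real A) := by
  have key : ∀ {F : StieltjesFunction ℝ}, F.IsSubDist →
      ∫ s in Ico 0 t, (1 - q' s) * Real.exp (-B.r₂ * s) ∂F.measure
      = (∫ s in Ico 0 t, (1 - q s) * Real.exp (-B.r₂ * s) ∂F.measure) + F.measure.real A * κ := by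
    intro F hF
    have := hF.isFiniteMeasure
    simp only [h]
    rw [integral_add (integrable_see hF hB.r₂_pos.le hq hq0 hq1).integrableOn
      ((integrable_const κ).indicator hA).integrableOn, setIntegral_indicator hA,
      inter_eq_right.2 hAt, setIntegral_const, smul_eq_mul]
  rw [courtGain, courtGain, key S₁.isSubDist_G, key arrival_isSubDist]
  ring

/-- Seeing challenges does not pay, if unjustified challenges are rare relative to justified ones. -/
lemma courtGain_nonpos (hB : B.Valid) {q : ℝ → ℝ} (hq : Measurable q)
    (hq0 : ∀ t, 0 ≤ q t) (hq1 : ∀ t, q t ≤ 1) {t : ℝ}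
    (h : ∀ A ⊆ Ico 0 t, MeasurableSet A → (1 - B.z₁) * (1 - B.w₁ - B.k₂) * S₁.G.measure.real A
        ≤ B.z₁ * B.k₂ * (arrival B.γ₁ hB.γ₁_nonneg).measure.real A) :
    courtGain S₁ hB q t ≤ 0 := by
  have i1 := S₁.isSubDist_G.isFiniteMeasure
  have i2 := (arrival_isSubDist (γ := B.γ₁) (hγ := hB.γ₁_nonneg)).isFiniteMeasure
  have hG : 0 ≤ (1 - B.z₁) * (1 - B.w₁ - B.k₂) :=
    mul_nonneg (by linarith [hB.z₁_lt_one]) hB.court_pos.le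
  have hA : 0 ≤ B.z₁ * B.k₂ := mul_nonneg hB.z₁_pos.le hB.k₂_pos.le
  have hle : (ENNReal.ofReal ((1 - B.z₁) * (1 - B.w₁ - B.k₂)) • S₁.G.measure).restrict (Ico 0 t)
      ≤ (ENNReal.ofReal (B.z₁ * B.k₂) • (arrival B.γ₁ hB.γ₁_nonneg).measure).restrict (Ico 0 t) := by
    refine Measure.le_iff.2 fun A hAm => ?_
    rw [Measure.restrict_apply hAm, Measure.restrict_apply hAm, Measure.smul_apply,
      Measure.smul_apply, smul_eq_mul, smul_eq_mul, ← ofReal_measureReal, ← ofReal_measureReal,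
      ← ENNReal.ofReal_mul hG, ← ENNReal.ofReal_mul hA]
    exact ENNReal.ofReal_le_ofReal (h _ inter_subset_right (hAm.inter measurableSet_Ico))
  have h1 := integral_mono_measure (f := fun s => (1 - q s) * Real.exp (-B.r₂ * s)) hle
    (Eventually.of_forall fun s => mul_nonneg (by linarith [hq1 s]) (Real.exp_pos _).le)
    (by
      rw [Measure.restrict_smul]
      exact ((integrable_see arrival_isSubDist hB.r₂_pos.le hq hq0 hq1).integrableOn).smul_measure
        ENNReal.ofReal_ne_top)
  rw [Measure.restrict_smul, Measure.restrict_smul, integral_smul_measure, integral_smul_measure,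
    ENNReal.toReal_ofReal hG, ENNReal.toReal_ofReal hA, smul_eq_mul, smul_eq_mul] at h1
  rw [courtGain]; linarith

namespace IsEquilibrium

lemma courtGain_le (hB : B.Valid) (hE : B.IsEquilibrium S₁ S₂) {q : ℝ → ℝ} (hq : Measurable q)
    (hq0 : ∀ t, 0 ≤ q t) (hq1 : ∀ t, q t ≤ 1) {t : ℝ} (ht : 0 ≤ t)
    (h : B.concedeUtility₂ S₁ S₂.q t = B.utility₂ S₁ S₂) :
    courtGain S₁ hB q t ≤ courtGain S₁ hB S₂.q t := by
  have h1 := hE.concedeUtility₂_le hq hq0 hq1 ht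
  rw [← h, concedeUtility₂_eq hB hq hq0 hq1 ht,
    concedeUtility₂_eq hB S₂.q_meas S₂.q_nonneg S₂.q_le_one ht, add_le_add_iff_left] at h1
  linarith [le_of_mul_le_mul_left h1 hB.D_pos]

/-- Before an optimal concession time of player 2, unjustified challenges are at most as frequent as
leaves him willing to yield: otherwise he would see some of the challenges to which he yields. -/
lemma challenge_le (hB : B.Valid) (hE : B.IsEquilibrium S₁ S₂) {t : ℝ} (ht : 0 ≤ t)
    (h : B.concedeUtility₂ S₁ S₂.q t = B.utility₂ S₁ S₂) {A : Set ℝ} (hAt : A ⊆ Ico 0 t)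
    (hA : MeasurableSet A) :
    (1 - B.z₁) * (1 - B.w₁ - B.k₂) * S₁.G.measure.real A
      ≤ B.z₁ * B.k₂ * (arrival B.γ₁ hB.γ₁_nonneg).measure.real A := by
  have i2 := (arrival_isSubDist (γ := B.γ₁) (hγ := hB.γ₁_nonneg)).isFiniteMeasure
  set q₀ := (B.c₁ - B.w₁) / (1 - B.w₁) with hq₀
  have hq₀pos : 0 < q₀ := div_pos (by linarith [hB.w₁_lt_c₁]) (by linarith [hB.w₁_lt_one])
  set A' := A ∩ {s | q₀ ≤ S₂.q s} with hA'
  have hA'm : MeasurableSet A' := hA.inter (measurableSet_le measurable_const S₂.q_meas)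
  -- The deviation lowers the probability of yielding just enough to cancel the discount factor.
  let f : ℝ → ℝ := A'.indicator fun s => q₀ * Real.exp (B.r₂ * (s - t))
  have hfm : Measurable f := Measurable.indicator (by fun_prop) hA'm
  have hf0 : ∀ s, 0 ≤ f s := fun s =>
    indicator_nonneg (fun s _ => mul_nonneg hq₀pos.le (Real.exp_pos _).le) s
  have hfq : ∀ s, f s ≤ S₂.q s := fun s => by
    by_cases hs : s ∈ A'
    · have h1 : Real.exp (B.r₂ * (s - t)) ≤ 1 := by
        rw [Real.exp_le_one_iff]
        exact mul_nonpos_of_nonneg_of_nonpos hB.r₂_pos.le (by linarith [(hAt hs.1).2])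
      have h2 : q₀ ≤ S₂.q s := hs.2
      simp only [f, indicator_of_mem hs]
      nlinarith
    · simp only [f, indicator_of_notMem hs]; exact S₂.q_nonneg s
  have hdev := hE.courtGain_le hB (q := fun s => S₂.q s - f s) (S₂.q_meas.sub hfm)
    (fun s => sub_nonneg.2 (hfq s)) (fun s => by linarith [hf0 s, S₂.q_le_one s]) ht h
  rw [courtGain_eq_add (κ := q₀ * Real.exp (-B.r₂ * t)) hB S₂.q_meas S₂.q_nonneg S₂.q_le_one hA'm
    (inter_subset_left.trans hAt) (fun s => ?_)] at hdev
  · have h1 : (1 - B.z₁) * (1 - B.w₁ - B.k₂) * S₁.G.measure.real A'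
        - B.z₁ * B.k₂ * (arrival B.γ₁ hB.γ₁_nonneg).measure.real A' ≤ 0 := by
      have hpos : 0 < q₀ * Real.exp (-B.r₂ * t) := mul_pos hq₀pos (Real.exp_pos _)
      by_contra hlt
      linarith [mul_pos hpos (not_le.1 hlt)]
    have h2 : S₁.G.measure.real A = S₁.G.measure.real A' := by
      refine measureReal_congr ?_
      filter_upwards [hE.ae_challenge₁ hB] with s hs
      exact propext ⟨fun h => ⟨h, hs.2.2⟩, fun h => h.1⟩
    have h3 : (arrival B.γ₁ hB.γ₁_nonneg).measure.real A'
        ≤ (arrival B.γ₁ hB.γ₁_nonneg).measure.real A := measureReal_mono inter_subset_left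
    have h4 := mul_le_mul_of_nonneg_left h3 (mul_nonneg hB.z₁_pos.le hB.k₂_pos.le)
    rw [h2]; linarith
  · by_cases hs : s ∈ A'
    · simp only [f, indicator_of_mem hs]
      have : Real.exp (B.r₂ * (s - t)) * Real.exp (-B.r₂ * s) = Real.exp (-B.r₂ * t) := by
        rw [← Real.exp_add]; congr 1; ring
      linear_combination q₀ * this
    · simp only [f, indicator_of_notMem hs]; ring

/-- Player 2 does not profit from his responses to challenges. -/
lemma courtGain_eq_zero (hB : B.Valid) (hE : B.IsEquilibrium S₁ S₂) {t : ℝ} (ht : 0 ≤ t)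
    (h : B.concedeUtility₂ S₁ S₂.q t = B.utility₂ S₁ S₂) : courtGain S₁ hB S₂.q t = 0 := by
  refine le_antisymm (courtGain_nonpos hB S₂.q_meas S₂.q_nonneg S₂.q_le_one
    fun A hAt hA => hE.challenge_le hB ht h hAt hA) ?_
  rw [← courtGain_one (S₁ := S₁) hB t]
  exact hE.courtGain_le hB measurable_const (fun _ => zero_le_one) (fun _ => le_rfl) ht h

/-- Where player 2 yields with probability less than one, unjustified challenges are frequent enough
to leave him willing not to yield. -/
lemma le_challenge (hB : B.Valid) (hE : B.IsEquilibrium S₁ S₂) {t : ℝ} (ht : 0 ≤ t)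
    (h : B.concedeUtility₂ S₁ S₂.q t = B.utility₂ S₁ S₂) {A : Set ℝ} (hAt : A ⊆ Ico 0 t)
    (hA : MeasurableSet A) {ε : ℝ} (hε : 0 < ε) (hq : ∀ s ∈ A, S₂.q s ≤ 1 - ε) :
    B.z₁ * B.k₂ * (arrival B.γ₁ hB.γ₁_nonneg).measure.real A
      ≤ (1 - B.z₁) * (1 - B.w₁ - B.k₂) * S₁.G.measure.real A := by
  let f : ℝ → ℝ := A.indicator fun s => ε * Real.exp (B.r₂ * (s - t))
  have hfm : Measurable f := Measurable.indicator (by fun_prop) hA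
  have hf0 : ∀ s, 0 ≤ f s := fun s =>
    indicator_nonneg (fun s _ => mul_nonneg hε.le (Real.exp_pos _).le) s
  have hfq : ∀ s, S₂.q s + f s ≤ 1 := fun s => by
    by_cases hs : s ∈ A
    · have h1 : Real.exp (B.r₂ * (s - t)) ≤ 1 := by
        rw [Real.exp_le_one_iff]
        exact mul_nonpos_of_nonneg_of_nonpos hB.r₂_pos.le (by linarith [(hAt hs).2])
      simp only [f, indicator_of_mem hs]
      nlinarith [hq s hs]
    · simp only [f, indicator_of_notMem hs, add_zero]; exact S₂.q_le_one s
  have hdev := hE.courtGain_le hB (q := fun s => S₂.q s + f s) (S₂.q_meas.add hfm)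
    (fun s => add_nonneg (S₂.q_nonneg s) (hf0 s)) hfq ht h
  rw [courtGain_eq_add (κ := -(ε * Real.exp (-B.r₂ * t))) hB S₂.q_meas S₂.q_nonneg S₂.q_le_one hA
    hAt (fun s => ?_)] at hdev
  · have hpos : 0 < ε * Real.exp (-B.r₂ * t) := mul_pos hε (Real.exp_pos _)
    by_contra hlt
    linarith [mul_pos hpos (sub_pos.2 (not_le.1 hlt))]
  · by_cases hs : s ∈ A
    · simp only [f, indicator_of_mem hs]
      have : Real.exp (B.r₂ * (s - t)) * Real.exp (-B.r₂ * s) = Real.exp (-B.r₂ * t) := by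
        rw [← Real.exp_add]; congr 1; ring
      linear_combination (-ε) * this
    · simp only [f, indicator_of_notMem hs]; ring

/-- Player 2 concedes only when waiting has its maximal value, and not when player 1 concedes with
positive probability. -/
lemma ae_concede₂ (hB : B.Valid) (hE : B.IsEquilibrium S₁ S₂) : ∀ᵐ t ∂S₂.F.measure,
    0 ≤ t ∧ B.concedeUtility₂ S₁ S₂.q t = B.utility₂ S₁ S₂ ∧
      gain₂ S₁ hB t = B.value₂ S₁ S₂ ∧ Function.leftLim S₁.F t = S₁.F t := by
  filter_upwards [S₂.isSubDist.ae_nonneg, (hE.optimal₂ hB).2] with t ht hopt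
  have h := hopt
  rw [concedeUtility₂_eq hB S₂.q_meas S₂.q_nonneg S₂.q_le_one ht, utility₂_eq_value hB,
    add_right_inj, mul_right_inj' hB.D_pos.ne', hE.courtGain_eq_zero hB ht hopt, add_zero] at h
  have h1 := hE.gain₂_le hB ht
  have h2 := StieltjesFunction.leftLim_le S₁.F t
  have h3 : 0 < Real.exp (-B.r₂ * t) * (1 - B.z₁) :=
    mul_pos (Real.exp_pos _) (by linarith [hB.z₁_lt_one])
  have h4 : S₁.F t - Function.leftLim S₁.F t ≤ 0 := by
    by_contra hlt
    have := mul_pos h3 (not_le.1 hlt)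
    linarith
  have h5 : Function.leftLim S₁.F t = S₁.F t := by linarith
  refine ⟨ht, hopt, ?_, h5⟩
  rw [h5] at h; linarith

end IsEquilibrium

end BargainingGame

/-- A function on `[0, T]` with right derivative `-l` times itself decays exponentially. -/
lemma eq_mul_exp_of_hasDerivWithinAt {f : ℝ → ℝ} {l T : ℝ} (hT : 0 ≤ T)
    (hc : ContinuousOn f (Icc 0 T))
    (hd : ∀ t ∈ Ico 0 T, HasDerivWithinAt f (-l * f t) (Ici t) t) :
    f T = f 0 * Real.exp (-l * T) := by
  have h := constant_of_has_deriv_right_zero (f := fun t => Real.exp (l * t) * f t) (a := 0) (b := T)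
    (ContinuousOn.mul (Continuous.continuousOn (by fun_prop)) hc)
    (fun t ht => (((hasDerivAt_exp_mul l t).hasDerivWithinAt (s := Ici t)).mul (hd t ht)).congr_deriv
      (by ring)) T ⟨hT, le_rfl⟩
  simp only [mul_zero, Real.exp_zero, one_mul] at h
  rw [← h]
  have : Real.exp (l * T) * Real.exp (-l * T) = 1 := by rw [← Real.exp_add]; simp
  linear_combination (-f T) * this

namespace BargainingGame

variable {B : BargainingGame} {S₁ : Strategy₁} {S₂ : Strategy₂}

/-! ### The path of play -/

/-- The overall probability of a challenge by time `t`, when the reputations reach one at time `T`: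
unjustified challenges occur until player 2's reputation reaches `muStar₂`, at the rate that makes
player 2 indifferent. -/
noncomputable def challengePath (B : BargainingGame) (T t : ℝ) : ℝ :=
  B.z₁ * ((1 - Real.exp (-B.γ₁ * t)) + B.k₂ / (1 - B.w₁ - B.k₂)
    * (1 - Real.exp (-B.γ₁ * min t (max (T - B.tauStar) 0))))

/-- The overall probability that player 1 has neither conceded nor challenged by time `t`, when the
reputations reach one at time `T`. -/
noncomputable def survivalPath (B : BargainingGame) (T t : ℝ) : ℝ :=
  B.z₁ * Real.exp (-B.γ₁ * t) * B.rho (T - t)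

lemma challengePath_zero (T : ℝ) : B.challengePath T 0 = 0 := by
  rw [challengePath, min_eq_left (le_max_right _ _)]; simp

lemma continuous_challengePath (T : ℝ) : Continuous (B.challengePath T) := by
  unfold challengePath; fun_prop

lemma continuous_survivalPath (T : ℝ) : Continuous (B.survivalPath T) := by
  have := continuous_rho (B := B)
  unfold survivalPath; fun_prop

lemma hasDerivWithinAt_challengePath (hB : B.Valid) (T : ℝ) {t : ℝ} (ht : 0 ≤ t) :
    HasDerivWithinAt (B.challengePath T) (B.z₁ * Real.exp (-B.γ₁ * t)
      * (B.γ₁ + if t < T - B.tauStar then B.γ₁ / B.nuStar₁ - B.γ₁ else 0)) (Ici t) t := by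
  have h1 : HasDerivAt (fun t => 1 - Real.exp (-B.γ₁ * t)) (B.γ₁ * Real.exp (-B.γ₁ * t)) t :=
    ((hasDerivAt_exp_mul (-B.γ₁) t).const_sub 1).congr_deriv (by ring)
  have h2 : HasDerivWithinAt
      (fun t => 1 - Real.exp (-B.γ₁ * min t (max (T - B.tauStar) 0)))
      (if t < T - B.tauStar then B.γ₁ * Real.exp (-B.γ₁ * t) else 0) (Ici t) t := by
    split_ifs with hlt
    · refine h1.hasDerivWithinAt.congr_of_eventuallyEq ?_ ?_
      · filter_upwards [nhdsWithin_le_nhds (Iio_mem_nhds hlt)] with s hs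
        rw [min_eq_left (le_max_of_le_left (le_of_lt hs))]
      · rw [min_eq_left (le_max_of_le_left hlt.le)]
    · have h3 : ∀ s, t ≤ s → min s (max (T - B.tauStar) 0) = max (T - B.tauStar) 0 := fun s hs =>
        min_eq_right (max_le ((not_lt.1 hlt).trans hs) (ht.trans hs))
      exact (hasDerivWithinAt_const t (Ici t) _).congr (fun s hs => by rw [h3 s hs])
        (by rw [h3 t le_rfl])
  refine ((h1.hasDerivWithinAt.add (h2.const_mul (B.k₂ / (1 - B.w₁ - B.k₂)))).const_mul
    B.z₁).congr_deriv ?_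
  rw [hB.excess_eq]
  split_ifs <;> ring

lemma hasDerivWithinAt_survivalPath (T t : ℝ) :
    HasDerivWithinAt (B.survivalPath T) (-B.lam₁ * B.survivalPath T t
      - B.z₁ * Real.exp (-B.γ₁ * t)
      * (B.γ₁ + if t < T - B.tauStar then B.γ₁ / B.nuStar₁ - B.γ₁ else 0)) (Ici t) t := by
  refine ((((hasDerivAt_exp_mul (-B.γ₁) t).const_mul B.z₁).hasDerivWithinAt).mul
    (hasDerivWithinAt_rho (B := B) T t)).congr_deriv ?_
  rw [survivalPath]; ring

/-! ### Uniqueness of the equilibrium payoffs -/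

namespace IsEquilibrium

lemma conceded₁_lt_iff (hB : B.Valid) {s t : ℝ} :
    conceded₁ S₁ B s < conceded₁ S₁ B t ↔ S₁.F s < S₁.F t :=
  mul_lt_mul_iff_right₀ (by linarith [hB.z₁_lt_one])

lemma conceded₂_lt_iff (hB : B.Valid) {s t : ℝ} :
    conceded₂ S₂ B s < conceded₂ S₂ B t ↔ S₂.F s < S₂.F t :=
  mul_lt_mul_iff_right₀ (by linarith [hB.z₂_lt_one])

lemma exists_lt₂ (hB : B.Valid) (hE : B.IsEquilibrium S₁ S₂) {s : ℝ} (h : S₂.F s < 1) :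
    ∃ t, S₂.F s < S₂.F t := by
  by_contra! hcon
  have := S₂.isSubDist.measureReal_univ_le hcon
  rw [(hE.optimal₂ hB).1] at this
  linarith

/-- Waiting has its maximal value for both players until player 2 has conceded for sure. -/
lemma gain_eq_value (hB : B.Valid) (hE : B.IsEquilibrium S₁ S₂) {s : ℝ} (hs : 0 ≤ s)
    (h : S₂.F s < 1) : gain₁ S₂ B s = B.value₁ S₁ S₂ ∧ gain₂ S₁ hB s = B.value₂ S₁ S₂ := by
  obtain ⟨t', ht'⟩ := hE.exists_lt₂ hB h
  refine waiting_value_eq_of_lt (conceded₁_mono (S₁ := S₁) hB) (conceded₂_mono (S₂ := S₂) hB)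
    (fun t _ => gain₁_rightCont hB t) (fun t _ => gain₂_rightCont hB t)
    (fun t => hE.gain₁_le hB) (fun t => hE.gain₂_le hB) (fun s t _ => gain₁_lt hB)
    (fun s t _ => gain₂_lt hB) (fun s t _ hst => ?_) (fun s t _ hst => ?_) hs
    ((conceded₂_lt_iff hB).2 ht')
  · obtain ⟨u, hu, -, h1, h2⟩ := StieltjesFunction.exists_of_lt (hE.ae_concede₁ hB)
      ((conceded₁_lt_iff hB).1 hst)
    exact ⟨u, hu, h1, leftLim_conceded₂ h2⟩
  · obtain ⟨u, hu, -, -, h1, h2⟩ := StieltjesFunction.exists_of_lt (hE.ae_concede₂ hB)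
      ((conceded₂_lt_iff hB).1 hst)
    exact ⟨u, hu, h1, leftLim_conceded₁ h2⟩

lemma survival₂_eq_of_F_eq_one {t : ℝ} (h : S₂.F t = 1) : survival₂ S₂ B t = B.z₂ := by
  rw [survival₂, conceded₂, h]; ring

/-- Unjustified challenges occur only while player 2 has not conceded for sure. -/
lemma ae_challenge_lt_one (hB : B.Valid) (hE : B.IsEquilibrium S₁ S₂) :
    ∀ᵐ t ∂S₁.G.measure, 0 ≤ t ∧ S₂.F t < 1 := by
  filter_upwards [hE.ae_challenge₁ hB] with t ht
  refine ⟨ht.1, lt_of_le_of_ne (S₂.F_le_one t) fun h => ?_⟩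
  have h1 := ht.2.1
  rw [survival₂_eq_of_F_eq_one h, sub_self] at h1
  linarith [mul_pos hB.c₁_pos hB.z₂_pos]

lemma F_zero_lt_one (hB : B.Valid) (hE : B.IsEquilibrium S₁ S₂) : S₂.F 0 < 1 := by
  refine lt_of_le_of_ne (S₂.F_le_one 0) fun h => ?_
  have hone : ∀ t, 0 ≤ t → S₂.F t = 1 := fun t ht =>
    le_antisymm (S₂.F_le_one t) (h.ge.trans (S₂.F.mono ht))
  have hG : S₁.G.measure = 0 := by
    rw [← ae_eq_bot, ← Filter.eventually_false_iff_eq_bot]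
    filter_upwards [hE.ae_challenge_lt_one hB] with t ht
    exact ht.2.ne (hone t ht.1)
  have hF : S₁.F.measure = 0 := by
    rw [← ae_eq_bot, ← Filter.eventually_false_iff_eq_bot]
    filter_upwards [hE.ae_concede₁ hB] with t ht
    rcases ht.1.eq_or_lt with h0 | h0
    · have := ht.2.2
      rw [← h0, S₂.isSubDist.leftLim_zero, h] at this
      exact zero_ne_one this
    · have h1 := gain₁_lt (S₂ := S₂) hB h0 (by rw [conceded₂, conceded₂, h, hone t ht.1])
      linarith [hE.gain₁_le hB le_rfl]
  have := (hE.optimal₁ hB).1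
  simp [hG, hF] at this

lemma survival₂_eq (hB : B.Valid) (hE : B.IsEquilibrium S₁ S₂) {T : ℝ} (hT : 0 ≤ T)
    (h : ∀ t ∈ Ico 0 T, S₂.F t < 1) :
    survival₂ S₂ B T = survival₂ S₂ B 0 * Real.exp (-B.lam₂ * T) := by
  have h0 : B.value₁ S₁ S₂ = conceded₂ S₂ B 0 := by
    rw [← gain₁_zero, (hE.gain_eq_value hB le_rfl (hE.F_zero_lt_one hB)).1]
  have hc : ∀ t ∈ Ico 0 T, gain₁ S₂ B t = conceded₂ S₂ B 0 := fun t ht => by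
    rw [(hE.gain_eq_value hB ht.1 (h t ht)).1, h0]
  have hcT : gain₁ S₂ B T ≤ conceded₂ S₂ B 0 := h0 ▸ hE.gain₁_le hB hT
  refine eq_mul_exp_of_hasDerivWithinAt hT (continuousOn_const.sub
    (continuousOn_of_netGain_const (conceded₂_mono hB) (survival₂_anti hB) hc hcT)) fun t ht => ?_
  exact ((hasDerivWithinAt_of_netGain_const (conceded₂_mono hB) (survival₂_anti hB) hc hcT ht
    (conceded₂_rightCont t) (survival₂_rightCont t)).const_sub 1).congr_deriv (by ring)

/-- Player 2 has conceded for sure by a finite time. -/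
lemma exists_end (hB : B.Valid) (hE : B.IsEquilibrium S₁ S₂) :
    ∃ T, 0 < T ∧ S₂.F T = 1 ∧ ∀ t ∈ Ico 0 T, S₂.F t < 1 := by
  let X : Set ℝ := {t | 0 ≤ t ∧ S₂.F t = 1}
  have hX : X.Nonempty := by
    by_contra hne
    rw [not_nonempty_iff_eq_empty] at hne
    have hlt : ∀ t, 0 ≤ t → S₂.F t < 1 := fun t ht =>
      lt_of_le_of_ne (S₂.F_le_one t) fun h => (hne ▸ (show t ∈ X from ⟨ht, h⟩) : t ∈ (∅ : Set ℝ))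
    have hl := hB.lam₂_pos
    set T := (1 - Real.log B.z₂) / B.lam₂ with hT
    have hT0 : 0 ≤ T := div_nonneg (by linarith [Real.log_neg hB.z₂_pos hB.z₂_lt_one]) hl.le
    have h1 := hE.survival₂_eq hB hT0 fun t ht => hlt t ht.1
    have h2 : Real.exp (-B.lam₂ * T) < B.z₂ := by
      rw [← Real.lt_log_iff_exp_lt hB.z₂_pos, hT, neg_mul, mul_div_cancel₀ _ hl.ne']; linarith
    have h3 : survival₂ S₂ B 0 ≤ 1 := by
      have := mul_nonneg (by linarith [hB.z₂_lt_one] : 0 ≤ 1 - B.z₂) (S₂.isSubDist.nonneg 0)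
      rw [survival₂, conceded₂]; linarith
    have h4 := le_survival₂ (S₂ := S₂) hB T
    have h5 := mul_le_mul_of_nonneg_right h3 (Real.exp_pos (-B.lam₂ * T)).le
    linarith
  have hXb : BddBelow X := ⟨0, fun t ht => ht.1⟩
  have hT0 : 0 ≤ sInf X := le_csInf hX fun t ht => ht.1
  have hFT : S₂.F (sInf X) = 1 := by
    have h1 : Tendsto S₂.F (𝓝[>] sInf X) (𝓝 (S₂.F (sInf X))) :=
      ((S₂.F.right_continuous (sInf X)).mono Ioi_subset_Ici_self).tendsto
    refine tendsto_nhds_unique h1 (tendsto_const_nhds.congr' ?_)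
    filter_upwards [self_mem_nhdsWithin] with t ht
    obtain ⟨x, hx, hxt⟩ := exists_lt_of_csInf_lt hX ht
    exact le_antisymm (hx.2 ▸ S₂.F.mono hxt.le) (S₂.F_le_one t)
  refine ⟨sInf X, lt_of_le_of_ne hT0 fun h => ?_, hFT, fun t ht => ?_⟩
  · exact (hE.F_zero_lt_one hB).ne (h ▸ hFT)
  · exact lt_of_le_of_ne (S₂.F_le_one t) fun h => notMem_of_lt_csInf ht.2 hXb ⟨ht.1, h⟩

section End

variable {T : ℝ}

lemma survival₂_eq_path (hB : B.Valid) (hE : B.IsEquilibrium S₁ S₂) (hF : S₂.F T = 1)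
    (hlt : ∀ t ∈ Ico 0 T, S₂.F t < 1) {t : ℝ} (ht : t ∈ Icc 0 T) :
    survival₂ S₂ B t = B.z₂ * Real.exp (B.lam₂ * (T - t)) := by
  have h1 := hE.survival₂_eq hB (ht.1.trans ht.2) hlt
  have h2 := hE.survival₂_eq hB ht.1 fun s hs => hlt s ⟨hs.1, hs.2.trans_le ht.2⟩
  rw [survival₂_eq_of_F_eq_one hF] at h1
  rw [h2, h1, mul_assoc, ← Real.exp_add]
  congr 2; ring

/-- Unjustified challenges end when the reputation of player 2 reaches `muStar₂`. -/
lemma ae_challenge_le (hB : B.Valid) (hE : B.IsEquilibrium S₁ S₂) (hF : S₂.F T = 1)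
    (hlt : ∀ t ∈ Ico 0 T, S₂.F t < 1) : ∀ᵐ t ∂S₁.G.measure, 0 ≤ t ∧ t ≤ T - B.tauStar := by
  filter_upwards [hE.ae_challenge₁ hB, hE.ae_challenge_lt_one hB] with t ht ht'
  have htT : t < T := by
    by_contra hge
    have := S₂.F.mono (not_lt.1 hge)
    linarith [ht'.2]
  refine ⟨ht.1, ?_⟩
  have h1 := ht.2.1
  rw [hE.survival₂_eq_path hB hF hlt ⟨ht.1, htT.le⟩] at h1
  have h2 : 1 ≤ B.muStar₂ * Real.exp (B.lam₂ * (T - t)) := by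
    refine le_of_mul_le_mul_left ?_ hB.z₂_pos
    rw [muStar₂]; linarith
  have h3 := Real.log_le_log one_pos h2
  rw [Real.log_one, Real.log_mul hB.muStar₂_pos.ne' (Real.exp_pos _).ne', Real.log_exp] at h3
  have h4 : B.tauStar ≤ T - t := by
    rw [tauStar, div_le_iff₀ hB.lam₂_pos]; linarith
  linarith

lemma G_const (hB : B.Valid) (hE : B.IsEquilibrium S₁ S₂) (hF : S₂.F T = 1)
    (hlt : ∀ t ∈ Ico 0 T, S₂.F t < 1) {s t : ℝ} (hst : s ≤ t) (hs : T - B.tauStar ≤ s) :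
    S₁.G t = S₁.G s := by
  by_contra hne
  obtain ⟨u, hu, h1, h2⟩ := StieltjesFunction.exists_of_lt (hE.ae_challenge_le hB hF hlt)
    (lt_of_le_of_ne (S₁.G.mono hst) (Ne.symm hne))
  linarith [hu.1]

/-- An optimal concession time of player 2 after a time at which he has not conceded for sure. -/
lemma exists_optimal₂ (hB : B.Valid) (hE : B.IsEquilibrium S₁ S₂) {s : ℝ} (h : S₂.F s < 1) :
    ∃ t, s < t ∧ 0 ≤ t ∧ B.concedeUtility₂ S₁ S₂.q t = B.utility₂ S₁ S₂ := by
  obtain ⟨t', ht'⟩ := hE.exists_lt₂ hB h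
  obtain ⟨u, hu, h0, h1, -⟩ := StieltjesFunction.exists_of_lt (hE.ae_concede₂ hB) ht'
  exact ⟨u, hu.1, h0, h1⟩

lemma challenge_le_of_lt (hB : B.Valid) (hE : B.IsEquilibrium S₁ S₂)
    {t : ℝ} (ht : 0 ≤ t) (h : S₂.F t < 1) :
    (1 - B.z₁) * (1 - B.w₁ - B.k₂) * S₁.G t
      ≤ B.z₁ * B.k₂ * (1 - Real.exp (-B.γ₁ * t)) := by
  obtain ⟨t', htt', h0, hopt⟩ := hE.exists_optimal₂ hB h
  have := hE.challenge_le hB h0 hopt (A := Icc 0 t) (fun s hs => ⟨hs.1, hs.2.trans_lt htt'⟩)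
    measurableSet_Icc
  rwa [S₁.isSubDist_G.measureReal_Icc, arrival_isSubDist.measureReal_Icc,
    arrival_of_nonneg ht] at this

/-- While the reputation of player 2 is below `muStar₂`, a challenge to which he yields for sure
would be profitable, so that his probability of yielding is bounded away from one. -/
lemma le_challenge_of_lt (hB : B.Valid) (hE : B.IsEquilibrium S₁ S₂) (hF : S₂.F T = 1)
    (hlt : ∀ t ∈ Ico 0 T, S₂.F t < 1) {t : ℝ} (ht : 0 ≤ t) (htT : t < T - B.tauStar) :
    B.z₁ * B.k₂ * (1 - Real.exp (-B.γ₁ * t))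
      ≤ (1 - B.z₁) * (1 - B.w₁ - B.k₂) * S₁.G t := by
  have hτ := hB.tauStar_pos
  have hw := hB.w₁_lt_one
  obtain ⟨t', htt', h0, hopt⟩ := hE.exists_optimal₂ hB (hlt t ⟨ht, by linarith⟩)
  set x := Real.exp (-(B.lam₂ * (T - t))) with hx
  have hxs : x < B.muStar₂ := by
    rw [hx, ← Real.lt_log_iff_exp_lt hB.muStar₂_pos]
    have : B.tauStar < T - t := by linarith
    rw [tauStar, div_lt_iff₀ hB.lam₂_pos] at this
    linarith
  have hxc : B.c₁ < 1 - x := by rw [muStar₂] at hxs; linarith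
  have hx1 : 0 < 1 - x := hB.c₁_pos.trans hxc
  have hε : 0 < (1 - B.c₁ / (1 - x)) / (1 - B.w₁) :=
    div_pos (sub_pos.2 ((div_lt_one hx1).2 hxc)) (by linarith)
  have := hE.le_challenge hB h0 hopt (A := Icc 0 t) (fun s hs => ⟨hs.1, hs.2.trans_lt htt'⟩)
    measurableSet_Icc hε (fun s hs => ?_)
  · rwa [S₁.isSubDist_G.measureReal_Icc, arrival_isSubDist.measureReal_Icc,
      arrival_of_nonneg ht] at this
  have hsT : s ∈ Ico 0 T := ⟨hs.1, by linarith [hs.2]⟩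
  have h1 := hE.challengeUtility₁_le hs.1
  rw [challengeUtility₁_eq hB hs.1, utility₁_eq_value hB, add_le_add_iff_left,
    (hE.gain_eq_value hB hs.1 (hlt s hsT)).1] at h1
  have h2 := le_of_mul_le_mul_left h1 hB.D_pos
  rw [add_le_iff_nonpos_right] at h2
  have h3 := nonpos_of_mul_nonpos_right h2 (Real.exp_pos _)
  have hS := survival₂_pos (S₂ := S₂) hB s
  have hzS : B.z₂ ≤ x * survival₂ S₂ B s := by
    rw [hE.survival₂_eq_path hB hF hlt ⟨hs.1, hsT.2.le⟩, mul_left_comm, hx, ← Real.exp_add]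
    refine le_mul_of_one_le_right hB.z₂_pos.le (Real.one_le_exp ?_)
    nlinarith [hB.lam₂_pos, hs.2]
  set y := (1 - S₂.q s) * B.w₁ + S₂.q s with hy
  have hy0 : 0 ≤ y := by nlinarith [hB.w₁_nonneg, S₂.q_le_one s, S₂.q_nonneg s]
  have h4 : survival₂ S₂ B s * ((1 - x) * y) ≤ survival₂ S₂ B s * B.c₁ := by
    nlinarith [mul_le_mul_of_nonneg_right hzS hy0]
  have h5 : y ≤ B.c₁ / (1 - x) := by
    rw [le_div_iff₀ hx1, mul_comm]; exact le_of_mul_le_mul_left h4 hS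
  rw [le_sub_comm, div_le_iff₀ (by linarith)]
  have : (1 - S₂.q s) * (1 - B.w₁) = 1 - y := by rw [hy]; ring
  linarith

/-- The challenges are determined by the time at which the reputations reach one. -/
lemma challenged₁_eq_path (hB : B.Valid) (hE : B.IsEquilibrium S₁ S₂) (hF : S₂.F T = 1)
    (hlt : ∀ t ∈ Ico 0 T, S₂.F t < 1) {t : ℝ} (ht : 0 ≤ t) :
    challenged₁ S₁ hB t = B.challengePath T t := by
  have hκ := hB.court_pos
  have hτ := hB.tauStar_pos
  have key : ∀ s, 0 ≤ s → s ≤ T - B.tauStar → (1 - B.z₁) * (1 - B.w₁ - B.k₂) * S₁.G s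
      = B.z₁ * B.k₂ * (1 - Real.exp (-B.γ₁ * s)) := by
    intro s hs hsT
    refine le_antisymm (hE.challenge_le_of_lt hB hs (hlt s ⟨hs, by linarith⟩)) ?_
    rcases hsT.lt_or_eq with hsT' | hsT'
    · exact hE.le_challenge_of_lt hB hF hlt hs hsT'
    · rcases hs.eq_or_lt with h0 | h0
      · rw [← h0]; simp only [mul_zero, Real.exp_zero, sub_self]
        exact mul_nonneg (mul_nonneg (by linarith [hB.z₁_lt_one]) hκ.le) (S₁.isSubDist_G.nonneg 0)
      have hlim : Tendsto (fun u => B.z₁ * B.k₂ * (1 - Real.exp (-B.γ₁ * u))) (𝓝[<] s)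
          (𝓝 (B.z₁ * B.k₂ * (1 - Real.exp (-B.γ₁ * s)))) :=
        (Continuous.tendsto (by fun_prop) s).mono_left nhdsWithin_le_nhds
      refine le_of_tendsto hlim ?_
      filter_upwards [Ico_mem_nhdsLT h0] with u hu
      refine (hE.le_challenge_of_lt hB hF hlt hu.1 (hu.2.trans_eq hsT')).trans ?_
      exact mul_le_mul_of_nonneg_left (S₁.G.mono hu.2.le)
        (mul_nonneg (by linarith [hB.z₁_lt_one]) hκ.le)
  have hG : (1 - B.z₁) * S₁.G t = B.z₁ * (B.k₂ / (1 - B.w₁ - B.k₂)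
      * (1 - Real.exp (-B.γ₁ * min t (max (T - B.tauStar) 0)))) := by
    have hm : (1 - B.z₁) * (1 - B.w₁ - B.k₂) * S₁.G t = B.z₁ * B.k₂
        * (1 - Real.exp (-B.γ₁ * min t (max (T - B.tauStar) 0))) := by
      rcases le_total t (T - B.tauStar) with h | h
      · rw [min_eq_left (le_max_of_le_left h), key t ht h]
      · rcases le_total 0 (T - B.tauStar) with h' | h'
        · rw [max_eq_left h', min_eq_right h, hE.G_const hB hF hlt h le_rfl, key _ h' le_rfl]
        · rw [max_eq_right h', min_eq_right ht]
          simp only [mul_zero, Real.exp_zero, sub_self]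
          rcases h'.eq_or_lt with h'' | h''
          · have := key 0 le_rfl h''.ge
            rw [hE.G_const hB hF hlt ht h''.le, this]; simp
          · have hlt0 : max (T - B.tauStar) (-1) < 0 := max_lt h'' (by norm_num)
            rw [hE.G_const hB hF hlt (hlt0.le.trans ht) (le_max_left _ _), S₁.G_neg _ hlt0, mul_zero]
    generalize 1 - Real.exp (-B.γ₁ * min t (max (T - B.tauStar) 0)) = e at hm ⊢
    field_simp
    linear_combination hm
  rw [challenged₁, hG, arrival_of_nonneg ht, challengePath]
  ring

/-- Player 1's reputation moves along the coevolution curve. -/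
lemma survival₁_zero_eq (hB : B.Valid) (hE : B.IsEquilibrium S₁ S₂) (hT : 0 < T)
    (hF : S₂.F T = 1) (hlt : ∀ t ∈ Ico 0 T, S₂.F t < 1) :
    conceded₁ S₁ B 0 = 1 - B.z₁ * B.rho T := by
  have h0 : B.value₂ S₁ S₂ = conceded₁ S₁ B 0 := by
    rw [← gain₂_zero hB, (hE.gain_eq_value hB le_rfl (hE.F_zero_lt_one hB)).2]
  have hc : ∀ t ∈ Ico 0 T, gain₂ S₁ hB t = conceded₁ S₁ B 0 := fun t ht => by
    rw [(hE.gain_eq_value hB ht.1 (hlt t ht)).2, h0]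
  have hcT : gain₂ S₁ hB T ≤ conceded₁ S₁ B 0 := h0 ▸ hE.gain₂_le hB hT.le
  have hcont := continuousOn_of_netGain_const (conceded₁_mono hB) (survival₁_anti hB) hc hcT
  have hder : ∀ t ∈ Ico 0 T, HasDerivWithinAt (conceded₁ S₁ B) (B.lam₁ * survival₁ S₁ hB t)
      (Ici t) t := fun t ht => hasDerivWithinAt_of_netGain_const (conceded₁_mono hB)
    (survival₁_anti hB) hc hcT ht (conceded₁_rightCont t) (survival₁_rightCont hB t)
  -- The deviation from the path vanishes at `T` and solves a linear equation.
  let f : ℝ → ℝ := fun t => 1 - conceded₁ S₁ B t - B.challengePath T t - B.survivalPath T t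
  have hs : ∀ t, 0 ≤ t → survival₁ S₁ hB t = 1 - conceded₁ S₁ B t - B.challengePath T t :=
    fun t ht => by rw [survival₁, hE.challenged₁_eq_path hB hF hlt ht]
  have hfT := eq_mul_exp_of_hasDerivWithinAt (f := f) (l := B.lam₁) hT.le
    (((continuousOn_const.sub hcont).sub (continuous_challengePath T).continuousOn).sub
      (continuous_survivalPath T).continuousOn) (fun t ht => by
      refine ((((hder t ht).const_sub 1).sub (hasDerivWithinAt_challengePath hB T ht.1)).sub
        (hasDerivWithinAt_survivalPath T t)).congr_deriv ?_
      simp only [f]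
      rw [hs t ht.1]; ring)
  -- At time `T` an unjustified player 1 has conceded or challenged for sure.
  have hFc : ∀ s, T ≤ s → S₁.F s = S₁.F T := fun s hsT => by
    by_contra hne
    obtain ⟨u, hu, -, hw, -⟩ := StieltjesFunction.exists_of_lt (hE.ae_concede₁ hB)
      (lt_of_le_of_ne (S₁.F.mono hsT) (Ne.symm hne))
    have h1 : S₂.F u = 1 := le_antisymm (S₂.F_le_one u) (hF ▸ S₂.F.mono hu.1.le)
    have h2 := gain₁_lt (S₂ := S₂) hB hu.1 (by rw [conceded₂, conceded₂, hF, h1])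
    linarith [hE.gain₁_le hB hT.le]
  have hτ := hB.tauStar_pos
  have hm := (hE.optimal₁ hB).1
  rw [S₁.isSubDist_F.eq_measureReal_univ hFc, S₁.isSubDist_G.eq_measureReal_univ
    (t := T) (fun s hsT => hE.G_const hB hF hlt hsT (by linarith))] at hm
  have hsT : survival₁ S₁ hB T = B.survivalPath T T := by
    rw [survival₁, conceded₁, challenged₁, arrival_of_nonneg hT.le, survivalPath, sub_self,
      rho_zero hB]
    linear_combination (-(1 - B.z₁)) * hm
  have hf0 : f 0 = 0 := by
    have h1 : f T = 0 := by
      simp only [f]; rw [← hs T hT.le, hsT, sub_self]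
    rw [h1] at hfT
    exact (mul_eq_zero.1 hfT.symm).resolve_right (Real.exp_pos _).ne'
  simp only [f, challengePath_zero, survivalPath, mul_zero, Real.exp_zero, mul_one, sub_zero] at hf0
  linarith

end End

/-- At most one of the players concedes with positive probability at time zero. -/
lemma conceded_zero (hB : B.Valid) (hE : B.IsEquilibrium S₁ S₂) :
    conceded₂ S₂ B 0 = 0 ∨ conceded₁ S₁ B 0 = 0 := by
  rw [or_iff_not_imp_right]
  intro h
  have h1 : S₁.F (-1) < S₁.F 0 := by
    rw [S₁.F_neg _ (by norm_num)]
    refine lt_of_le_of_ne (S₁.isSubDist_F.nonneg 0) fun h' => h ?_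
    rw [conceded₁, ← h', mul_zero]
  obtain ⟨u, hu, h0, -, hl⟩ := StieltjesFunction.exists_of_lt (hE.ae_concede₁ hB) h1
  obtain rfl : u = 0 := le_antisymm hu.2 h0
  rw [conceded₂, ← hl, S₂.isSubDist.leftLim_zero, mul_zero]

theorem utility_eq_payoff (hB : B.Valid) (hE : B.IsEquilibrium S₁ S₂) :
    B.utility₁ S₁ S₂ = B.payoff₁ ∧ B.utility₂ S₁ S₂ = B.payoff₂ := by
  obtain ⟨T, hT, hF, hlt⟩ := hE.exists_end hB
  have hv := hE.gain_eq_value hB le_rfl (hE.F_zero_lt_one hB)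
  rw [gain₁_zero, gain₂_zero] at hv
  have h1 := hE.survival₁_zero_eq hB hT hF hlt
  have h2 : conceded₂ S₂ B 0 = 1 - B.z₂ * Real.exp (B.lam₂ * T) := by
    have h := hE.survival₂_eq_path hB hF hlt ⟨le_rfl, hT.le⟩
    rw [survival₂, sub_zero] at h; linarith
  have n1 : 0 ≤ conceded₁ S₁ B 0 :=
    mul_nonneg (by linarith [hB.z₁_lt_one]) (S₁.isSubDist_F.nonneg 0)
  have n2 : 0 ≤ conceded₂ S₂ B 0 :=
    mul_nonneg (by linarith [hB.z₂_lt_one]) (S₂.isSubDist.nonneg 0)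
  have hp := payoff_eq_of_time hB hT.le (by linarith) (by linarith)
    ((hE.conceded_zero hB).imp (fun h => by linarith) (fun h => by linarith))
  rw [utility₁_eq_value hB, utility₂_eq_value hB, ← hv.1, ← hv.2, h1, h2]
  exact ⟨hp.1.symm, hp.2.symm⟩

end IsEquilibrium

end BargainingGame

namespace BargainingGame

variable {B : BargainingGame} {T : ℝ}

/-! ### Existence of an equilibrium -/

/-- The overall probability that player 1 has conceded by time `t`, when the reputations reach one at
time `T`. -/
noncomputable def concessionPath (B : BargainingGame) (T t : ℝ) : ℝ :=
  1 - B.challengePath T t - B.survivalPath T t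

/-- The probability with which player 2 yields to a challenge at time `t`, when the reputations reach
one at time `T`: below the reputation `muStar₂` it makes player 1 indifferent between challenging and
conceding. -/
noncomputable def yieldPath (B : BargainingGame) (T t : ℝ) : ℝ :=
  if t < T - B.tauStar then (B.c₁ / (1 - Real.exp (-(B.lam₂ * (T - t)))) - B.w₁) / (1 - B.w₁) else 1

lemma continuous_concessionPath : Continuous (B.concessionPath T) :=
  (continuous_const.sub (continuous_challengePath T)).sub (continuous_survivalPath T)

lemma hasDerivWithinAt_concessionPath (hB : B.Valid) {t : ℝ} (ht : 0 ≤ t) :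
    HasDerivWithinAt (B.concessionPath T) (B.lam₁ * B.survivalPath T t) (Ici t) t :=
  (((hasDerivWithinAt_challengePath hB T ht).const_sub 1).sub
    (hasDerivWithinAt_survivalPath T t)).congr_deriv (by ring)

lemma le_survivalPath (hB : B.Valid) {t : ℝ} (ht : t ≤ T) :
    B.z₁ * Real.exp (-B.γ₁ * t) ≤ B.survivalPath T t :=
  le_mul_of_one_le_right (mul_nonneg hB.z₁_pos.le (Real.exp_pos _).le)
    (one_le_rho hB (sub_nonneg.2 ht))

lemma concessionPath_monotoneOn (hB : B.Valid) : MonotoneOn (B.concessionPath T) (Icc 0 T) := by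
  intro s hs t ht hst
  have h := intervalIntegral.integral_eq_sub_of_hasDeriv_right_of_le hst
    (continuous_concessionPath (B := B) (T := T)).continuousOn
    (fun u hu => (hasDerivWithinAt_concessionPath hB (hs.1.trans hu.1.le)).mono Ioi_subset_Ici_self)
    ((continuous_const.mul (continuous_survivalPath T)).intervalIntegrable s t)
  have h2 : 0 ≤ ∫ u in s..t, B.lam₁ * B.survivalPath T u :=
    intervalIntegral.integral_nonneg hst fun u hu => mul_nonneg hB.lam₁_pos.le
      ((mul_nonneg hB.z₁_pos.le (Real.exp_pos _).le).trans
        (le_survivalPath hB (hu.2.trans ht.2)))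
  linarith

lemma concessionPath_zero : B.concessionPath T 0 = 1 - B.z₁ * B.rho T := by
  simp [concessionPath, challengePath_zero, survivalPath]

lemma min_mem_Icc (hT : 0 ≤ T) {t : ℝ} (ht : 0 ≤ t) : min t T ∈ Icc 0 T :=
  ⟨le_min ht hT, min_le_right _ _⟩

/-- The ratio of unjustified to justified challenges, per unjustified player 1. -/
lemma excess_nonneg' (hB : B.Valid) : 0 ≤ B.z₁ * (B.k₂ / (1 - B.w₁ - B.k₂)) / (1 - B.z₁) :=
  div_nonneg (mul_nonneg hB.z₁_pos.le (div_nonneg hB.k₂_pos.le hB.court_pos.le))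
    (by linarith [hB.z₁_lt_one])

lemma one_sub_exp_mono (hB : B.Valid) {s t : ℝ} (h : s ≤ t) :
    1 - Real.exp (-B.γ₁ * s) ≤ 1 - Real.exp (-B.γ₁ * t) := by
  have : Real.exp (-B.γ₁ * t) ≤ Real.exp (-B.γ₁ * s) :=
    Real.exp_le_exp.2 (by nlinarith [mul_le_mul_of_nonneg_left h hB.γ₁_nonneg])
  linarith

lemma yieldPath_bounds (hB : B.Valid) (t : ℝ) : 0 ≤ B.yieldPath T t ∧ B.yieldPath T t ≤ 1 := by
  rw [yieldPath]
  split_ifs with h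
  · have hw := hB.w₁_lt_one
    set x := Real.exp (-(B.lam₂ * (T - t))) with hx
    have hx0 : 0 < x := Real.exp_pos _
    have hxs : x < B.muStar₂ := by
      rw [hx, ← Real.lt_log_iff_exp_lt hB.muStar₂_pos]
      have : B.tauStar < T - t := by linarith
      rw [tauStar, div_lt_iff₀ hB.lam₂_pos] at this
      linarith
    have hxc : B.c₁ < 1 - x := by rw [muStar₂] at hxs; linarith
    have h1 : B.c₁ / (1 - x) ≤ 1 := (div_le_one (hB.c₁_pos.trans hxc)).2 hxc.le
    have h2 : B.c₁ ≤ B.c₁ / (1 - x) :=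
      le_div_self hB.c₁_pos.le (hB.c₁_pos.trans hxc) (by linarith)
    constructor
    · exact div_nonneg (by linarith [hB.w₁_lt_c₁]) (by linarith)
    · rw [div_le_one (by linarith)]; linarith
  · exact ⟨zero_le_one, le_rfl⟩

lemma measurable_yieldPath : Measurable (B.yieldPath T) :=
  Measurable.ite measurableSet_Iio (by fun_prop) measurable_const

lemma div_one_sub_monotoneOn₂ (hB : B.Valid) : MonotoneOn
    (fun t => (1 - B.z₂ * Real.exp (B.lam₂ * (T - min t T))) / (1 - B.z₂)) (Ici 0) := by
  intro s _ t _ hst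
  have h1 : Real.exp (B.lam₂ * (T - min t T)) ≤ Real.exp (B.lam₂ * (T - min s T)) :=
    Real.exp_le_exp.2 (mul_le_mul_of_nonneg_left
      (sub_le_sub_left (min_le_min_right T hst) T) hB.lam₂_pos.le)
  have h2 := mul_le_mul_of_nonneg_left h1 hB.z₂_pos.le
  exact div_le_div_of_nonneg_right (by linarith) (by linarith [hB.z₂_lt_one])

lemma div_one_sub_monotoneOn₁ (hB : B.Valid) (hT : 0 ≤ T) :
    MonotoneOn (fun t => B.concessionPath T (min t T) / (1 - B.z₁)) (Ici 0) :=
  fun _ hs _ ht hst => div_le_div_of_nonneg_right (concessionPath_monotoneOn hB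
    (min_mem_Icc hT hs) (min_mem_Icc hT ht) (min_le_min_right T hst)) (by linarith [hB.z₁_lt_one])

lemma excess_monotoneOn (hB : B.Valid) :
    MonotoneOn (fun t => B.z₁ * (B.k₂ / (1 - B.w₁ - B.k₂)) / (1 - B.z₁)
      * (1 - Real.exp (-B.γ₁ * min t (max (T - B.tauStar) 0)))) (Ici 0) :=
  fun _ _ _ _ hst => mul_le_mul_of_nonneg_left (one_sub_exp_mono hB (min_le_min_right _ hst))
    (excess_nonneg' hB)

lemma div_one_sub_nonneg₂ (hB : B.Valid) (h₂ : B.z₂ * Real.exp (B.lam₂ * T) ≤ 1) (hT : 0 ≤ T) :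
    0 ≤ (1 - B.z₂ * Real.exp (B.lam₂ * (T - min 0 T))) / (1 - B.z₂) := by
  rw [min_eq_left hT, sub_zero]
  exact div_nonneg (by linarith) (by linarith [hB.z₂_lt_one])

lemma div_one_sub_nonneg₁ (hB : B.Valid) (h₁ : B.z₁ * B.rho T ≤ 1) (hT : 0 ≤ T) :
    0 ≤ B.concessionPath T (min 0 T) / (1 - B.z₁) := by
  rw [min_eq_left hT, concessionPath_zero]
  exact div_nonneg (by linarith) (by linarith [hB.z₁_lt_one])

/-- The concessions of an unjustified player 2, when the reputations reach one at time `T`. -/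
noncomputable def pathF₂ (hB : B.Valid) (h₂ : B.z₂ * Real.exp (B.lam₂ * T) ≤ 1) (hT : 0 ≤ T) :
    StieltjesFunction ℝ :=
  .ofContinuousOn _ (div_one_sub_monotoneOn₂ (T := T) hB) (Continuous.continuousOn (by fun_prop))
    (div_one_sub_nonneg₂ hB h₂ hT)

/-- The concessions of an unjustified player 1, when the reputations reach one at time `T`. -/
noncomputable def pathF₁ (hB : B.Valid) (h₁ : B.z₁ * B.rho T ≤ 1) (hT : 0 ≤ T) :
    StieltjesFunction ℝ :=
  .ofContinuousOn _ (div_one_sub_monotoneOn₁ hB hT)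
    ((continuous_concessionPath.comp (continuous_id.min continuous_const)).div_const _).continuousOn
    (div_one_sub_nonneg₁ hB h₁ hT)

/-- The challenges of an unjustified player 1, when the reputations reach one at time `T`. -/
noncomputable def pathG₁ (hB : B.Valid) (T : ℝ) : StieltjesFunction ℝ :=
  .ofContinuousOn _ (excess_monotoneOn (T := T) hB) (Continuous.continuousOn (by fun_prop))
    (by rw [min_eq_left (le_max_right _ _)]; simp)

lemma pathF₂_apply {hB : B.Valid} {h₂ : B.z₂ * Real.exp (B.lam₂ * T) ≤ 1} {hT : 0 ≤ T} {t : ℝ}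
    (ht : 0 ≤ t) :
    pathF₂ hB h₂ hT t = (1 - B.z₂ * Real.exp (B.lam₂ * (T - min t T))) / (1 - B.z₂) :=
  StieltjesFunction.ofContinuousOn_of_nonneg ht

lemma pathF₁_apply {hB : B.Valid} {h₁ : B.z₁ * B.rho T ≤ 1} {hT : 0 ≤ T} {t : ℝ} (ht : 0 ≤ t) :
    pathF₁ hB h₁ hT t = B.concessionPath T (min t T) / (1 - B.z₁) :=
  StieltjesFunction.ofContinuousOn_of_nonneg ht

lemma leftLim_pathF₂ {hB : B.Valid} {h₂ : B.z₂ * Real.exp (B.lam₂ * T) ≤ 1} {hT : 0 ≤ T} {t : ℝ}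
    (ht : 0 < t) : Function.leftLim (pathF₂ hB h₂ hT) t = pathF₂ hB h₂ hT t := by
  rw [pathF₂_apply ht.le, pathF₂, StieltjesFunction.leftLim_ofContinuousOn ht]

lemma leftLim_pathF₁ {hB : B.Valid} {h₁ : B.z₁ * B.rho T ≤ 1} {hT : 0 ≤ T} {t : ℝ} (ht : 0 < t) :
    Function.leftLim (pathF₁ hB h₁ hT) t = pathF₁ hB h₁ hT t := by
  rw [pathF₁_apply ht.le, pathF₁, StieltjesFunction.leftLim_ofContinuousOn ht]

lemma pathG₁_apply {hB : B.Valid} {t : ℝ} (ht : 0 ≤ t) :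
    pathG₁ hB T t = B.z₁ * (B.k₂ / (1 - B.w₁ - B.k₂)) / (1 - B.z₁)
      * (1 - Real.exp (-B.γ₁ * min t (max (T - B.tauStar) 0))) :=
  StieltjesFunction.ofContinuousOn_of_nonneg ht

/-- The strategy of player 2 in the equilibrium in which the reputations reach one at time `T`. -/
noncomputable def pathStrategy₂ (hB : B.Valid) (h₂ : B.z₂ * Real.exp (B.lam₂ * T) ≤ 1)
    (hT : 0 ≤ T) : Strategy₂ where
  F := pathF₂ hB h₂ hT
  F_neg _ ht := StieltjesFunction.ofContinuousOn_of_neg ht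
  F_le_one := StieltjesFunction.IsSubDist.le_one
    (StieltjesFunction.ofContinuousOn_isSubDist fun t _ => by
      rw [div_le_one (by linarith [hB.z₂_lt_one])]
      have h1 : 1 ≤ Real.exp (B.lam₂ * (T - min t T)) :=
        Real.one_le_exp (mul_nonneg hB.lam₂_pos.le (sub_nonneg.2 (min_le_right _ _)))
      nlinarith [hB.z₂_pos])
  q := B.yieldPath T
  q_meas := measurable_yieldPath
  q_nonneg t := (yieldPath_bounds hB t).1
  q_le_one t := (yieldPath_bounds hB t).2

/-- The strategy of player 1 in the equilibrium in which the reputations reach one at time `T`. -/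
noncomputable def pathStrategy₁ (hB : B.Valid) (h₁ : B.z₁ * B.rho T ≤ 1) (hT : 0 ≤ T) :
    Strategy₁ where
  F := pathF₁ hB h₁ hT
  G := pathG₁ hB T
  F_neg _ ht := StieltjesFunction.ofContinuousOn_of_neg ht
  G_neg _ ht := StieltjesFunction.ofContinuousOn_of_neg ht
  add_le_one t := by
    rcases lt_or_ge t 0 with ht | ht
    · have h1 : pathF₁ hB h₁ hT t = 0 := StieltjesFunction.ofContinuousOn_of_neg ht
      have h2 : pathG₁ hB T t = 0 := StieltjesFunction.ofContinuousOn_of_neg ht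
      rw [h1, h2]; norm_num
    · rw [pathF₁_apply ht, pathG₁_apply ht]
      have hz : 0 < 1 - B.z₁ := by linarith [hB.z₁_lt_one]
      have hmin : min (min t T) (max (T - B.tauStar) 0) = min t (max (T - B.tauStar) 0) := by
        rw [min_assoc, min_eq_right (max_le (by linarith [hB.tauStar_pos]) hT)]
      have h1 := le_survivalPath hB (min_le_right t T)
      rw [div_mul_eq_mul_div, ← add_div, div_le_one hz, concessionPath, challengePath, hmin]
      linarith

section Path

variable {hB : B.Valid} {h₁ : B.z₁ * B.rho T ≤ 1} {h₂ : B.z₂ * Real.exp (B.lam₂ * T) ≤ 1}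
  {hT : 0 ≤ T} {t : ℝ}

lemma conceded₁_path (ht : 0 ≤ t) :
    conceded₁ (pathStrategy₁ hB h₁ hT) B t = B.concessionPath T (min t T) := by
  have hz : 1 - B.z₁ ≠ 0 := by linarith [hB.z₁_lt_one]
  rw [conceded₁, pathStrategy₁, pathF₁_apply ht, mul_div_cancel₀ _ hz]

lemma challenged₁_path (ht : 0 ≤ t) :
    challenged₁ (pathStrategy₁ hB h₁ hT) hB t = B.challengePath T t := by
  have hz : 1 - B.z₁ ≠ 0 := by linarith [hB.z₁_lt_one]
  rw [challenged₁, pathStrategy₁, pathG₁_apply ht,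
    arrival_of_nonneg ht, challengePath, ← mul_assoc, mul_div_cancel₀ _ hz]
  ring

lemma survival₁_path (ht : t ∈ Icc 0 T) :
    survival₁ (pathStrategy₁ hB h₁ hT) hB t = B.survivalPath T t := by
  rw [survival₁, conceded₁_path ht.1, challenged₁_path ht.1, min_eq_left ht.2, concessionPath]
  ring

lemma conceded₂_path (ht : 0 ≤ t) : conceded₂ (pathStrategy₂ hB h₂ hT) B t
    = 1 - B.z₂ * Real.exp (B.lam₂ * (T - min t T)) := by
  have hz : 1 - B.z₂ ≠ 0 := by linarith [hB.z₂_lt_one]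
  rw [conceded₂, pathStrategy₂, pathF₂_apply ht, mul_div_cancel₀ _ hz]

lemma survival₂_path (ht : 0 ≤ t) : survival₂ (pathStrategy₂ hB h₂ hT) B t
    = B.z₂ * Real.exp (B.lam₂ * (T - min t T)) := by
  rw [survival₂, conceded₂_path ht]; ring

lemma gain₂_path (ht : t ∈ Icc 0 T) : gain₂ (pathStrategy₁ hB h₁ hT) hB t
    = conceded₁ (pathStrategy₁ hB h₁ hT) B 0 := by
  have heq : EqOn (conceded₁ (pathStrategy₁ hB h₁ hT) B) (B.concessionPath T) (Icc 0 T) :=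
    fun s hs => by rw [conceded₁_path hs.1, min_eq_left hs.2]
  refine netGain_const_of_hasDerivWithinAt (conceded₁_mono hB) (survival₁_anti hB) (T := T)
    (continuous_concessionPath.continuousOn.congr heq) (fun s hs => ?_)
    (fun s _ => survival₁_rightCont hB s) ht
  have hs' : s ∈ Icc 0 T := ⟨hs.1, hs.2.le⟩
  rw [survival₁_path hs']
  refine (hasDerivWithinAt_concessionPath hB hs.1).congr_of_eventuallyEq ?_ (heq hs')
  filter_upwards [Icc_mem_nhdsGE hs.2] with u hu using heq ⟨hs.1.trans hu.1, hu.2⟩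

lemma gain₁_path (ht : t ∈ Icc 0 T) : gain₁ (pathStrategy₂ hB h₂ hT) B t
    = conceded₂ (pathStrategy₂ hB h₂ hT) B 0 := by
  have heq : EqOn (conceded₂ (pathStrategy₂ hB h₂ hT) B)
      (fun t => 1 - B.z₂ * Real.exp (B.lam₂ * (T - t))) (Icc 0 T) :=
    fun s hs => by rw [conceded₂_path hs.1, min_eq_left hs.2]
  refine netGain_const_of_hasDerivWithinAt (conceded₂_mono hB) (survival₂_anti hB) (T := T)
    ((Continuous.continuousOn (by fun_prop)).congr heq) (fun s hs => ?_)
    (fun s _ => survival₂_rightCont s) ht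
  have hs' : s ∈ Icc 0 T := ⟨hs.1, hs.2.le⟩
  rw [survival₂_path hs.1, min_eq_left hs'.2]
  have hd : HasDerivAt (fun t => 1 - B.z₂ * Real.exp (B.lam₂ * (T - t)))
      (B.lam₂ * (B.z₂ * Real.exp (B.lam₂ * (T - s)))) s := by
    have h1 : HasDerivAt (fun t => B.lam₂ * (T - t)) (-B.lam₂) s := by
      simpa using ((hasDerivAt_id s).const_sub T).const_mul B.lam₂
    exact ((h1.exp.const_mul B.z₂).const_sub 1).congr_deriv (by ring)
  refine hd.hasDerivWithinAt.congr_of_eventuallyEq ?_ (heq hs')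
  filter_upwards [Icc_mem_nhdsGE hs.2] with u hu using heq ⟨hs.1.trans hu.1, hu.2⟩

lemma gain₂_path_le (ht : 0 ≤ t) : gain₂ (pathStrategy₁ hB h₁ hT) hB t
    ≤ conceded₁ (pathStrategy₁ hB h₁ hT) B 0 := by
  rcases le_or_gt t T with h | h
  · exact (gain₂_path ⟨ht, h⟩).le
  · rw [← gain₂_path (T := T) (t := T) ⟨hT, le_rfl⟩]
    refine (gain₂_lt hB h ?_).le
    rw [conceded₁_path hT, conceded₁_path ht, min_self, min_eq_right h.le]

lemma gain₁_path_le (ht : 0 ≤ t) : gain₁ (pathStrategy₂ hB h₂ hT) B t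
    ≤ conceded₂ (pathStrategy₂ hB h₂ hT) B 0 := by
  rcases le_or_gt t T with h | h
  · exact (gain₁_path ⟨ht, h⟩).le
  · rw [← gain₁_path (T := T) (t := T) ⟨hT, le_rfl⟩]
    refine (gain₁_lt hB h ?_).le
    rw [conceded₂_path hT, conceded₂_path ht, min_self, min_eq_right h.le]

/-- Against the yielding probabilities of the path, challenging never beats conceding, and it is as good
until the reputation of player 2 reaches `muStar₂`. -/
lemma challenge_benefit (ht : 0 ≤ t) :
    (survival₂ (pathStrategy₂ hB h₂ hT) B t - B.z₂)
        * ((1 - B.yieldPath T t) * B.w₁ + B.yieldPath T t)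
      - B.c₁ * survival₂ (pathStrategy₂ hB h₂ hT) B t ≤ 0 ∧
    (t ≤ T - B.tauStar → (survival₂ (pathStrategy₂ hB h₂ hT) B t - B.z₂)
        * ((1 - B.yieldPath T t) * B.w₁ + B.yieldPath T t)
      - B.c₁ * survival₂ (pathStrategy₂ hB h₂ hT) B t = 0) := by
  have hτ := hB.tauStar_pos
  have hs := hB.muStar₂_pos
  have hl := hB.lam₂_pos
  set S := survival₂ (pathStrategy₂ hB h₂ hT) B t with hS
  have hS0 : 0 < S := survival₂_pos hB t
  set x := Real.exp (-(B.lam₂ * (T - min t T))) with hx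
  have hSx : S - B.z₂ = S * (1 - x) := by
    have : Real.exp (B.lam₂ * (T - min t T)) * x = 1 := by rw [hx, ← Real.exp_add]; simp
    rw [hS, survival₂_path ht]
    linear_combination B.z₂ * this
  rw [hSx]
  rcases lt_or_ge t (T - B.tauStar) with h | h
  · have hw : 1 - B.w₁ ≠ 0 := by linarith [hB.w₁_lt_one]
    have hmin : min t T = t := min_eq_left (by linarith)
    rw [hmin] at hx
    have hx1 : 1 - x ≠ 0 := by
      have : x < 1 := Real.exp_lt_one_iff.2 (by nlinarith)
      linarith
    have key : S * (1 - x) * ((1 - B.yieldPath T t) * B.w₁ + B.yieldPath T t) - B.c₁ * S = 0 := by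
      rw [yieldPath, if_pos h, ← hx]
      field_simp
      ring
    exact ⟨key.le, fun _ => key⟩
  · rw [yieldPath, if_neg (not_lt.2 h)]
    constructor
    · have h1 : B.muStar₂ ≤ x := by
        rw [hx, ← Real.log_le_iff_le_exp hs]
        have : T - min t T ≤ B.tauStar := by
          rcases min_choice t T with h' | h' <;> rw [h'] <;> linarith
        rw [tauStar, le_div_iff₀ hl] at this
        linarith
      rw [muStar₂] at h1
      nlinarith
    · intro h'
      have h1 : x = B.muStar₂ := by
        rw [hx, min_eq_left (by linarith), le_antisymm h' h, sub_sub_cancel, tauStar,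
          mul_div_cancel₀ _ hl.ne', neg_neg, Real.exp_log hs]
      rw [h1, muStar₂]; ring

/-- On the equilibrium path, unjustified challenges are proportional to justified ones until the
reputation of player 2 reaches `muStar₂`. -/
lemma measure_G_path : (pathStrategy₁ hB h₁ hT).G.measure
    = ENNReal.ofReal (B.z₁ * (B.k₂ / (1 - B.w₁ - B.k₂)) / (1 - B.z₁))
      • (arrival B.γ₁ hB.γ₁_nonneg).measure.restrict (Iic (max (T - B.tauStar) 0)) := by
  have := (pathStrategy₁ hB h₁ hT).isSubDist_G.isFiniteMeasure
  refine Measure.ext_of_Iic _ _ fun a => ?_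
  rw [(pathStrategy₁ hB h₁ hT).isSubDist_G.measure_Iic, Measure.smul_apply,
    Measure.restrict_apply measurableSet_Iic, Iic_inter_Iic, arrival_isSubDist.measure_Iic,
    smul_eq_mul, ← ENNReal.ofReal_mul (excess_nonneg' hB)]
  congr 1
  rcases lt_or_ge a 0 with ha | ha
  · rw [(pathStrategy₁ hB h₁ hT).G_neg a ha, arrival_of_neg (lt_of_le_of_lt (min_le_left _ _) ha),
      mul_zero]
  · rw [arrival_of_nonneg (le_min ha (le_max_right _ _)), pathStrategy₁,
      pathG₁_apply ha]

lemma rate_eq (hB : B.Valid) : (1 - B.z₁) * (1 - B.w₁ - B.k₂)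
    * (B.z₁ * (B.k₂ / (1 - B.w₁ - B.k₂)) / (1 - B.z₁)) = B.z₁ * B.k₂ := by
  have h1 : 1 - B.z₁ ≠ 0 := by linarith [hB.z₁_lt_one]
  have h2 := hB.court_pos.ne'
  field_simp

lemma courtGain_path_nonpos {q : ℝ → ℝ} (hq : Measurable q) (hq0 : ∀ t, 0 ≤ q t)
    (hq1 : ∀ t, q t ≤ 1) : courtGain (pathStrategy₁ hB h₁ hT) hB q t ≤ 0 := by
  refine courtGain_nonpos hB hq hq0 hq1 fun A _ hA => ?_
  have := (arrival_isSubDist (γ := B.γ₁) (hγ := hB.γ₁_nonneg)).isFiniteMeasure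
  rw [measure_G_path, measureReal_ennreal_smul_apply, ENNReal.toReal_ofReal (excess_nonneg' hB),
    ← mul_assoc, rate_eq hB, measureReal_restrict_apply hA]
  exact mul_le_mul_of_nonneg_left (measureReal_mono inter_subset_left)
    (mul_nonneg hB.z₁_pos.le hB.k₂_pos.le)

lemma courtGain_path_eq_zero :
    courtGain (pathStrategy₁ hB h₁ hT) hB (B.yieldPath T) t = 0 := by
  rw [courtGain, measure_G_path, Measure.restrict_smul, integral_smul_measure,
    ENNReal.toReal_ofReal (excess_nonneg' hB), smul_eq_mul, ← mul_assoc, rate_eq hB,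
    Measure.restrict_restrict measurableSet_Ico, sub_eq_zero]
  congr 1
  refine (setIntegral_eq_of_subset_of_forall_sdiff_eq_zero measurableSet_Ico inter_subset_left ?_).symm
  rintro s ⟨hs, hs'⟩
  have h1 : max (T - B.tauStar) 0 < s := by
    by_contra h; exact hs' ⟨hs, not_lt.1 h⟩
  rw [yieldPath, if_neg (not_lt.2 ((le_max_left _ _).trans h1.le)), sub_self, zero_mul]

/-- The strategies along the coevolution curve form an equilibrium, if at most one of the players
concedes with positive probability at time zero. -/
lemma isEquilibrium_path
    (h : B.z₂ * Real.exp (B.lam₂ * T) = 1 ∨ B.z₁ * B.rho T = 1) :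
    B.IsEquilibrium (pathStrategy₁ hB h₁ hT) (pathStrategy₂ hB h₂ hT) := by
  set S₁ := pathStrategy₁ hB h₁ hT with hS₁
  set S₂ := pathStrategy₂ hB h₂ hT with hS₂
  have hD := hB.D_pos
  have hz₁ : 0 < 1 - B.z₁ := by linarith [hB.z₁_lt_one]
  have hz₂ : 0 < 1 - B.z₂ := by linarith [hB.z₂_lt_one]
  set u₁ := 1 - B.a₂ + B.D * conceded₂ S₂ B 0 with hu₁
  set u₂ := 1 - B.a₁ + B.D * conceded₁ S₁ B 0 with hu₂
  have hu₁0 : 0 ≤ u₁ := add_nonneg (by linarith [hB.a₂_lt_one])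
    (mul_nonneg hD.le (mul_nonneg hz₂.le (S₂.isSubDist.nonneg 0)))
  have hu₂0 : 0 ≤ u₂ := add_nonneg (by linarith [hB.a₁_lt_one])
    (mul_nonneg hD.le (mul_nonneg hz₁.le (S₁.isSubDist_F.nonneg 0)))
  have leU₁ : ∀ t, 0 ≤ t → B.concedeUtility₁ S₂ t ≤ u₁ := fun t ht => by
    rw [concedeUtility₁_eq hB ht, hu₁, add_le_add_iff_left]
    refine mul_le_mul_of_nonneg_left ?_ hD.le
    have h1 := mul_nonneg (Real.exp_pos (-B.r₁ * t)).le
      (mul_nonneg hz₂.le (sub_nonneg.2 (StieltjesFunction.leftLim_le S₂.F t)))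
    linarith [gain₁_path_le (hB := hB) (h₂ := h₂) (hT := hT) ht]
  have hq : S₂.q = B.yieldPath T := rfl
  have leV₁ : ∀ t, 0 ≤ t → B.challengeUtility₁ S₂ t ≤ u₁ := fun t ht => by
    rw [challengeUtility₁_eq hB ht, hq, hu₁, add_le_add_iff_left]
    refine mul_le_mul_of_nonneg_left ?_ hD.le
    have h1 := mul_nonpos_of_nonneg_of_nonpos (Real.exp_pos (-B.r₁ * t)).le
      (challenge_benefit (hB := hB) (h₂ := h₂) (hT := hT) ht).1
    linarith [gain₁_path_le (hB := hB) (h₂ := h₂) (hT := hT) ht]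
  have leU₂ : ∀ q : ℝ → ℝ, Measurable q → (∀ t, 0 ≤ q t) → (∀ t, q t ≤ 1) → ∀ t, 0 ≤ t →
      B.concedeUtility₂ S₁ q t ≤ u₂ := fun q hq hq0 hq1 t ht => by
    rw [concedeUtility₂_eq hB hq hq0 hq1 ht, hu₂, add_le_add_iff_left]
    refine mul_le_mul_of_nonneg_left ?_ hD.le
    have h1 := mul_nonneg (Real.exp_pos (-B.r₂ * t)).le
      (mul_nonneg hz₁.le (sub_nonneg.2 (StieltjesFunction.leftLim_le S₁.F t)))
    linarith [gain₂_path_le (hB := hB) (h₁ := h₁) (hT := hT) ht,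
      courtGain_path_nonpos (hB := hB) (h₁ := h₁) (hT := hT) (t := t) hq hq0 hq1]
  have hF₁ : ∀ t, 0 ≤ t → S₁.F t = B.concessionPath T (min t T) / (1 - B.z₁) := fun t ht =>
    pathF₁_apply (hB := hB) (h₁ := h₁) (hT := hT) ht
  have hF₂ : ∀ t, 0 ≤ t → S₂.F t = (1 - B.z₂ * Real.exp (B.lam₂ * (T - min t T))) / (1 - B.z₂) :=
    fun t ht => pathF₂_apply (hB := hB) (h₂ := h₂) (hT := hT) ht
  have hG₁ : ∀ t, 0 ≤ t → S₁.G t = B.z₁ * (B.k₂ / (1 - B.w₁ - B.k₂)) / (1 - B.z₁)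
      * (1 - Real.exp (-B.γ₁ * min t (max (T - B.tauStar) 0))) := fun t ht =>
    pathG₁_apply (hB := hB) ht
  have cF₁ : ∀ s, T ≤ s → S₁.F s = S₁.F T := fun s hs => by
    rw [hF₁ s (hT.trans hs), hF₁ T hT, min_self, min_eq_right hs]
  have cF₂ : ∀ s, T ≤ s → S₂.F s = S₂.F T := fun s hs => by
    rw [hF₂ s (hT.trans hs), hF₂ T hT, min_self, min_eq_right hs]
  have cG₁ : ∀ s, max (T - B.tauStar) 0 ≤ s → S₁.G s = S₁.G (max (T - B.tauStar) 0) :=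
    fun s hs => by
      rw [hG₁ s ((le_max_right _ _).trans hs), hG₁ _ (le_max_right _ _), min_self, min_eq_right hs]
  -- The jumps of the concessions vanish except at time zero, where only one of them is positive.
  have jump₁ : ∀ t, 0 < t → Function.leftLim S₁.F t = S₁.F t := fun t ht =>
    leftLim_pathF₁ (hB := hB) (h₁ := h₁) (hT := hT) ht
  have jump₂ : ∀ t, 0 < t → Function.leftLim S₂.F t = S₂.F t := fun t ht =>
    leftLim_pathF₂ (hB := hB) (h₂ := h₂) (hT := hT) ht
  have atom : S₂.F 0 = 0 ∨ S₁.F 0 = 0 := by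
    refine h.imp (fun h => ?_) (fun h => ?_)
    · rw [hF₂ 0 le_rfl, min_eq_left hT, sub_zero, h, sub_self, zero_div]
    · rw [hF₁ 0 le_rfl, min_eq_left hT, concessionPath_zero, h, sub_self, zero_div]
  have aeU₁ : ∀ᵐ t ∂S₁.F.measure, B.concedeUtility₁ S₂ t = u₁ := by
    have hne : ∀ᵐ t ∂S₁.F.measure, Function.leftLim S₂.F t = S₂.F t := by
      rcases atom with h0 | h0
      · filter_upwards [S₁.isSubDist_F.ae_nonneg] with t ht
        rcases ht.eq_or_lt with rfl | ht
        · rw [S₂.isSubDist.leftLim_zero, h0]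
        · exact jump₂ t ht
      · filter_upwards [S₁.isSubDist_F.ae_nonneg, S₁.isSubDist_F.ae_ne h0] with t ht ht'
        exact jump₂ t (lt_of_le_of_ne ht ht'.symm)
    filter_upwards [S₁.isSubDist_F.ae_nonneg, StieltjesFunction.ae_le cF₁, hne] with t ht htT hj
    rw [concedeUtility₁_eq hB ht, gain₁_path ⟨ht, htT⟩, hj]
    simp [hu₁, hS₂]
  have aeV₁ : ∀ᵐ t ∂S₁.G.measure, B.challengeUtility₁ S₂ t = u₁ := by
    have h0 : S₁.G 0 = 0 := by
      rw [hG₁ 0 le_rfl, min_eq_left (le_max_right _ _)]; simp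
    filter_upwards [S₁.isSubDist_G.ae_nonneg, S₁.isSubDist_G.ae_ne h0,
      StieltjesFunction.ae_le cG₁] with t ht ht0 htT
    have htT' : t ≤ T - B.tauStar := (le_max_iff.1 htT).resolve_right
      (not_le.2 (lt_of_le_of_ne ht (Ne.symm ht0)))
    rw [challengeUtility₁_eq hB ht, gain₁_path ⟨ht, by linarith [hB.tauStar_pos]⟩, hq,
      (challenge_benefit (hB := hB) (h₂ := h₂) (hT := hT) ht).2 htT', mul_zero, add_zero]
  have aeU₂ : ∀ᵐ t ∂S₂.F.measure, B.concedeUtility₂ S₁ S₂.q t = u₂ := by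
    have hne : ∀ᵐ t ∂S₂.F.measure, Function.leftLim S₁.F t = S₁.F t := by
      rcases atom.symm with h0 | h0
      · filter_upwards [S₂.isSubDist.ae_nonneg] with t ht
        rcases ht.eq_or_lt with rfl | ht
        · rw [S₁.isSubDist_F.leftLim_zero, h0]
        · exact jump₁ t ht
      · filter_upwards [S₂.isSubDist.ae_nonneg, S₂.isSubDist.ae_ne h0] with t ht ht'
        exact jump₁ t (lt_of_le_of_ne ht ht'.symm)
    filter_upwards [S₂.isSubDist.ae_nonneg, StieltjesFunction.ae_le cF₂, hne] with t ht htT hj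
    rw [concedeUtility₂_eq hB S₂.q_meas S₂.q_nonneg S₂.q_le_one ht, gain₂_path ⟨ht, htT⟩, hj, hq,
      courtGain_path_eq_zero]
    simp [hu₂, hS₁]
  -- Both unjustified players act with probability one.
  have mass₁ : S₁.F.measure.real univ + S₁.G.measure.real univ = 1 := by
    have hmT : max (T - B.tauStar) 0 ≤ T := max_le (by linarith [hB.tauStar_pos]) hT
    rw [S₁.isSubDist_F.eq_measureReal_univ cF₁, S₁.isSubDist_G.eq_measureReal_univ cG₁,
      ← cG₁ T hmT]
    have h1 := conceded₁_path (hB := hB) (h₁ := h₁) (hT := hT) hT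
    have h2 := challenged₁_path (hB := hB) (h₁ := h₁) (hT := hT) hT
    rw [challenged₁, arrival_of_nonneg hT] at h2
    rw [conceded₁, min_self, concessionPath, survivalPath, sub_self, rho_zero hB, ← h2] at h1
    have h3 : (1 - B.z₁) * (S₁.F T + S₁.G T) = (1 - B.z₁) * 1 := by linarith
    exact mul_left_cancel₀ hz₁.ne' h3
  have mass₂ : S₂.F.measure.real univ = 1 := by
    rw [S₂.isSubDist.eq_measureReal_univ cF₂, hF₂ T hT, min_self, sub_self, mul_zero,
      Real.exp_zero, mul_one, div_self hz₂.ne']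
  have val₁ : B.utility₁ S₁ S₂ = u₁ := by
    rw [utility₁, integral_congr_ae aeU₁, integral_congr_ae aeV₁, integral_const, integral_const,
      smul_eq_mul, smul_eq_mul, ← add_mul, mass₁, one_mul]
  have val₂ : B.utility₂ S₁ S₂ = u₂ := by
    rw [utility₂, integral_congr_ae aeU₂, integral_const, smul_eq_mul, mass₂, one_mul]
  constructor
  · intro S
    have i1 := S.isSubDist_F.isFiniteMeasure
    have i2 := S.isSubDist_G.isFiniteMeasure
    rw [val₁, utility₁]
    have h1 := integral_le_of_ae_le hu₁0 (S.isSubDist_F.ae_nonneg.mono leU₁)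
    have h2 := integral_le_of_ae_le hu₁0 (S.isSubDist_G.ae_nonneg.mono leV₁)
    have h3 := mul_le_mul_of_nonneg_left S.mass_le hu₁0
    linarith
  · intro S
    have i1 := S.isSubDist.isFiniteMeasure
    rw [val₂, utility₂]
    have h1 := integral_le_of_ae_le hu₂0
      (S.isSubDist.ae_nonneg.mono (leU₂ S.q S.q_meas S.q_nonneg S.q_le_one))
    have h2 := mul_le_mul_of_nonneg_left (S.isSubDist.measureReal_univ_le S.F_le_one) hu₂0
    linarith

end Path

theorem isEquilibriumPayoff_iff (hB : B.Valid) (p : ℝ × ℝ) :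
    B.IsEquilibriumPayoff p ↔ p = (B.payoff₁, B.payoff₂) := by
  constructor
  · rintro ⟨S₁, S₂, hE, rfl⟩
    rw [(hE.utility_eq_payoff hB).1, (hE.utility_eq_payoff hB).2]
  · rintro rfl
    obtain ⟨T, hT, h₂, h₁, h⟩ := exists_time hB
    have hE := isEquilibrium_path (hB := hB) (h₁ := h₁) (h₂ := h₂) (hT := hT.le) h
    refine ⟨_, _, hE, ?_⟩
    rw [(hE.utility_eq_payoff hB).1, (hE.utility_eq_payoff hB).2]

end BargainingGame

/-! ### Comparative statics of the coevolution curve -/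

namespace BargainingGame

variable {B B' : BargainingGame}

lemma rho_le_rho (hB : B.Valid) (hB' : B'.Valid) (hγ : B'.γ₁ = B.γ₁) (hl : B.lam₁ ≤ B'.lam₁)
    (hn : B'.nuStar₁ ≤ B.nuStar₁) {τ τ' : ℝ} (hτ : 0 ≤ τ) (hττ' : τ ≤ τ')
    (hδ : τ - B.tauStar ≤ τ' - B'.tauStar) : B.rho τ ≤ B'.rho τ' := by
  have hE : ∀ {s s' : ℝ}, 0 ≤ s → s ≤ s' →
      expInt (B.lam₁ - B.γ₁) s ≤ expInt (B'.lam₁ - B'.γ₁) s' := fun hs hss' =>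
    (expInt_mono_left (by linarith) hs).trans ((expInt_strictMono _).monotone hss')
  have h1 := mul_le_mul hl (hE hτ hττ') (expInt_nonneg _ hτ) hB'.lam₁_pos.le
  have h2 : B.γ₁ / B.nuStar₁ - B.γ₁ ≤ B'.γ₁ / B'.nuStar₁ - B'.γ₁ := by
    rw [hγ]
    exact sub_le_sub_right (div_le_div_of_nonneg_left hB.γ₁_nonneg hB'.nuStar₁_pos hn) _
  have h3 := mul_le_mul h2 (hE (le_max_right _ _) (max_le_max_right 0 hδ))
    (expInt_nonneg _ (le_max_right _ _)) hB'.excess_nonneg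
  unfold rho; linarith

lemma rho_lt_rho (hB : B.Valid) (hB' : B'.Valid) (hγ : B'.γ₁ = B.γ₁) (hl : B.lam₁ ≤ B'.lam₁)
    (hn : B'.nuStar₁ ≤ B.nuStar₁) {τ τ' : ℝ} (hτ : 0 < τ) (hττ' : τ ≤ τ')
    (hδ : τ - B.tauStar ≤ τ' - B'.tauStar) (hlt : B.lam₁ < B'.lam₁ ∨ τ < τ') :
    B.rho τ < B'.rho τ' := by
  have hE : ∀ {s s' : ℝ}, 0 ≤ s → s ≤ s' →
      expInt (B.lam₁ - B.γ₁) s ≤ expInt (B'.lam₁ - B'.γ₁) s' := fun hs hss' =>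
    (expInt_mono_left (by linarith) hs).trans ((expInt_strictMono _).monotone hss')
  have h1 : B.lam₁ * expInt (B.lam₁ - B.γ₁) τ < B'.lam₁ * expInt (B'.lam₁ - B'.γ₁) τ' := by
    rcases hlt with h | h
    · exact mul_lt_mul h (hE hτ.le hττ') (expInt_pos _ hτ) hB'.lam₁_pos.le
    · exact mul_lt_mul' hl ((expInt_mono_left (by linarith) hτ.le).trans_lt (expInt_strictMono _ h))
        (expInt_nonneg _ hτ.le) hB'.lam₁_pos
  have h2 : B.γ₁ / B.nuStar₁ - B.γ₁ ≤ B'.γ₁ / B'.nuStar₁ - B'.γ₁ := by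
    rw [hγ]
    exact sub_le_sub_right (div_le_div_of_nonneg_left hB.γ₁_nonneg hB'.nuStar₁_pos hn) _
  have h3 := mul_le_mul h2 (hE (le_max_right _ _) (max_le_max_right 0 hδ))
    (expInt_nonneg _ (le_max_right _ _)) hB'.excess_nonneg
  unfold rho; linarith

/-- The court parameters matter strictly while challenges occur with positive rate. -/
lemma rho_lt_rho_of_court (hB : B.Valid) (hB' : B'.Valid) (hγ : B'.γ₁ = B.γ₁)
    (hl : B'.lam₁ = B.lam₁) (hn : B'.nuStar₁ ≤ B.nuStar₁) (hs : B'.tauStar ≤ B.tauStar)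
    (hlt : B'.nuStar₁ < B.nuStar₁ ∨ B'.tauStar < B.tauStar) (hpos : 0 < B.γ₁) {τ : ℝ}
    (hτ : B'.tauStar < τ) : B.rho τ < B'.rho τ := by
  have h1 := expInt_nonneg (B.lam₁ - B.γ₁) (le_max_right (τ - B.tauStar) 0)
  have h2 := expInt_pos (B.lam₁ - B.γ₁) (sub_pos.2 hτ)
  have h3 : expInt (B.lam₁ - B.γ₁) (max (τ - B.tauStar) 0)
      ≤ expInt (B.lam₁ - B.γ₁) (τ - B'.tauStar) :=
    (expInt_strictMono _).monotone (max_le (by linarith) (by linarith))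
  have h4 : B.γ₁ / B.nuStar₁ ≤ B.γ₁ / B'.nuStar₁ :=
    div_le_div_of_nonneg_left hB.γ₁_nonneg hB'.nuStar₁_pos hn
  have h5 : 0 < B.γ₁ / B'.nuStar₁ - B.γ₁ := by
    rw [sub_pos, lt_div_iff₀ hB'.nuStar₁_pos]
    exact mul_lt_of_lt_one_right hpos hB'.nuStar₁_lt_one
  have key : (B.γ₁ / B.nuStar₁ - B.γ₁) * expInt (B.lam₁ - B.γ₁) (max (τ - B.tauStar) 0)
      < (B.γ₁ / B'.nuStar₁ - B.γ₁) * expInt (B.lam₁ - B.γ₁) (τ - B'.tauStar) := by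
    rcases hlt with h | h
    · have h6 : B.γ₁ / B.nuStar₁ < B.γ₁ / B'.nuStar₁ :=
        div_lt_div_of_pos_left hpos hB'.nuStar₁_pos h
      exact mul_lt_mul_of_lt_of_le_of_nonneg_of_pos (sub_lt_sub_right h6 _) h3 hB.excess_nonneg h2
    · have h6 : expInt (B.lam₁ - B.γ₁) (max (τ - B.tauStar) 0)
          < expInt (B.lam₁ - B.γ₁) (τ - B'.tauStar) :=
        expInt_strictMono _ (max_lt (by linarith) (by linarith))
      exact mul_lt_mul' (sub_le_sub_right h4 _) h6 h1 h5
  unfold rho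
  rw [hl, hγ, max_eq_left (sub_pos.2 hτ).le]
  linarith

lemma muTilde₁_le_of_rho_le (hB : B.Valid) (hB' : B'.Valid) {x : ℝ} (hx : x ∈ Ioo (0 : ℝ) 1)
    (h : B.rho (-Real.log x / B.lam₂) ≤ B'.rho (-Real.log x / B'.lam₂)) :
    B'.muTilde₁ x ≤ B.muTilde₁ x := by
  rw [muTilde₁_eq hB hx.1, muTilde₁_eq hB' hx.1]
  exact one_div_le_one_div_of_le
    (one_pos.trans_le (one_le_rho hB (timeLeft_nonneg hB hx.1 hx.2.le))) h

lemma muTilde₁_lt_of_rho_lt (hB : B.Valid) (hB' : B'.Valid) {x : ℝ} (hx : x ∈ Ioo (0 : ℝ) 1)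
    (h : B.rho (-Real.log x / B.lam₂) < B'.rho (-Real.log x / B'.lam₂)) :
    B'.muTilde₁ x < B.muTilde₁ x := by
  rw [muTilde₁_eq hB hx.1, muTilde₁_eq hB' hx.1]
  exact one_div_lt_one_div_of_lt
    (one_pos.trans_le (one_le_rho hB (timeLeft_nonneg hB hx.1 hx.2.le))) h

lemma timeLeft_pos (hB : B.Valid) {x : ℝ} (hx : x ∈ Ioo (0 : ℝ) 1) : 0 < -Real.log x / B.lam₂ :=
  div_pos (neg_pos.2 (Real.log_neg hx.1 hx.2)) hB.lam₂_pos

lemma tauStar_lt_timeLeft_iff (hB : B.Valid) {x : ℝ} (hx : 0 < x) :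
    B.tauStar < -Real.log x / B.lam₂ ↔ x < B.muStar₂ := by
  rw [tauStar, div_lt_div_iff_of_pos_right hB.lam₂_pos, neg_lt_neg_iff,
    Real.log_lt_log_iff hx hB.muStar₂_pos]

/-- A more patient player 1 needs a lower reputation: player 2 concedes at a lower rate, so that
it takes longer until the reputations reach one. -/
lemma muTilde₁_lt_of_r₁_lt {r : ℝ} (hB : B.Valid) (hB' : ({B with r₁ := r} : BargainingGame).Valid)
    (hr : r < B.r₁) {x : ℝ} (hx : x ∈ Ioo (0 : ℝ) 1) :
    ({B with r₁ := r} : BargainingGame).muTilde₁ x < B.muTilde₁ x := by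
  have hl : ({B with r₁ := r} : BargainingGame).lam₂ < B.lam₂ :=
    div_lt_div_of_pos_right (mul_lt_mul_of_pos_right hr (by linarith [hB.a₂_lt_one])) hB.D_pos
  have hlog := neg_pos.2 (Real.log_neg hx.1 hx.2)
  have hlt := div_lt_div_of_pos_left hlog hB'.lam₂_pos hl
  by_cases hxs : x < B.muStar₂
  · refine muTilde₁_lt_of_rho_lt hB hB' hx
      (rho_lt_rho hB hB' rfl le_rfl le_rfl (timeLeft_pos hB hx) hlt.le ?_ (Or.inr hlt))
    have h1 : 0 ≤ -Real.log x - -Real.log B.muStar₂ := by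
      linarith [Real.log_lt_log hx.1 hxs]
    have h2 := div_le_div_of_nonneg_left h1 hB'.lam₂_pos hl.le
    rw [sub_div, sub_div] at h2
    exact h2
  · have h1 := not_lt.1 (mt (tauStar_lt_timeLeft_iff hB hx.1).1 hxs)
    have h2 := not_lt.1 (mt (tauStar_lt_timeLeft_iff hB' hx.1).1 hxs)
    refine muTilde₁_lt_of_rho_lt hB hB' hx ?_
    have h3 := mul_lt_mul_of_pos_left (expInt_strictMono (B.lam₁ - B.γ₁) hlt) hB.lam₁_pos
    rw [rho, rho, max_eq_right (sub_nonpos.2 h1), max_eq_right (sub_nonpos.2 h2), expInt_zero,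
      expInt_zero, mul_zero, mul_zero, add_zero, add_zero]
    exact (add_lt_add_iff_left 1).2 h3

/-- A more patient player 2 forces player 1 to have a higher reputation: player 1 concedes at a
lower rate. -/
lemma muTilde₁_lt_of_r₂_lt {r : ℝ} (hB : B.Valid) (hB' : ({B with r₂ := r} : BargainingGame).Valid)
    (hr : r < B.r₂) {x : ℝ} (hx : x ∈ Ioo (0 : ℝ) 1) :
    B.muTilde₁ x < ({B with r₂ := r} : BargainingGame).muTilde₁ x := by
  have hl : ({B with r₂ := r} : BargainingGame).lam₁ < B.lam₁ :=
    div_lt_div_of_pos_right (mul_lt_mul_of_pos_right hr (by linarith [hB.a₁_lt_one])) hB.D_pos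
  exact muTilde₁_lt_of_rho_lt hB' hB hx
    (rho_lt_rho hB' hB rfl hl.le le_rfl (timeLeft_pos hB' hx) le_rfl le_rfl (Or.inl hl))

/-- The common effect of the changes in `CourtAgainst₁`: the game is altered through the thresholds
`nuStar₁` and `muStar₂` of the coevolution curve only, and one of them moves. -/
structure CourtShift (B B' : BargainingGame) : Prop where
  a₁_eq : B'.a₁ = B.a₁
  a₂_eq : B'.a₂ = B.a₂
  z₁_eq : B'.z₁ = B.z₁
  z₂_eq : B'.z₂ = B.z₂
  γ₁_eq : B'.γ₁ = B.γ₁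
  lam₁_eq : B'.lam₁ = B.lam₁
  lam₂_eq : B'.lam₂ = B.lam₂
  nuStar₁_le : B.nuStar₁ ≤ B'.nuStar₁
  muStar₂_le : B'.muStar₂ ≤ B.muStar₂
  lt_or_lt : B.nuStar₁ < B'.nuStar₁ ∨ B'.muStar₂ < B.muStar₂

lemma CourtAgainst₁.courtShift (hB : B.Valid) (hB' : B'.Valid) (h : B.CourtAgainst₁ B') :
    CourtShift B B' := by
  have hw := hB.w₁_lt_one
  rcases h with ⟨c, hc, rfl⟩ | ⟨k, hk, rfl⟩ | ⟨w, hw', rfl⟩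
  · have : 1 - c < 1 - B.c₁ := by linarith
    exact ⟨rfl, rfl, rfl, rfl, rfl, rfl, rfl, le_rfl, this.le, Or.inr this⟩
  · have : 1 - B.k₂ / (1 - B.w₁) < 1 - k / (1 - B.w₁) :=
      sub_lt_sub_left (div_lt_div_of_pos_right hk (by linarith)) 1
    exact ⟨rfl, rfl, rfl, rfl, rfl, rfl, rfl, this.le, le_rfl, Or.inl this⟩
  · have : 1 - B.k₂ / (1 - B.w₁) < 1 - B.k₂ / (1 - w) :=
      sub_lt_sub_left (div_lt_div_of_pos_left hB.k₂_pos (by linarith) (by linarith)) 1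
    exact ⟨rfl, rfl, rfl, rfl, rfl, rfl, rfl, this.le, le_rfl, Or.inl this⟩

namespace CourtShift

lemma tauStar_le (hB : B.Valid) (hB' : B'.Valid) (h : CourtShift B B') :
    B.tauStar ≤ B'.tauStar := by
  rw [tauStar, tauStar, h.lam₂_eq]
  exact div_le_div_of_nonneg_right
    (neg_le_neg (Real.log_le_log hB'.muStar₂_pos h.muStar₂_le)) hB.lam₂_pos.le

lemma muTilde₁_le (hB : B.Valid) (hB' : B'.Valid) (h : CourtShift B B') {x : ℝ}
    (hx : x ∈ Ioo (0 : ℝ) 1) : B.muTilde₁ x ≤ B'.muTilde₁ x := by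
  refine muTilde₁_le_of_rho_le hB' hB hx (rho_le_rho hB' hB h.γ₁_eq.symm h.lam₁_eq.le h.nuStar₁_le
    (timeLeft_pos hB' hx).le (by rw [h.lam₂_eq]) ?_)
  rw [h.lam₂_eq]
  linarith [h.tauStar_le hB hB']

lemma muTilde₁_lt (hB : B.Valid) (hB' : B'.Valid) (h : CourtShift B B') (hγ : 0 < B.γ₁) {x : ℝ}
    (hx : x ∈ Ioo (0 : ℝ) 1) (hxs : x < B.muStar₂) : B.muTilde₁ x < B'.muTilde₁ x := by
  refine muTilde₁_lt_of_rho_lt hB' hB hx ?_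
  rw [h.lam₂_eq]
  refine rho_lt_rho_of_court hB' hB h.γ₁_eq.symm h.lam₁_eq.symm h.nuStar₁_le (h.tauStar_le hB hB')
    (h.lt_or_lt.imp_right fun hs => ?_) (h.γ₁_eq ▸ hγ) ((tauStar_lt_timeLeft_iff hB hx.1).2 hxs)
  rw [tauStar, tauStar, h.lam₂_eq]
  exact div_lt_div_of_pos_right (neg_lt_neg (Real.log_lt_log hB'.muStar₂_pos hs)) hB.lam₂_pos

lemma muTilde₁_eq_of_le (hB : B.Valid) (hB' : B'.Valid) (h : CourtShift B B') {x : ℝ}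
    (hx : x ∈ Ioo (0 : ℝ) 1) (hxs : B.γ₁ = 0 ∨ B.muStar₂ ≤ x) :
    B'.muTilde₁ x = B.muTilde₁ x := by
  rw [muTilde₁_eq hB hx.1, muTilde₁_eq hB' hx.1, rho, rho, h.lam₁_eq, h.lam₂_eq, h.γ₁_eq]
  rcases hxs with h0 | h0
  · simp [h0]
  · have h1 := not_lt.1 (mt (tauStar_lt_timeLeft_iff hB hx.1).1 (not_lt.2 h0))
    rw [max_eq_right (by linarith [h.tauStar_le hB hB']), max_eq_right (by linarith), expInt_zero,
      mul_zero, mul_zero]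

end CourtShift

/-! ### Comparative statics of the payoffs -/

lemma surplus_le_iff {D z y z' y' : ℝ} (hD : 0 < D) (hz : 0 < z) (hz' : 0 < z') :
    D * (1 - z / max z y) ≤ D * (1 - z' / max z' y') ↔ max z y * z' ≤ max z' y' * z := by
  rw [mul_le_mul_iff_right₀ hD, sub_le_sub_iff_left,
    div_le_div_iff₀ (lt_max_of_lt_left hz') (lt_max_of_lt_left hz), mul_comm z', mul_comm z]

lemma payoff₁_le_iff (hB : B.Valid) (hB' : B'.Valid) (h₁ : B'.a₁ = B.a₁) (h₂ : B'.a₂ = B.a₂) :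
    B.payoff₁ ≤ B'.payoff₁ ↔
      max B.z₂ (B.muTilde₂ B.z₁) * B'.z₂ ≤ max B'.z₂ (B'.muTilde₂ B'.z₁) * B.z₂ := by
  have hD : B'.D = B.D := by rw [D, D, h₁, h₂]
  rw [payoff₁, payoff₁, h₂, hD, add_le_add_iff_left, surplus_le_iff hB.D_pos hB.z₂_pos hB'.z₂_pos]

lemma payoff₂_le_iff (hB : B.Valid) (hB' : B'.Valid) (h₁ : B'.a₁ = B.a₁) (h₂ : B'.a₂ = B.a₂) :
    B.payoff₂ ≤ B'.payoff₂ ↔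
      max B.z₁ (B.muTilde₁ B.z₂) * B'.z₁ ≤ max B'.z₁ (B'.muTilde₁ B'.z₂) * B.z₁ := by
  have hD : B'.D = B.D := by rw [D, D, h₁, h₂]
  rw [payoff₂, payoff₂, h₁, hD, add_le_add_iff_left, surplus_le_iff hB.D_pos hB.z₁_pos hB'.z₁_pos]

/-- Raising a player's reputation `z` and lowering the reputation `y` required of him lowers the
opponent's gain; strictly so if `z < y`. -/
lemma max_mul_le {z z' y y' : ℝ} (hz : 0 < z) (hzz' : z ≤ z') (hyy' : y' ≤ y) :
    max z' y' * z ≤ max z y * z' := by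
  have hz' := hz.trans_le hzz'
  rcases le_total y' z' with h | h
  · rw [max_eq_left h, mul_comm]; exact mul_le_mul_of_nonneg_right (le_max_left _ _) hz'.le
  · rw [max_eq_right h]
    exact mul_le_mul (hyy'.trans (le_max_right _ _)) hzz' hz.le (hz.le.trans (le_max_left _ _))

lemma max_mul_lt {z z' y y' : ℝ} (hz : 0 < z) (hzz' : z ≤ z') (hyy' : y' ≤ y)
    (hlt : z < z' ∨ y' < y) (hzy : z < y) : max z' y' * z < max z y * z' := by
  have hz' := hz.trans_le hzz'
  rw [max_eq_right hzy.le]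
  rcases le_total y' z' with h | h
  · rw [max_eq_left h, mul_comm]; exact mul_lt_mul_of_pos_right hzy hz'
  · rw [max_eq_right h]
    rcases hlt with hlt | hlt
    · exact mul_lt_mul' hyy' hlt hz.le (hz.trans hzy)
    · exact mul_lt_mul hlt hzz' hz (hz.trans hzy).le

lemma muTilde₂_le_muTilde₂ (hB : B.Valid) (hB' : B'.Valid) (hz : B.z₁ ≤ B'.z₁)
    (hm : ∀ x ∈ Ioo (0 : ℝ) 1, B'.muTilde₁ x ≤ B.muTilde₁ x) :
    B.muTilde₂ B.z₁ ≤ B'.muTilde₂ B'.z₁ := by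
  rcases (muTilde₂_nonneg B.z₁ : 0 ≤ B.muTilde₂ B.z₁).eq_or_lt with h | h
  · rw [← h]; exact muTilde₂_nonneg _
  · obtain ⟨h1, h2⟩ := muTilde₁_muTilde₂ hB hB.z₁_lt_one h
    rw [le_muTilde₂_iff hB' hB'.z₁_lt_one h h2.le]
    linarith [hm _ ⟨h, h2⟩]

lemma muTilde₂_lt_muTilde₂ (hB : B.Valid) (hB' : B'.Valid) (h : 0 < B.muTilde₂ B.z₁)
    (hlt : B'.muTilde₁ (B.muTilde₂ B.z₁) < B'.z₁) :
    B.muTilde₂ B.z₁ < B'.muTilde₂ B'.z₁ :=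
  (lt_muTilde₂_iff hB' hB'.z₁_lt_one h (muTilde₁_muTilde₂ hB hB.z₁_lt_one h).2.le).2 hlt

theorem payoff_of_favors₁ (hB : B.Valid) (hB' : B'.Valid) (h : B.Favors₁ B') :
    B.payoff₁ ≤ B'.payoff₁ ∧ B'.payoff₂ ≤ B.payoff₂ ∧
      (B.muTilde₁ B.z₂ ≤ B.z₁ → B.payoff₁ < B'.payoff₁) ∧
      (B.z₁ < B.muTilde₁ B.z₂ → B'.payoff₂ < B.payoff₂) ∧
      (B'.z₁ ≤ B'.muTilde₁ B'.z₂ → B'.payoff₁ = B.payoff₁) ∧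
      (B.muTilde₁ B.z₂ ≤ B.z₁ → B'.payoff₂ = B.payoff₂) := by
  obtain ⟨h₁, h₂, hz₂, hz₁, hm, hlt⟩ : B'.a₁ = B.a₁ ∧ B'.a₂ = B.a₂ ∧ B'.z₂ = B.z₂ ∧ B.z₁ ≤ B'.z₁ ∧
      (∀ x ∈ Ioo (0 : ℝ) 1, B'.muTilde₁ x ≤ B.muTilde₁ x) ∧
      (B.z₁ < B'.z₁ ∨ ∀ x ∈ Ioo (0 : ℝ) 1, B'.muTilde₁ x < B.muTilde₁ x) := by
    rcases h with ⟨z, hz, rfl⟩ | ⟨r, hr, rfl⟩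
    · exact ⟨rfl, rfl, rfl, hz.le, fun x _ => le_rfl, Or.inl hz⟩
    · have hm := fun x hx => muTilde₁_lt_of_r₁_lt hB hB' hr (x := x) hx
      exact ⟨rfl, rfl, rfl, le_rfl, fun x hx => (hm x hx).le, Or.inr hm⟩
  have hy := muTilde₂_le_muTilde₂ hB hB' hz₁ hm
  have hz₂I : B.z₂ ∈ Ioo (0 : ℝ) 1 := ⟨hB.z₂_pos, hB.z₂_lt_one⟩
  have le₁ : B.payoff₁ ≤ B'.payoff₁ := by
    rw [payoff₁_le_iff hB hB' h₁ h₂, hz₂]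
    exact mul_le_mul_of_nonneg_right (max_le_max_left _ hy) hB.z₂_pos.le
  have le₂ : B'.payoff₂ ≤ B.payoff₂ := by
    rw [payoff₂_le_iff hB' hB h₁.symm h₂.symm, hz₂]
    exact max_mul_le hB.z₁_pos hz₁ (hm _ hz₂I)
  refine ⟨le₁, le₂, fun h => ?_, fun h => ?_, fun h => le_antisymm ?_ le₁,
    fun h => le_antisymm le₂ ?_⟩
  · have hle := (le_muTilde₂_iff hB hB.z₁_lt_one hB.z₂_pos hB.z₂_lt_one.le).2 h
    have hy0 := hB.z₂_pos.trans_le hle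
    obtain ⟨e, l⟩ := muTilde₁_muTilde₂ hB hB.z₁_lt_one hy0
    have hy' : B.muTilde₂ B.z₁ < B'.muTilde₂ B'.z₁ := by
      refine muTilde₂_lt_muTilde₂ hB hB' hy0 ?_
      rcases hlt with hlt | hlt
      · linarith [hm _ ⟨hy0, l⟩]
      · linarith [hlt _ ⟨hy0, l⟩]
    rw [← not_le, payoff₁_le_iff hB' hB h₁.symm h₂.symm, not_le, hz₂, max_eq_right hle,
      max_eq_right (hle.trans hy)]
    exact mul_lt_mul_of_pos_right hy' hB.z₂_pos
  · rw [← not_le, payoff₂_le_iff hB hB' h₁ h₂, not_le, hz₂]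
    exact max_mul_lt hB.z₁_pos hz₁ (hm _ hz₂I) (hlt.imp_right fun h => h _ hz₂I) h
  · have hle : B'.muTilde₂ B'.z₁ ≤ B.z₂ := by
      rw [← hz₂, ← not_lt, lt_muTilde₂_iff hB' hB'.z₁_lt_one hB'.z₂_pos hB'.z₂_lt_one.le, not_lt]
      exact h
    rw [payoff₁_le_iff hB' hB h₁.symm h₂.symm, hz₂, max_eq_left hle, max_eq_left (hy.trans hle)]
  · have h' := hm _ hz₂I
    rw [payoff₂_le_iff hB hB' h₁ h₂, hz₂, max_eq_left h, max_eq_left (by linarith), mul_comm]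

theorem payoff_of_favors₂ (hB : B.Valid) (hB' : B'.Valid) (h : B.Favors₂ B') :
    B.payoff₂ ≤ B'.payoff₂ ∧ B'.payoff₁ ≤ B.payoff₁ ∧
      (B.muTilde₂ B.z₁ ≤ B.z₂ → B.payoff₂ < B'.payoff₂) ∧
      (B.z₂ < B.muTilde₂ B.z₁ → B'.payoff₁ < B.payoff₁) ∧
      (B'.z₂ ≤ B'.muTilde₂ B'.z₁ → B'.payoff₂ = B.payoff₂) ∧
      (B.muTilde₂ B.z₁ ≤ B.z₂ → B'.payoff₁ = B.payoff₁) := by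
  obtain ⟨h₁, h₂, hz₁, hz₂, hm, hlt⟩ : B'.a₁ = B.a₁ ∧ B'.a₂ = B.a₂ ∧ B'.z₁ = B.z₁ ∧ B.z₂ ≤ B'.z₂ ∧
      (∀ x ∈ Ioo (0 : ℝ) 1, B.muTilde₁ x ≤ B'.muTilde₁ x) ∧
      (B.z₂ < B'.z₂ ∨ ∀ x ∈ Ioo (0 : ℝ) 1, B.muTilde₁ x < B'.muTilde₁ x) := by
    rcases h with ⟨z, hz, rfl⟩ | ⟨r, hr, rfl⟩
    · exact ⟨rfl, rfl, rfl, hz.le, fun x _ => le_rfl, Or.inl hz⟩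
    · have hm := fun x hx => muTilde₁_lt_of_r₂_lt hB hB' hr (x := x) hx
      exact ⟨rfl, rfl, rfl, le_rfl, fun x hx => (hm x hx).le, Or.inr hm⟩
  have hy := muTilde₂_le_muTilde₂ hB' hB hz₁.le hm
  have hz₂I : B.z₂ ∈ Ioo (0 : ℝ) 1 := ⟨hB.z₂_pos, hB.z₂_lt_one⟩
  have hz₂I' : B'.z₂ ∈ Ioo (0 : ℝ) 1 := ⟨hB'.z₂_pos, hB'.z₂_lt_one⟩
  have hm₂ : B.muTilde₁ B.z₂ ≤ B'.muTilde₁ B'.z₂ :=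
    (hm _ hz₂I).trans ((muTilde₁_strictMonoOn hB').monotoneOn
      ⟨hB.z₂_pos, hB.z₂_lt_one.le⟩ ⟨hB'.z₂_pos, hB'.z₂_lt_one.le⟩ hz₂)
  have le₂ : B.payoff₂ ≤ B'.payoff₂ := by
    rw [payoff₂_le_iff hB hB' h₁ h₂, hz₁]
    exact mul_le_mul_of_nonneg_right (max_le_max_left _ hm₂) hB.z₁_pos.le
  have le₁ : B'.payoff₁ ≤ B.payoff₁ := by
    rw [payoff₁_le_iff hB' hB h₁.symm h₂.symm]
    exact max_mul_le hB.z₂_pos hz₂ hy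
  refine ⟨le₂, le₁, fun h => ?_, fun h => ?_, fun h => le_antisymm ?_ le₂,
    fun h => le_antisymm le₁ ?_⟩
  · have hle : B.z₁ ≤ B.muTilde₁ B.z₂ := by
      rw [← not_lt, ← lt_muTilde₂_iff hB hB.z₁_lt_one hB.z₂_pos hB.z₂_lt_one.le, not_lt]
      exact h
    have hlt₂ : B.muTilde₁ B.z₂ < B'.muTilde₁ B'.z₂ := by
      rcases hlt with hlt | hlt
      · exact (muTilde₁_strictMonoOn hB ⟨hB.z₂_pos, hB.z₂_lt_one.le⟩
          ⟨hB'.z₂_pos, hB'.z₂_lt_one.le⟩ hlt).trans_le (hm _ hz₂I')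
      · exact (hlt _ hz₂I).trans_le ((muTilde₁_strictMonoOn hB').monotoneOn
          ⟨hB.z₂_pos, hB.z₂_lt_one.le⟩ ⟨hB'.z₂_pos, hB'.z₂_lt_one.le⟩ hz₂)
    rw [← not_le, payoff₂_le_iff hB' hB h₁.symm h₂.symm, not_le, hz₁, max_eq_right hle,
      max_eq_right (hle.trans hm₂)]
    exact mul_lt_mul_of_pos_right hlt₂ hB.z₁_pos
  · rw [← not_le, payoff₁_le_iff hB hB' h₁ h₂, not_le]
    refine max_mul_lt hB.z₂_pos hz₂ hy (hlt.imp_right fun hlt => ?_) h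
    rcases (muTilde₂_nonneg _ : 0 ≤ B'.muTilde₂ B'.z₁).eq_or_lt with h0 | h0
    · rw [← h0]; exact hB.z₂_pos.trans h
    · obtain ⟨e, l⟩ := muTilde₁_muTilde₂ hB' hB'.z₁_lt_one h0
      refine muTilde₂_lt_muTilde₂ hB' hB h0 ?_
      linarith [hlt _ ⟨h0, l⟩]
  · have hle := (le_muTilde₂_iff hB' hB'.z₁_lt_one hB'.z₂_pos hB'.z₂_lt_one.le).1 h
    rw [hz₁] at hle
    rw [payoff₂_le_iff hB' hB h₁.symm h₂.symm, hz₁, max_eq_left hle, max_eq_left (hm₂.trans hle)]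
  · rw [payoff₁_le_iff hB hB' h₁ h₂, max_eq_left h, max_eq_left (hy.trans (h.trans hz₂)), mul_comm]

theorem payoff_of_courtAgainst₁ (hB : B.Valid) (hB' : B'.Valid) (h : B.CourtAgainst₁ B') :
    B'.payoff₁ ≤ B.payoff₁ ∧ B.payoff₂ ≤ B'.payoff₂ ∧
      (0 < B.γ₁ → B.muTilde₁ B.z₂ < B.z₁ → B.z₁ < B.muN₁ → B'.payoff₁ < B.payoff₁) ∧
      (0 < B.γ₁ → B.muTilde₂ B.z₁ ≤ B.z₂ → B.z₂ < B.muStar₂ → B.payoff₂ < B'.payoff₂) ∧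
      (B.γ₁ = 0 ∨ B.z₁ ≤ B.muTilde₁ B.z₂ ∨ B.muN₁ ≤ B.z₁ → B'.payoff₁ = B.payoff₁) ∧
      (B.γ₁ = 0 ∨ B'.z₂ ≤ B'.muTilde₂ B'.z₁ ∨ B.muStar₂ ≤ B.z₂ → B'.payoff₂ = B.payoff₂) := by
  replace h := CourtAgainst₁.courtShift hB hB' h
  have hm := fun x hx => h.muTilde₁_le hB hB' (x := x) hx
  have hz₁ := h.z₁_eq
  have hz₂ := h.z₂_eq
  have hy := muTilde₂_le_muTilde₂ hB' hB hz₁.le hm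
  have hz₂I : B.z₂ ∈ Ioo (0 : ℝ) 1 := ⟨hB.z₂_pos, hB.z₂_lt_one⟩
  have hμI : B.muStar₂ ∈ Ioc (0 : ℝ) 1 := ⟨hB.muStar₂_pos, hB.muStar₂_lt_one.le⟩
  have eq₁ : max B.z₂ (B.muTilde₂ B.z₁) ≤ max B.z₂ (B'.muTilde₂ B'.z₁) →
      B.payoff₁ ≤ B'.payoff₁ := fun hle => by
    rw [payoff₁_le_iff hB hB' h.a₁_eq h.a₂_eq, hz₂]
    exact mul_le_mul_of_nonneg_right hle hB.z₂_pos.le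
  have le₁ : B'.payoff₁ ≤ B.payoff₁ := by
    rw [payoff₁_le_iff hB' hB h.a₁_eq.symm h.a₂_eq.symm, hz₂]
    exact mul_le_mul_of_nonneg_right (max_le_max_left _ hy) hB.z₂_pos.le
  have le₂ : B.payoff₂ ≤ B'.payoff₂ := by
    rw [payoff₂_le_iff hB hB' h.a₁_eq h.a₂_eq, hz₁, hz₂]
    exact mul_le_mul_of_nonneg_right (max_le_max_left _ (hm _ hz₂I)) hB.z₁_pos.le
  refine ⟨le₁, le₂, fun hγ hz hN => ?_, fun hγ hz hN => ?_, fun hc => le_antisymm le₁ (eq₁ ?_),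
    fun hc => le_antisymm ?_ le₂⟩
  · have hlt := (lt_muTilde₂_iff hB hB.z₁_lt_one hB.z₂_pos hB.z₂_lt_one.le).2 hz
    have hyN : B.muTilde₂ B.z₁ < B.muStar₂ := by
      rw [← not_le, le_muTilde₂_iff hB hB.z₁_lt_one hμI.1 hμI.2, not_le]
      exact hN
    rw [← not_le, payoff₁_le_iff hB hB' h.a₁_eq h.a₂_eq, not_le, hz₂]
    refine max_mul_lt hB.z₂_pos le_rfl hy (Or.inr ?_) hlt
    rcases (muTilde₂_nonneg _ : 0 ≤ B'.muTilde₂ B'.z₁).eq_or_lt with h0 | h0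
    · rw [← h0]; exact hB.z₂_pos.trans hlt
    · obtain ⟨e, l⟩ := muTilde₁_muTilde₂ hB' hB'.z₁_lt_one h0
      refine muTilde₂_lt_muTilde₂ hB' hB h0 ?_
      linarith [h.muTilde₁_lt hB hB' hγ ⟨h0, l⟩ (hy.trans_lt hyN)]
  · have hle : B.z₁ ≤ B.muTilde₁ B.z₂ := by
      rw [← not_lt, ← lt_muTilde₂_iff hB hB.z₁_lt_one hB.z₂_pos hB.z₂_lt_one.le, not_lt]
      exact hz
    rw [← not_le, payoff₂_le_iff hB' hB h.a₁_eq.symm h.a₂_eq.symm, not_le, hz₁, hz₂,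
      max_eq_right hle, max_eq_right (hle.trans (hm _ hz₂I))]
    exact mul_lt_mul_of_pos_right (h.muTilde₁_lt hB hB' hγ hz₂I hN) hB.z₁_pos
  · rcases le_or_gt (B.muTilde₂ B.z₁) B.z₂ with hle | hlt
    · rw [max_eq_left hle]; exact le_max_left _ _
    refine max_le_max_left _ ?_
    have hy0 := hB.z₂_pos.trans hlt
    obtain ⟨e, l⟩ := muTilde₁_muTilde₂ hB hB.z₁_lt_one hy0
    have hlt' := (lt_muTilde₂_iff hB hB.z₁_lt_one hB.z₂_pos hB.z₂_lt_one.le).1 hlt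
    have hc' : B.γ₁ = 0 ∨ B.muStar₂ ≤ B.muTilde₂ B.z₁ := hc.imp_right fun hc => by
      rw [le_muTilde₂_iff hB hB.z₁_lt_one hμI.1 hμI.2]
      exact hc.resolve_left (not_le.2 hlt')
    rw [le_muTilde₂_iff hB' hB'.z₁_lt_one hy0 l.le, h.muTilde₁_eq_of_le hB hB' ⟨hy0, l⟩ hc', e, hz₁]
  · rw [payoff₂_le_iff hB' hB h.a₁_eq.symm h.a₂_eq.symm, hz₁, hz₂]
    rw [or_left_comm] at hc
    rcases hc with hc | hc
    · have hle := (le_muTilde₂_iff hB' hB'.z₁_lt_one hB'.z₂_pos hB'.z₂_lt_one.le).1 hc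
      rw [hz₁, hz₂] at hle
      rw [max_eq_left hle, max_eq_left ((hm _ hz₂I).trans hle)]
    · rw [h.muTilde₁_eq_of_le hB hB' hz₂I hc]

/-! ### Local constancy of the payoffs -/

lemma payoff₁_eq_of_le (hB : B.Valid) (h : B.z₁ ≤ B.muTilde₁ B.z₂) : B.payoff₁ = 1 - B.a₂ := by
  have hle : B.muTilde₂ B.z₁ ≤ B.z₂ := by
    rw [← not_lt, lt_muTilde₂_iff hB hB.z₁_lt_one hB.z₂_pos hB.z₂_lt_one.le, not_lt]
    exact h
  rw [payoff₁, max_eq_left hle, div_self hB.z₂_pos.ne']; ring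

lemma payoff₂_eq_of_le (hB : B.Valid) (h : B.muTilde₁ B.z₂ ≤ B.z₁) : B.payoff₂ = 1 - B.a₁ := by
  rw [payoff₂, max_eq_left h, div_self hB.z₁_pos.ne']; ring

section Continuity

variable {l : Filter ℝ} {g : ℝ → BargainingGame}

/-- The coevolution curve is jointly continuous in the reputation and the parameters. -/
lemma tendsto_muTilde₁ (hB : B.Valid) (hv : ∀ᶠ p in l, (g p).Valid)
    (hγ : Tendsto (fun p => (g p).γ₁) l (𝓝 B.γ₁))
    (h₁ : Tendsto (fun p => (g p).lam₁) l (𝓝 B.lam₁))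
    (h₂ : Tendsto (fun p => (g p).lam₂) l (𝓝 B.lam₂))
    (hν : Tendsto (fun p => (g p).nuStar₁) l (𝓝 B.nuStar₁))
    (hμ : Tendsto (fun p => (g p).muStar₂) l (𝓝 B.muStar₂))
    (hz : Tendsto (fun p => (g p).z₂) l (𝓝 B.z₂)) :
    Tendsto (fun p => (g p).muTilde₁ (g p).z₂) l (𝓝 (B.muTilde₁ B.z₂)) := by
  have hτ : Tendsto (fun p => -Real.log (g p).z₂ / (g p).lam₂) l (𝓝 (-Real.log B.z₂ / B.lam₂)) :=
    (hz.log hB.z₂_pos.ne').neg.div h₂ hB.lam₂_pos.ne'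
  have hτs : Tendsto (fun p => (g p).tauStar) l (𝓝 B.tauStar) :=
    (hμ.log hB.muStar₂_pos.ne').neg.div h₂ hB.lam₂_pos.ne'
  have hE : ∀ {f : ℝ → ℝ} {s : ℝ}, Tendsto f l (𝓝 s) →
      Tendsto (fun p => expInt ((g p).lam₁ - (g p).γ₁) (f p)) l
        (𝓝 (expInt (B.lam₁ - B.γ₁) s)) := fun hf =>
    (continuous_expInt.tendsto _).comp ((h₁.sub hγ).prodMk_nhds hf)
  have hρ : Tendsto (fun p => (g p).rho (-Real.log (g p).z₂ / (g p).lam₂)) l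
      (𝓝 (B.rho (-Real.log B.z₂ / B.lam₂))) :=
    ((h₁.mul (hE hτ)).const_add 1).add (((hγ.div hν hB.nuStar₁_pos.ne').sub hγ).mul
      (hE ((hτ.sub hτs).max tendsto_const_nhds)))
  rw [muTilde₁_eq hB hB.z₂_pos]
  have h0 : B.rho (-Real.log B.z₂ / B.lam₂) ≠ 0 :=
    (one_pos.trans_le (one_le_rho hB (timeLeft_nonneg hB hB.z₂_pos hB.z₂_lt_one.le))).ne'
  refine (tendsto_const_nhds.div hρ h0).congr' ?_
  filter_upwards [hv] with p hp
  exact (muTilde₁_eq hp hp.z₂_pos).symm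

lemma eventually_payoff₁_eq (hB : B.Valid) (hv : ∀ᶠ p in l, (g p).Valid)
    (ha : ∀ p, (g p).a₂ = B.a₂) (hz : Tendsto (fun p => (g p).z₁) l (𝓝 B.z₁))
    (hm : Tendsto (fun p => (g p).muTilde₁ (g p).z₂) l (𝓝 (B.muTilde₁ B.z₂)))
    (h : B.z₁ < B.muTilde₁ B.z₂) : ∀ᶠ p in l, (g p).payoff₁ = B.payoff₁ := by
  filter_upwards [hv, hz.eventually_lt hm h] with p hp hlt
  rw [payoff₁_eq_of_le hp hlt.le, payoff₁_eq_of_le hB h.le, ha]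

lemma eventually_payoff₂_eq (hB : B.Valid) (hv : ∀ᶠ p in l, (g p).Valid)
    (ha : ∀ p, (g p).a₁ = B.a₁) (hz : Tendsto (fun p => (g p).z₁) l (𝓝 B.z₁))
    (hm : Tendsto (fun p => (g p).muTilde₁ (g p).z₂) l (𝓝 (B.muTilde₁ B.z₂)))
    (h : B.muTilde₁ B.z₂ < B.z₁) : ∀ᶠ p in l, (g p).payoff₂ = B.payoff₂ := by
  filter_upwards [hv, hm.eventually_lt hz h] with p hp hlt
  rw [payoff₂_eq_of_le hp hlt.le, payoff₂_eq_of_le hB h.le, ha]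

end Continuity

theorem payoff₁_locally_constant (hB : B.Valid) (h : B.z₁ < B.muTilde₁ B.z₂) :
    (∀ᶠ z in 𝓝 B.z₁, payoff₁ { B with z₁ := z } = B.payoff₁) ∧
    (∀ᶠ r in 𝓝 B.r₁, payoff₁ { B with r₁ := r } = B.payoff₁) := by
  constructor
  · have hv : ∀ᶠ z in 𝓝 B.z₁, ({ B with z₁ := z } : BargainingGame).Valid := by
      filter_upwards [Ioo_mem_nhds hB.z₁_pos hB.z₁_lt_one] with z hz
      exact { hB with z₁_pos := hz.1, z₁_lt_one := hz.2 }
    exact eventually_payoff₁_eq hB hv (fun _ => rfl) tendsto_id tendsto_const_nhds h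
  · have hv : ∀ᶠ r in 𝓝 B.r₁, ({ B with r₁ := r } : BargainingGame).Valid := by
      filter_upwards [Ioi_mem_nhds hB.r₁_pos] with r hr
      exact { hB with r₁_pos := hr }
    exact eventually_payoff₁_eq hB hv (fun _ => rfl) tendsto_const_nhds
      (tendsto_muTilde₁ hB hv tendsto_const_nhds tendsto_const_nhds
        ((tendsto_id.mul_const _).div_const _) tendsto_const_nhds tendsto_const_nhds
        tendsto_const_nhds) h

theorem payoff₂_locally_constant (hB : B.Valid) (h : B.z₂ < B.muTilde₂ B.z₁) :
    (∀ᶠ z in 𝓝 B.z₂, payoff₂ { B with z₂ := z } = B.payoff₂) ∧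
    (∀ᶠ r in 𝓝 B.r₂, payoff₂ { B with r₂ := r } = B.payoff₂) ∧
    (∀ᶠ c in 𝓝 B.c₁, payoff₂ { B with c₁ := c } = B.payoff₂) ∧
    (∀ᶠ k in 𝓝 B.k₂, payoff₂ { B with k₂ := k } = B.payoff₂) ∧
    (∀ᶠ w in 𝓝 B.w₁, 0 ≤ w → payoff₂ { B with w₁ := w } = B.payoff₂) := by
  rw [lt_muTilde₂_iff hB hB.z₁_lt_one hB.z₂_pos hB.z₂_lt_one.le] at h
  refine ⟨?_, ?_, ?_, ?_, ?_⟩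
  · have hv : ∀ᶠ z in 𝓝 B.z₂, ({ B with z₂ := z } : BargainingGame).Valid := by
      filter_upwards [Ioo_mem_nhds hB.z₂_pos hB.z₂_lt_one] with z hz
      exact { hB with z₂_pos := hz.1, z₂_lt_one := hz.2 }
    exact eventually_payoff₂_eq hB hv (fun _ => rfl) tendsto_const_nhds
      (tendsto_muTilde₁ hB hv tendsto_const_nhds tendsto_const_nhds tendsto_const_nhds
        tendsto_const_nhds tendsto_const_nhds tendsto_id) h
  · have hv : ∀ᶠ r in 𝓝 B.r₂, ({ B with r₂ := r } : BargainingGame).Valid := by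
      filter_upwards [Ioi_mem_nhds hB.r₂_pos] with r hr
      exact { hB with r₂_pos := hr }
    exact eventually_payoff₂_eq hB hv (fun _ => rfl) tendsto_const_nhds
      (tendsto_muTilde₁ hB hv tendsto_const_nhds ((tendsto_id.mul_const _).div_const _)
        tendsto_const_nhds tendsto_const_nhds tendsto_const_nhds tendsto_const_nhds) h
  · have hv : ∀ᶠ c in 𝓝 B.c₁, ({ B with c₁ := c } : BargainingGame).Valid := by
      filter_upwards [Ioo_mem_nhds hB.w₁_lt_c₁ hB.c₁_lt_one] with c hc
      exact { hB with w₁_lt_c₁ := hc.1, c₁_lt_one := hc.2 }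
    exact eventually_payoff₂_eq hB hv (fun _ => rfl) tendsto_const_nhds
      (tendsto_muTilde₁ hB hv tendsto_const_nhds tendsto_const_nhds tendsto_const_nhds
        tendsto_const_nhds (tendsto_id.const_sub 1) tendsto_const_nhds) h
  · have hv : ∀ᶠ k in 𝓝 B.k₂, ({ B with k₂ := k } : BargainingGame).Valid := by
      filter_upwards [Ioo_mem_nhds hB.k₂_pos hB.k₂_lt] with k hk
      exact { hB with k₂_pos := hk.1, k₂_lt := hk.2 }
    exact eventually_payoff₂_eq hB hv (fun _ => rfl) tendsto_const_nhds
      (tendsto_muTilde₁ hB hv tendsto_const_nhds tendsto_const_nhds tendsto_const_nhds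
        ((tendsto_id.div_const _).const_sub 1) tendsto_const_nhds tendsto_const_nhds) h
  · have hv : ∀ᶠ w in 𝓝[Ici 0] B.w₁, ({ B with w₁ := w } : BargainingGame).Valid := by
      have hk : B.w₁ < 1 - B.k₂ := by linarith [hB.k₂_lt]
      filter_upwards [self_mem_nhdsWithin,
        nhdsWithin_le_nhds (Iio_mem_nhds (lt_min hB.w₁_lt_c₁ hk))] with w hw0 hw
      exact { hB with
        w₁_nonneg := hw0
        w₁_lt_c₁ := (lt_min_iff.1 hw).1
        k₂_lt := lt_sub_comm.1 (lt_min_iff.1 hw).2 }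
    have hid : Tendsto (fun w : ℝ => w) (𝓝[Ici 0] B.w₁) (𝓝 B.w₁) :=
      tendsto_id.mono_left nhdsWithin_le_nhds
    have hw : 1 - B.w₁ ≠ 0 := by linarith [hB.w₁_lt_one]
    exact eventually_nhdsWithin_iff.1 (eventually_payoff₂_eq hB hv (fun _ => rfl)
      tendsto_const_nhds (tendsto_muTilde₁ hB hv tendsto_const_nhds tendsto_const_nhds
        tendsto_const_nhds ((tendsto_const_nhds.div (hid.const_sub 1) hw).const_sub 1)
        tendsto_const_nhds tendsto_const_nhds) h)

end BargainingGame

end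

theorem mainTheorem8 :
    ∃ u₁ u₂ : BargainingGame → ℝ,
      -- `(u₁ B, u₂ B)` is the unique pair of equilibrium payoffs of the game `B`
      (∀ B : BargainingGame, B.Valid → ∀ p : ℝ × ℝ,
        B.IsEquilibriumPayoff p ↔ p = (u₁ B, u₂ B)) ∧
      -- an increase of `z₁` or a decrease of `r₁`
      (∀ B B' : BargainingGame, B.Valid → B'.Valid → B.Favors₁ B' →
        u₁ B ≤ u₁ B' ∧ u₂ B' ≤ u₂ B ∧
        (B.muTilde₁ B.z₂ ≤ B.z₁ → u₁ B < u₁ B') ∧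
        (B.z₁ < B.muTilde₁ B.z₂ → u₂ B' < u₂ B) ∧
        (B'.z₁ ≤ B'.muTilde₁ B'.z₂ → u₁ B' = u₁ B) ∧
        (B.muTilde₁ B.z₂ ≤ B.z₁ → u₂ B' = u₂ B)) ∧
      -- an increase of `z₂` or a decrease of `r₂`
      (∀ B B' : BargainingGame, B.Valid → B'.Valid → B.Favors₂ B' →
        u₂ B ≤ u₂ B' ∧ u₁ B' ≤ u₁ B ∧
        (B.muTilde₂ B.z₁ ≤ B.z₂ → u₂ B < u₂ B') ∧
        (B.z₂ < B.muTilde₂ B.z₁ → u₁ B' < u₁ B) ∧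
        (B'.z₂ ≤ B'.muTilde₂ B'.z₁ → u₂ B' = u₂ B) ∧
        (B.muTilde₂ B.z₁ ≤ B.z₂ → u₁ B' = u₁ B)) ∧
      -- an increase of `c₁`, a decrease of `k₂`, or a decrease of `w₁`
      (∀ B B' : BargainingGame, B.Valid → B'.Valid → B.CourtAgainst₁ B' →
        u₁ B' ≤ u₁ B ∧ u₂ B ≤ u₂ B' ∧
        (0 < B.γ₁ → B.muTilde₁ B.z₂ < B.z₁ → B.z₁ < B.muN₁ → u₁ B' < u₁ B) ∧
        (0 < B.γ₁ → B.muTilde₂ B.z₁ ≤ B.z₂ → B.z₂ < B.muStar₂ → u₂ B < u₂ B') ∧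
        (B.γ₁ = 0 ∨ B.z₁ ≤ B.muTilde₁ B.z₂ ∨ B.muN₁ ≤ B.z₁ → u₁ B' = u₁ B) ∧
        (B.γ₁ = 0 ∨ B'.z₂ ≤ B'.muTilde₂ B'.z₁ ∨ B.muStar₂ ≤ B.z₂ → u₂ B' = u₂ B)) ∧
      -- outside the stated regions, sufficiently small changes leave the payoffs constant
      (∀ B : BargainingGame, B.Valid →
        (B.z₁ < B.muTilde₁ B.z₂ →
          (∀ᶠ z in 𝓝 B.z₁, u₁ { B with z₁ := z } = u₁ B) ∧
          (∀ᶠ r in 𝓝 B.r₁, u₁ { B with r₁ := r } = u₁ B)) ∧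
        (B.z₂ < B.muTilde₂ B.z₁ →
          (∀ᶠ z in 𝓝 B.z₂, u₂ { B with z₂ := z } = u₂ B) ∧
          (∀ᶠ r in 𝓝 B.r₂, u₂ { B with r₂ := r } = u₂ B) ∧
          (∀ᶠ c in 𝓝 B.c₁, u₂ { B with c₁ := c } = u₂ B) ∧
          (∀ᶠ k in 𝓝 B.k₂, u₂ { B with k₂ := k } = u₂ B) ∧
          (∀ᶠ w in 𝓝 B.w₁, 0 ≤ w → u₂ { B with w₁ := w } = u₂ B))) :=
  ⟨BargainingGame.payoff₁, BargainingGame.payoff₂,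
    fun _ hB p => BargainingGame.isEquilibriumPayoff_iff hB p,
    fun _ _ hB hB' h => BargainingGame.payoff_of_favors₁ hB hB' h,
    fun _ _ hB hB' h => BargainingGame.payoff_of_favors₂ hB hB' h,
    fun _ _ hB hB' h => BargainingGame.payoff_of_courtAgainst₁ hB hB' h,
    fun _ hB => ⟨BargainingGame.payoff₁_locally_constant hB,
      BargainingGame.payoff₂_locally_constant hB⟩⟩
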